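/- **Model.** Let $(Z_t)_{t\in\mathbb Z}$ be independent standard normal random variables on a probability space. For $1\le t\le T$ let $X_{t,T}=\sum_{l=0}^\infty \psi_{t,T,l}Z_{t-l}$ (limit in $L_2$), where $\sup_{T\ge 1}\sup_{1\le t\le T}\sum_{l\ge 0}\psi_{t,T,l}^2<\infty$. Put $I(l)=l$ for $l\ge1$ and $I(0)=1$. Suppose there are twice continuously differentiable functions $\psi_l:[0,1]\to\mathbb R$ ($l\ge 0$), twice differentiable functions $a,d:[0,1]\to[0,\infty)$ and a constant $C$ such that, with $d_\infty=\sup_{u\in[0,1]}d(u)$: 1. $|\psi_{t,T,l}-\psi_l(t/T)|\le C\,T^{-1}I(l)^{d_\infty-1}$ for all $1\le t\le T$ and $l\ge 0$, and $\psi_l(u)=a(u)I(l)^{d(u)-1}+O(I(l)^{d_\infty-2})$ uniformly in $u\in[0,1]$ as $l\to\infty$; 2. the time varying spectral density $f(u,\lambda)=\frac1{2\pi}\bigl|\sum_{l=0}^\infty\psi_l(u)e^{-i\lambda l}\bigr|^2$ (limit of the partial sums) is twice continuously differentiable on $(0,1)\times(0,\pi)$, and $f$ and all its partial derivatives up to order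 two are continuous on $[0,1]\times(0,\pi]$ (extending continuously from the interior); 3. for $l\ge2$ and $u\in(0,1)$, $|\psi_l'(u)|\le C\log(l)\,l^{d_\infty-1}$ and $|\psi_l''(u)|\le C\log^2(l)\,l^{d_\infty-1}$; and for $\lambda\in(0,\pi]$ and $u\in(0,1)$, $|\partial_uf(u,\lambda)|\le C(1+|\log\lambda|)\lambda^{-2d_\infty}$ and $|\partial_u^2f(u,\lambda)|\le C(1+\log^2\lambda)\lambda^{-2d_\infty}$. **Quantities.** Let $$F_1=\frac1{2\pi}\int_0^1\!\int_{-\pi}^{\pi}f^2(u,\lambda)\,d\lambda\,du,\qquad F_2=\frac1{4\pi}\int_{-\pi}^{\pi}\Bigl(\int_0^1f(u,\lambda)\,du\Bigr)^2d\lambda,$$ $$D^2=\int_0^1\!\int_{-\pi}^{\pi}\Bigl(f(u,\lambda)-\int_0^1f(v,\lambda)\,dv\Bigr)^2d\lambda\,du .$$ Let $T=NM$ with positive integers $N,M$ and $N$ even, $u_j=(N(j-1)+N/2)/T$, $\lambda_{k,N}=2\pi k/N$, $$I_N(u,\lambda)=\frac1{2\pi N}\Bigl|\sum_{s=0}^{N-1}X_{\lfloor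 uT\rfloor-N/2+1+s,T}\,e^{-i\lambda s}\Bigr|^2$$ with $X_{j,T}=0$ for $j\notin\{1,\dots,T\}$, and $$\hat F_{1,T}=\frac1T\sum_{j=1}^M\sum_{k=1}^{N/2}I_N(u_j,\lambda_{k,N})^2,\qquad \hat F_{2,T}=\frac1N\sum_{k=1}^{N/2}\Bigl(\frac1M\sum_{j=1}^MI_N(u_j,\lambda_{k,N})\Bigr)^2,\qquad \hat D_T^2=2\pi\hat F_{1,T}-4\pi\hat F_{2,T}.$$ **Theorem.** Suppose that $d_\infty<1/4$ and consider any sequence of such triples $(T,N,M)$ along which $T\to\infty$, $N\to\infty$ and $N/T\to0$. Then $f^2$ is integrable on $[0,1]\times[-\pi,\pi]$ (so that $F_1$, $F_2$, $D^2$ are finite), and $$\hat F_{1,T}\to F_1,\qquad \hat F_{2,T}\to F_2,\qquad \hat D_T^2\to D^2\qquad\text{in probability.}$$ -/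

import Mathlib

open MeasureTheory ProbabilityTheory Filter Topology Set

noncomputable section

namespace LongMemory

/-- `I(l) = |l|` for `l ≠ 0` and `I(0) = 1`. -/
def idx (l : ℕ) : ℝ := if l = 0 then 1 else (l : ℝ)

/-- `d_∞ = sup_{u ∈ [0,1]} d(u)`. -/
def dSup (d : ℝ → ℝ) : ℝ := sSup (d '' Icc (0 : ℝ) 1)

/-- `∑_{l=0}^∞ ψ_l(u) exp(-iλl)`, the limit of the partial sums. The series converges only
conditionally in general, so an unconditional sum (`tsum`) would not be the right notion. -/
def transferFunction (ψ : ℕ → ℝ → ℝ) (u lam : ℝ) : ℂ :=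
  limUnder atTop (fun n : ℕ =>
    ∑ l ∈ Finset.range n, (ψ l u : ℂ) * Complex.exp (-Complex.I * (lam : ℂ) * (l : ℂ)))

/-- The time varying spectral density `f(u,λ)`. -/
def spectralDensity (ψ : ℕ → ℝ → ℝ) (u lam : ℝ) : ℝ :=
  1 / (2 * Real.pi) * ‖transferFunction ψ u lam‖ ^ 2

/-- `g` is twice differentiable on `[0,1]` (one-sided at the end points). -/
def TwiceDifferentiableOnUnit (g : ℝ → ℝ) : Prop :=
  DifferentiableOn ℝ g (Icc 0 1) ∧
    DifferentiableOn ℝ (derivWithin g (Icc 0 1)) (Icc 0 1)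

/-- The locally stationary long-memory model. The observations are `X t T` for `1 ≤ t ≤ T`,
the innovations are `Z`, the coefficients `ψ_{t,T,l}` are `ψT t T l`, and `ψ l`, `a`, `d`
are functions on `[0,1]` (their values elsewhere play no role). -/
structure IsLocallyStationary {Ω : Type*} [MeasurableSpace Ω] (P : Measure Ω)
    (X : ℕ → ℕ → Ω → ℝ) (Z : ℤ → Ω → ℝ) (ψT : ℕ → ℕ → ℕ → ℝ)
    (ψ : ℕ → ℝ → ℝ) (a d : ℝ → ℝ) : Prop where
  /-- the innovations are independent -/
  indep : iIndepFun Z P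
  /-- the innovations are standard normal -/
  gaussian : ∀ t : ℤ, HasLaw (Z t) (gaussianReal 0 1) P
  /-- the squared coefficients are summable, with uniformly bounded sums -/
  sq_summable : ∃ K : ℝ, ∀ T t : ℕ, 1 ≤ t → t ≤ T →
    Summable (fun l => ψT t T l ^ 2) ∧ ∑' l, ψT t T l ^ 2 ≤ K
  aemeasurable : ∀ T t : ℕ, 1 ≤ t → t ≤ T → AEMeasurable (X t T) P
  /-- `X_{t,T} = ∑_{l=0}^∞ ψ_{t,T,l} Z_{t-l}`, as a limit in `L²(P)` -/
  ma_representation : ∀ T t : ℕ, 1 ≤ t → t ≤ T →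
    Tendsto (fun n : ℕ => eLpNorm
      (fun ω => X t T ω - ∑ l ∈ Finset.range n, ψT t T l * Z ((t : ℤ) - (l : ℤ)) ω) 2 P)
      atTop (𝓝 0)
  psi_contDiff : ∀ l : ℕ, ContDiffOn ℝ 2 (ψ l) (Icc 0 1)
  a_nonneg : ∀ u ∈ Icc (0 : ℝ) 1, 0 ≤ a u
  d_nonneg : ∀ u ∈ Icc (0 : ℝ) 1, 0 ≤ d u
  a_diff : TwiceDifferentiableOnUnit a
  d_diff : TwiceDifferentiableOnUnit d
  /-- local approximation of the coefficients -/
  approx : ∃ C : ℝ, ∀ T t : ℕ, 1 ≤ t → t ≤ T → ∀ l : ℕ,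
    |ψT t T l - ψ l ((t : ℝ) / T)| ≤ C / (T * idx l ^ (1 - dSup d))
  /-- `ψ_l(u) = a(u) / I(l)^{1-d(u)} + O(1 / I(l)^{2-d_∞})` uniformly in `u` as `l → ∞` -/
  psi_asymp : ∃ C : ℝ, ∀ᶠ l : ℕ in atTop, ∀ u ∈ Icc (0 : ℝ) 1,
    |ψ l u - a u / idx l ^ (1 - d u)| ≤ C / idx l ^ (2 - dSup d)
  /-- `f` is `C²` on `(0,1) × (0,π)`, and `f` and its partial derivatives up to order two
  are continuous on `[0,1] × (0,π]` -/
  f_contDiff : ContDiffOn ℝ 2 (fun p : ℝ × ℝ => spectralDensity ψ p.1 p.2)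
    (Icc (0 : ℝ) 1 ×ˢ Ioc (0 : ℝ) Real.pi)
  psi_deriv : ∃ C : ℝ, ∀ l : ℕ, 2 ≤ l → ∀ u ∈ Ioo (0 : ℝ) 1,
    |deriv (ψ l) u| ≤ C * Real.log l / (l : ℝ) ^ (1 - dSup d)
  psi_deriv2 : ∃ C : ℝ, ∀ l : ℕ, 2 ≤ l → ∀ u ∈ Ioo (0 : ℝ) 1,
    |deriv (deriv (ψ l)) u| ≤ C * Real.log l ^ 2 / (l : ℝ) ^ (1 - dSup d)
  f_deriv : ∃ C : ℝ, ∀ lam ∈ Ioc (0 : ℝ) Real.pi, ∀ u ∈ Ioo (0 : ℝ) 1,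
    |deriv (fun v => spectralDensity ψ v lam) u|
      ≤ C * (1 + |Real.log lam|) / lam ^ (2 * dSup d)
  f_deriv2 : ∃ C : ℝ, ∀ lam ∈ Ioc (0 : ℝ) Real.pi, ∀ u ∈ Ioo (0 : ℝ) 1,
    |deriv (deriv (fun v => spectralDensity ψ v lam)) u|
      ≤ C * (1 + Real.log lam ^ 2) / lam ^ (2 * dSup d)

/-- `F₁ = (1/2π) ∫₀¹ ∫_{-π}^{π} f²(u,λ) dλ du`. -/
def F1 (f : ℝ → ℝ → ℝ) : ℝ :=
  1 / (2 * Real.pi) * ∫ u in (0 : ℝ)..1, ∫ lam in (-Real.pi)..Real.pi, f u lam ^ 2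

/-- `F₂ = (1/4π) ∫_{-π}^{π} (∫₀¹ f(u,λ) du)² dλ`. -/
def F2 (f : ℝ → ℝ → ℝ) : ℝ :=
  1 / (4 * Real.pi) * ∫ lam in (-Real.pi)..Real.pi, (∫ u in (0 : ℝ)..1, f u lam) ^ 2

/-- `D² = ∫₀¹ ∫_{-π}^{π} (f(u,λ) - ∫₀¹ f(v,λ) dv)² dλ du`. -/
def Dsq (f : ℝ → ℝ → ℝ) : ℝ :=
  ∫ u in (0 : ℝ)..1, ∫ lam in (-Real.pi)..Real.pi,
    (f u lam - ∫ v in (0 : ℝ)..1, f v lam) ^ 2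

/-- The sample `x 1, …, x T`, extended by zero to all integer times. -/
def zeroExtend (x : ℕ → ℝ) (T : ℕ) (j : ℤ) : ℝ :=
  if 1 ≤ j ∧ j ≤ (T : ℤ) then x j.toNat else 0

/-- The local periodogram `I_N(u,λ)` of the sample `x 1, …, x T` (`N` even). -/
def localPeriodogram (x : ℕ → ℝ) (T N : ℕ) (u lam : ℝ) : ℝ :=
  1 / (2 * Real.pi * N) *
    ‖∑ s ∈ Finset.range N,
      (zeroExtend x T (⌊u * (T : ℝ)⌋ - ((N / 2 : ℕ) : ℤ) + 1 + (s : ℤ)) : ℂ) *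
        Complex.exp (-Complex.I * (lam : ℂ) * (s : ℂ))‖ ^ 2

/-- The rescaled midpoint `u_j = (N(j-1) + N/2) / T` of the `j`-th block, `j ≥ 1`. -/
def blockMid (T N j : ℕ) : ℝ := ((N : ℝ) * ((j : ℝ) - 1) + (N : ℝ) / 2) / (T : ℝ)

/-- The Fourier frequency `λ_{k,N} = 2πk/N`. -/
def fourierFreq (N k : ℕ) : ℝ := 2 * Real.pi * (k : ℝ) / (N : ℝ)

/-- `F̂_{1,T}`, computed from the sample `x 1, …, x T` with `M` blocks of length `N`. -/
def F1hat (x : ℕ → ℝ) (T N M : ℕ) : ℝ :=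
  1 / (T : ℝ) * ∑ j ∈ Finset.Icc 1 M, ∑ k ∈ Finset.Icc 1 (N / 2),
    localPeriodogram x T N (blockMid T N j) (fourierFreq N k) ^ 2

/-- `F̂_{2,T}`, computed from the sample `x 1, …, x T` with `M` blocks of length `N`. -/
def F2hat (x : ℕ → ℝ) (T N M : ℕ) : ℝ :=
  1 / (N : ℝ) * ∑ k ∈ Finset.Icc 1 (N / 2),
    (1 / (M : ℝ) * ∑ j ∈ Finset.Icc 1 M,
      localPeriodogram x T N (blockMid T N j) (fourierFreq N k)) ^ 2

/-- `D̂²_T = 2π F̂_{1,T} - 4π F̂_{2,T}`. -/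
def DsqHat (x : ℕ → ℝ) (T N M : ℕ) : ℝ :=
  2 * Real.pi * F1hat x T N M - 4 * Real.pi * F2hat x T N M

end LongMemory

end

/-! On each block the Fourier transform of the data is compared with `transferFunction ψ u_j λ`
times the Fourier transform of the innovations (Bartlett's approximation). The error is an L² limit
of Gaussian linear forms, so its fourth moment is controlled by the sum of squares of the
coefficients `errCoef`. Up to a phase, the coefficient of an innovation inside the block is a
partial sum of the transfer function, taken along slowly drifting times, minus the full sum; for an
earlier innovation it is a window of that series. `SlowlyVarying` records what Abel summation needs
in order to bound such sums, uniformly by a multiple of λ^(-D) and by a multiple of m^(D-1)/λ when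
the window starts near lag m. Here D lies strictly between d_∞ and 1/4. It follows
(`IsLocallyStationary.exists_bartlett`) that the mean square error of the local periodogram is at
most C λ^(-4D) and tends to zero at positive frequencies. Since 4D < 1, this bound is integrable at
frequency zero, and dominated convergence for Riemann sums (`tendsto_double_riemann_sum`) shows that
the error averaged over the grid vanishes. The same bound dominates f²; this is where d_∞ < 1/4
enters.

It remains to treat f times the innovation periodogram. At a Fourier frequency with 0 < 2k < N the
innovation transform is circular Gaussian, so its normalised periodogram has mean 1 and second
moment 2. Distinct blocks use disjoint innovations, hence are independent, and their number M = T/N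
tends to infinity; averages over blocks therefore concentrate, and no independence between
frequencies is needed. In F̂₁ the square sits inside the average and produces the factor 2; in F̂₂
the average over blocks is taken before squaring, so only the mean 1 survives. The Riemann sums then
converge to F₁ and F₂. Convergence is proved in L¹ (`tendsto_integral_abs_gridAvg_sq_sub`,
`tendsto_integral_abs_avgSq_sub`), and D² = 2πF₁ - 4πF₂ follows by expanding the square. -/

namespace LongMemory

/-! ### Riemann sums with an integrable singularity at zero. -/

theorem integral_ceil_step (g : ℕ → ℝ) {N : ℕ} (hN : 0 < N) (m : ℕ) :
    IntervalIntegrable (fun x : ℝ => g ⌈x * N⌉₊) volume 0 ((m : ℝ) / N) ∧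
      ∫ x in (0 : ℝ)..((m : ℝ) / N), g ⌈x * N⌉₊ = 1 / (N : ℝ) * ∑ k ∈ Finset.Icc 1 m, g k := by
  have hN' : (0 : ℝ) < N := by exact_mod_cast hN
  induction m with
  | zero => simp
  | succ m ih =>
    have hle : (m : ℝ) / N ≤ ((m + 1 : ℕ) : ℝ) / N := by
      gcongr; linarith
    have hEq : EqOn (fun _ => g (m + 1)) (fun x : ℝ => g ⌈x * N⌉₊)
        (uIoc ((m : ℝ) / N) (((m + 1 : ℕ) : ℝ) / N)) := by
      intro x hx
      rw [uIoc_of_le hle, mem_Ioc, div_lt_iff₀ hN', le_div_iff₀ hN'] at hx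
      have : ⌈x * N⌉₊ = m + 1 := by
        rw [Nat.ceil_eq_iff (by omega)]
        simpa using hx
      simp [this]
    have h2 : IntervalIntegrable (fun x : ℝ => g ⌈x * N⌉₊) volume ((m : ℝ) / N)
        (((m + 1 : ℕ) : ℝ) / N) :=
      (intervalIntegrable_const (c := g (m + 1))).congr hEq
    refine ⟨ih.1.trans h2, ?_⟩
    rw [← intervalIntegral.integral_add_adjacent_intervals ih.1 h2, ih.2,
      Finset.sum_Icc_succ_top (by omega), mul_add]
    congr 1
    rw [← intervalIntegral.integral_congr_ae (f := fun _ => g (m + 1))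
      (Eventually.of_forall fun x hx => hEq hx)]
    rw [intervalIntegral.integral_const, smul_eq_mul]
    push_cast
    ring

/-- Riemann sums over the nodes `k / N`, `1 ≤ k ≤ c N`, converge under an integrable power bound. -/
theorem tendsto_riemann_sum {N m : ℕ → ℕ} {c β C : ℝ} (hNpos : ∀ n, 0 < N n)
    (hm : ∀ n, (m n : ℝ) / N n = c) (hβ : β < 1) (hβ0 : 0 ≤ β) (hC : 0 ≤ C)
    {g : ℕ → ℕ → ℝ} {G : ℝ → ℝ}
    (hb : ∀ n, ∀ k ∈ Finset.Icc 1 (m n), |g n k| ≤ C * ((k : ℝ) / N n) ^ (-β))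
    (hg : ∀ x ∈ Ioo 0 c, Tendsto (fun n => g n ⌈x * N n⌉₊) atTop (𝓝 (G x))) :
    Tendsto (fun n => 1 / (N n : ℝ) * ∑ k ∈ Finset.Icc 1 (m n), g n k) atTop
      (𝓝 (∫ x in (0 : ℝ)..c, G x)) := by
  have hc : 0 ≤ c := by rw [← hm 0]; positivity
  -- The sum is the integral of a step function, so dominated convergence applies. The nodes are
  -- right end points, hence x ≤ ⌈xN⌉/N and the decreasing bound at the node is below C x^(-β).
  have hEq : ∀ n, 1 / (N n : ℝ) * ∑ k ∈ Finset.Icc 1 (m n), g n k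
      = ∫ x in (0 : ℝ)..c, g n ⌈x * N n⌉₊ := fun n => by
    rw [← (integral_ceil_step (g n) (hNpos n) (m n)).2, hm n]
  simp_rw [hEq]
  have hne : ∀ᵐ x : ℝ, x ≠ c := by simp [ae_iff]
  refine intervalIntegral.tendsto_integral_filter_of_dominated_convergence
    (fun x => C * x ^ (-β)) (Eventually.of_forall fun n => ?_)
    (Eventually.of_forall fun n => Eventually.of_forall fun x hx => ?_) ?_ ?_
  · have := (integral_ceil_step (g n) (hNpos n) (m n)).1
    rw [hm n] at this
    rw [uIoc_of_le hc]
    exact ((intervalIntegrable_iff_integrableOn_Ioc_of_le hc).1 this).aestronglyMeasurable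
  · rw [uIoc_of_le hc] at hx
    have hN' : (0 : ℝ) < N n := by exact_mod_cast hNpos n
    have hle : x ≤ (⌈x * N n⌉₊ : ℝ) / N n := by
      rw [le_div_iff₀ hN']; exact Nat.le_ceil _
    have hmem : ⌈x * N n⌉₊ ∈ Finset.Icc 1 (m n) := by
      rw [Finset.mem_Icc]
      refine ⟨Nat.ceil_pos.2 (mul_pos hx.1 hN'), Nat.ceil_le.2 ?_⟩
      rw [← le_div_iff₀ hN', hm n]; exact hx.2
    refine (hb n _ hmem).trans ?_
    exact mul_le_mul_of_nonneg_left (Real.rpow_le_rpow_of_nonpos hx.1 hle (by linarith)) hC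
  · exact (intervalIntegral.intervalIntegrable_rpow' (by linarith)).const_mul C
  · filter_upwards [hne] with x hx hx2
    rw [uIoc_of_le hc] at hx2
    exact hg x ⟨hx2.1, lt_of_le_of_ne hx2.2 hx⟩

theorem tendsto_ceil_mul_div {N : ℕ → ℕ} (hN : Tendsto N atTop atTop) {x : ℝ} (hx : 0 ≤ x) :
    Tendsto (fun n => (⌈x * N n⌉₊ : ℝ) / N n) atTop (𝓝 x) :=
  (tendsto_nat_ceil_mul_div_atTop hx).comp (tendsto_natCast_atTop_atTop.comp hN)

end LongMemory

/-! ### Abel summation for slowly varying coefficients. -/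

namespace LongMemory

theorem rpow_sub_one_sub_le {p x : ℝ} (hp : -1 ≤ p) (hp0 : p ≤ 0) (hx : 0 < x) :
    x ^ p - (x + 1) ^ p ≤ x ^ (p - 1) := by
  obtain ⟨ξ, hξ, h⟩ := exists_deriv_eq_slope (fun y : ℝ => y ^ p) (show x < x + 1 by linarith)
    (fun y hy => (Real.continuousAt_rpow_const y p
      (Or.inl (by linarith [hy.1]))).continuousWithinAt)
    (fun y hy => (Real.differentiableAt_rpow_const_of_ne p
      (by linarith [hy.1])).differentiableWithinAt)
  have hξ0 : 0 < ξ := hx.trans hξ.1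
  rw [Real.deriv_rpow_const] at h
  simp only [add_sub_cancel_left, div_one] at h
  have h1 : ξ ^ (p - 1) ≤ x ^ (p - 1) :=
    Real.rpow_le_rpow_of_nonpos hx hξ.1.le (by linarith)
  have h2 : 0 < ξ ^ (p - 1) := Real.rpow_pos_of_pos hξ0 _
  nlinarith

/-- The mean value theorem turns the power into a telescoping difference. The intermediate point is
at most x + 1 ≤ 2x, and 2^(-s-1) ≥ 1/4 gives the factor 4. -/
theorem rpow_neg_sub_one_le {s x : ℝ} (hs : 0 < s) (hs1 : s ≤ 1) (hx : 1 ≤ x) :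
    x ^ (-s - 1) ≤ 4 / s * (x ^ (-s) - (x + 1) ^ (-s)) := by
  have hx0 : 0 < x := by linarith
  obtain ⟨ξ, hξ, h⟩ := exists_deriv_eq_slope (fun y : ℝ => y ^ (-s)) (show x < x + 1 by linarith)
    (fun y hy => (Real.continuousAt_rpow_const y (-s)
      (Or.inl (by linarith [hy.1]))).continuousWithinAt)
    (fun y hy => (Real.differentiableAt_rpow_const_of_ne (-s)
      (by linarith [hy.1])).differentiableWithinAt)
  have hξ0 : 0 < ξ := hx0.trans hξ.1
  rw [Real.deriv_rpow_const] at h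
  simp only [add_sub_cancel_left, div_one] at h
  have h1 : (2 * x) ^ (-s - 1) ≤ ξ ^ (-s - 1) :=
    Real.rpow_le_rpow_of_nonpos hξ0 (by linarith [hξ.2]) (by linarith)
  rw [Real.mul_rpow (by norm_num) hx0.le] at h1
  have h2 : (1 / 4 : ℝ) ≤ 2 ^ (-s - 1) := by
    calc (1 / 4 : ℝ) = 2 ^ (-2 : ℝ) := by
          rw [Real.rpow_neg (by norm_num)]; norm_num
      _ ≤ _ := Real.rpow_le_rpow_of_exponent_le (by norm_num) (by linarith)
  have h3 : 0 < x ^ (-s - 1) := Real.rpow_pos_of_pos hx0 _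
  have h4 : x ^ (-s) - (x + 1) ^ (-s) = s * ξ ^ (-s - 1) := by linarith
  rw [h4]
  have : 4 / s * (s * ξ ^ (-s - 1)) = 4 * ξ ^ (-s - 1) := by field_simp
  rw [this]
  nlinarith

theorem rpow_add_one_le {D x : ℝ} (hD : 0 < D) (hD1 : D ≤ 1) (hx : 0 ≤ x) :
    (x + 1) ^ (D - 1) ≤ 1 / D * ((x + 1) ^ D - x ^ D) := by
  obtain ⟨ξ, hξ, h⟩ := exists_deriv_eq_slope (fun y : ℝ => y ^ D) (show x < x + 1 by linarith)
    (fun y hy => (Real.continuousAt_rpow_const y D (Or.inr hD.le)).continuousWithinAt)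
    (fun y hy => (Real.differentiableAt_rpow_const_of_ne D
      (by linarith [hy.1])).differentiableWithinAt)
  have hξ0 : 0 < ξ := hx.trans_lt hξ.1
  rw [Real.deriv_rpow_const] at h
  simp only [add_sub_cancel_left, div_one] at h
  have h1 : (x + 1) ^ (D - 1) ≤ ξ ^ (D - 1) :=
    Real.rpow_le_rpow_of_nonpos hξ0 hξ.2.le (by linarith)
  rw [← h]
  have : 1 / D * (D * ξ ^ (D - 1)) = ξ ^ (D - 1) := by field_simp
  rw [this]; exact h1

/-- Tail sums of `(l + 1) ^ (-s - 1)`. -/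
theorem sum_Ico_rpow_neg_le {s : ℝ} (hs : 0 < s) (hs1 : s ≤ 1) {m n : ℕ} (hmn : m ≤ n) :
    ∑ l ∈ Finset.Ico m n, ((l : ℝ) + 1) ^ (-s - 1) ≤ 4 / s * ((m : ℝ) + 1) ^ (-s) := by
  have h : ∑ l ∈ Finset.Ico m n, ((l : ℝ) + 1) ^ (-s - 1)
      ≤ 4 / s * (((m : ℝ) + 1) ^ (-s) - ((n : ℝ) + 1) ^ (-s)) := by
    induction n, hmn using Nat.le_induction with
    | base => simp
    | succ n hn ih =>
      rw [Finset.sum_Ico_succ_top hn]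
      have := rpow_neg_sub_one_le hs hs1 (x := (n : ℝ) + 1) (by linarith [n.cast_nonneg (α := ℝ)])
      push_cast
      linarith
  refine h.trans (mul_le_mul_of_nonneg_left ?_ (by positivity))
  have : 0 ≤ ((n : ℝ) + 1) ^ (-s) := by positivity
  linarith

/-- Initial sums of `(l + 1) ^ (D - 1)`. -/
theorem sum_range_rpow_le {D : ℝ} (hD : 0 < D) (hD1 : D ≤ 1) (n : ℕ) :
    ∑ l ∈ Finset.range n, ((l : ℝ) + 1) ^ (D - 1) ≤ 1 / D * (n : ℝ) ^ D := by
  induction n with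
  | zero => simp [Real.zero_rpow hD.ne']
  | succ n ih =>
    rw [Finset.sum_range_succ]
    have := rpow_add_one_le hD hD1 n.cast_nonneg
    push_cast
    linarith

/-- `exp(-iλ)`-Abel summation, in the form of a bound. -/
theorem norm_sum_Ico_mul_pow_le {z : ℂ} (hz : ‖z‖ = 1) (g : ℕ → ℝ) {m n : ℕ} (hmn : m < n) :
    ‖z - 1‖ * ‖∑ l ∈ Finset.Ico m n, (g l : ℂ) * z ^ l‖
      ≤ |g m| + |g (n - 1)| + ∑ l ∈ Finset.Ico m (n - 1), |g (l + 1) - g l| := by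
  have key : ∀ n, m < n → (z - 1) * ∑ l ∈ Finset.Ico m n, (g l : ℂ) * z ^ l
      = g (n - 1) * z ^ n - g m * z ^ m
        - ∑ l ∈ Finset.Ico m (n - 1), ((g (l + 1) - g l : ℝ) : ℂ) * z ^ (l + 1) := by
    intro n hn
    induction n, hn using Nat.le_induction with
    | base => simp; ring
    | succ n hn ih =>
      have h1 : m ≤ n - 1 := by omega
      obtain ⟨k, rfl⟩ : ∃ k, n = k + 1 := ⟨n - 1, by omega⟩
      rw [Finset.sum_Ico_succ_top (by omega), mul_add, ih]
      simp only [Nat.add_sub_cancel]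
      rw [Finset.sum_Ico_succ_top (by omega)]
      push_cast
      ring
  rw [← norm_mul, key n hmn]
  refine (norm_sub_le _ _).trans (add_le_add ((norm_sub_le _ _).trans ?_) ?_)
  · simp [hz, add_comm]
  · refine (norm_sum_le _ _).trans (Finset.sum_le_sum fun l _ => ?_)
    rw [norm_mul, norm_pow, hz, one_pow, mul_one, Complex.norm_real, Real.norm_eq_abs]

/-- The modulus is 2 sin(λ/2). Jordan's inequality bounds the sine below by λ/π, and π ≤ 4. -/
theorem norm_exp_neg_sub_one {lam : ℝ} (h0 : 0 < lam) (hpi : lam ≤ Real.pi) :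
    lam / 2 ≤ ‖Complex.exp (-Complex.I * lam) - 1‖ := by
  have h : Complex.exp (-Complex.I * lam) - 1
      = Complex.exp (Complex.I * ((-lam : ℝ) : ℂ)) - 1 := by
    congr 2; push_cast; ring
  rw [h, Complex.norm_exp_I_mul_ofReal_sub_one]
  have h1 := Real.mul_le_sin (x := lam / 2) (by linarith) (by linarith)
  have h2 : Real.sin (-lam / 2) = - Real.sin (lam / 2) := by rw [neg_div, Real.sin_neg]
  rw [h2, Real.norm_eq_abs, abs_mul, abs_neg, abs_of_pos (by norm_num : (0 : ℝ) < 2)]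
  have h3 : 2 / Real.pi * (lam / 2) = lam / Real.pi := by ring
  rw [h3] at h1
  have h4 : lam / 4 ≤ lam / Real.pi :=
    div_le_div_of_nonneg_left h0.le Real.pi_pos Real.pi_le_four
  have := le_abs_self (Real.sin (lam / 2))
  linarith

/-- The character `exp(-iλl)`. -/
noncomputable def phase (lam : ℝ) (l : ℕ) : ℂ := Complex.exp (-Complex.I * (lam : ℂ) * (l : ℂ))

theorem phase_eq_pow (lam : ℝ) (l : ℕ) :
    phase lam l = Complex.exp (-Complex.I * lam) ^ l := by
  rw [phase, ← Complex.exp_nat_mul]; congr 1; ring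

theorem norm_exp_neg_I_mul (lam : ℝ) : ‖Complex.exp (-Complex.I * lam)‖ = 1 := by
  rw [Complex.norm_exp]; simp

theorem norm_phase (lam : ℝ) (l : ℕ) : ‖phase lam l‖ = 1 := by
  rw [phase_eq_pow, norm_pow, norm_exp_neg_I_mul, one_pow]

theorem phase_add (lam : ℝ) (k l : ℕ) : phase lam (k + l) = phase lam k * phase lam l := by
  rw [phase_eq_pow, phase_eq_pow, phase_eq_pow, pow_add]

/-- A real sequence which on `[m, n)` is, up to summable errors, of bounded variation with
the rate of `(l + 1) ^ (D - 1)`. The parameter `τ` measures an additional drift. -/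
structure SlowlyVarying (D κ τ : ℝ) (m n : ℕ) (β : ℕ → ℝ) : Prop where
  exists_main : ∃ g : ℕ → ℝ,
    (∀ l, m ≤ l → l < n →
      |β l - g l| ≤ κ * (((l : ℝ) + 1) ^ (D - 2) + τ * ((l : ℝ) + 1) ^ (D - 1))) ∧
    (∀ l, m ≤ l → l < n → |g l| ≤ κ * ((l : ℝ) + 1) ^ (D - 1)) ∧
    (∀ l, m ≤ l → l + 1 < n →
      |g (l + 1) - g l| ≤ κ * (((l : ℝ) + 1) ^ (D - 2) + τ * ((l : ℝ) + 1) ^ (D - 1)))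

theorem SlowlyVarying.mono {D κ τ : ℝ} {m n m' n' : ℕ} {β : ℕ → ℝ}
    (h : SlowlyVarying D κ τ m n β) (hm : m ≤ m') (hn : n' ≤ n) :
    SlowlyVarying D κ τ m' n' β := by
  obtain ⟨g, h1, h2, h3⟩ := h.exists_main
  exact ⟨g, fun l hl hl' => h1 l (hm.trans hl) (hl'.trans_le hn),
    fun l hl hl' => h2 l (hm.trans hl) (hl'.trans_le hn),
    fun l hl hl' => h3 l (hm.trans hl) (hl'.trans_le hn)⟩

theorem sum_error_le {D τ : ℝ} (hD0 : 0 < D) (hD1 : D < 1 / 4) (hτ : 0 ≤ τ) {m n : ℕ}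
    (hmn : m ≤ n) (hτn : τ * ((n : ℝ) - m) ≤ 1) :
    ∑ l ∈ Finset.Ico m n, (((l : ℝ) + 1) ^ (D - 2) + τ * ((l : ℝ) + 1) ^ (D - 1))
      ≤ 7 * ((m : ℝ) + 1) ^ (D - 1) := by
  have hp : 0 ≤ ((m : ℝ) + 1) ^ (D - 1) := by positivity
  rw [Finset.sum_add_distrib]
  have h1 := sum_Ico_rpow_neg_le (s := 1 - D) (by linarith) (by linarith) hmn
  have e1 : -(1 - D) - 1 = D - 2 := by ring
  have e2 : -(1 - D) = D - 1 := by ring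
  rw [e1, e2] at h1
  -- The constant 7 is 6 from the summable part plus 1 from the drift, whose total over the window
  -- is at most 1.
  have h2 : 4 / (1 - D) ≤ 6 := by
    rw [div_le_iff₀ (by linarith)]; linarith
  have h3 : ∑ l ∈ Finset.Ico m n, τ * ((l : ℝ) + 1) ^ (D - 1)
      ≤ ∑ l ∈ Finset.Ico m n, τ * ((m : ℝ) + 1) ^ (D - 1) := by
    refine Finset.sum_le_sum fun l hl => mul_le_mul_of_nonneg_left ?_ hτ
    have : (m : ℝ) ≤ l := by exact_mod_cast (Finset.mem_Ico.1 hl).1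
    exact Real.rpow_le_rpow_of_nonpos (by positivity) (by linarith) (by linarith)
  rw [Finset.sum_const, Nat.card_Ico, nsmul_eq_mul, Nat.cast_sub hmn] at h3
  nlinarith

/-- The comparison sequence g has boundary values and total variation of order (m+1)^(D-1), so Abel
summation gains 1/λ; the difference β - g is absolutely summable with the same rate. -/
theorem SlowlyVarying.norm_sum_le_div {D κ τ : ℝ} {m n : ℕ} {β : ℕ → ℝ}
    (h : SlowlyVarying D κ τ m n β) (hD0 : 0 < D) (hD1 : D < 1 / 4) (hκ : 0 ≤ κ) (hτ : 0 ≤ τ)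
    (hτn : τ * ((n : ℝ) - m) ≤ 1) {lam : ℝ} (h0 : 0 < lam) (hpi : lam ≤ Real.pi) :
    ‖∑ l ∈ Finset.Ico m n, (β l : ℂ) * phase lam l‖
      ≤ 50 * κ * ((m : ℝ) + 1) ^ (D - 1) / lam := by
  have hp : 0 ≤ ((m : ℝ) + 1) ^ (D - 1) := by positivity
  rcases le_or_gt n m with hnm | hmn
  · rw [Finset.Ico_eq_empty_of_le hnm]; simp only [Finset.sum_empty, norm_zero]; positivity
  obtain ⟨g, h1, h2, h3⟩ := h.exists_main
  have hsplit : ∑ l ∈ Finset.Ico m n, (β l : ℂ) * phase lam l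
      = ∑ l ∈ Finset.Ico m n, ((β l - g l : ℝ) : ℂ) * phase lam l
        + ∑ l ∈ Finset.Ico m n, (g l : ℂ) * phase lam l := by
    rw [← Finset.sum_add_distrib]
    refine Finset.sum_congr rfl fun l _ => ?_
    push_cast; ring
  have hE := sum_error_le hD0 hD1 hτ hmn.le hτn
  have hA : ‖∑ l ∈ Finset.Ico m n, ((β l - g l : ℝ) : ℂ) * phase lam l‖
      ≤ 7 * κ * ((m : ℝ) + 1) ^ (D - 1) := by
    calc _ ≤ ∑ l ∈ Finset.Ico m n,
          κ * (((l : ℝ) + 1) ^ (D - 2) + τ * ((l : ℝ) + 1) ^ (D - 1)) := by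
          refine (norm_sum_le _ _).trans (Finset.sum_le_sum fun l hl => ?_)
          rw [norm_mul, norm_phase, mul_one, Complex.norm_real, Real.norm_eq_abs]
          exact h1 l (Finset.mem_Ico.1 hl).1 (Finset.mem_Ico.1 hl).2
      _ ≤ _ := by rw [← Finset.mul_sum]; nlinarith
  have hB : ‖∑ l ∈ Finset.Ico m n, (g l : ℂ) * phase lam l‖
      ≤ 18 * κ * ((m : ℝ) + 1) ^ (D - 1) / lam := by
    -- The 18 is 2 · (1 + 1 + 7): two boundary terms and the variation, divided by |z - 1| ≥ λ/2.
    have hab := norm_sum_Ico_mul_pow_le (norm_exp_neg_I_mul lam) g hmn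
    simp_rw [← phase_eq_pow] at hab
    have hz := norm_exp_neg_sub_one h0 hpi
    have hlast : |g (n - 1)| ≤ κ * ((m : ℝ) + 1) ^ (D - 1) := by
      refine (h2 (n - 1) (by omega) (by omega)).trans (mul_le_mul_of_nonneg_left ?_ hκ)
      have : (m : ℝ) ≤ (n - 1 : ℕ) := by exact_mod_cast (by omega : m ≤ n - 1)
      exact Real.rpow_le_rpow_of_nonpos (by positivity) (by linarith) (by linarith)
    have hvar : ∑ l ∈ Finset.Ico m (n - 1), |g (l + 1) - g l|
        ≤ 7 * κ * ((m : ℝ) + 1) ^ (D - 1) := by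
      have hE' := sum_error_le (n := n - 1) hD0 hD1 hτ (by omega) (le_trans
        (mul_le_mul_of_nonneg_left (sub_le_sub_right (by exact_mod_cast Nat.sub_le n 1) _) hτ) hτn)
      calc _ ≤ ∑ l ∈ Finset.Ico m (n - 1),
            κ * (((l : ℝ) + 1) ^ (D - 2) + τ * ((l : ℝ) + 1) ^ (D - 1)) := by
            refine Finset.sum_le_sum fun l hl => ?_
            have := Finset.mem_Ico.1 hl
            exact h3 l this.1 (by omega)
        _ ≤ _ := by rw [← Finset.mul_sum]; nlinarith
    have hfst := h2 m le_rfl hmn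
    rw [le_div_iff₀ h0]
    have hn : 0 ≤ ‖∑ l ∈ Finset.Ico m n, (g l : ℂ) * phase lam l‖ := norm_nonneg _
    nlinarith
  have hlam : lam ≤ 4 := hpi.trans Real.pi_le_four
  have hA' : 7 * κ * ((m : ℝ) + 1) ^ (D - 1) ≤ 28 * κ * ((m : ℝ) + 1) ^ (D - 1) / lam := by
    rw [le_div_iff₀ h0]
    have : 0 ≤ κ * ((m : ℝ) + 1) ^ (D - 1) := by positivity
    nlinarith
  rw [hsplit]
  refine (norm_add_le _ _).trans ((add_le_add (hA.trans hA') hB).trans ?_)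
  rw [← add_div]
  gcongr
  have : 0 ≤ κ * ((m : ℝ) + 1) ^ (D - 1) := by positivity
  nlinarith

theorem SlowlyVarying.abs_le {D κ τ : ℝ} {m n : ℕ} {β : ℕ → ℝ}
    (h : SlowlyVarying D κ τ m n β) (hκ : 0 ≤ κ) (hτ : τ ≤ 1) {l : ℕ} (hl : m ≤ l) (hl' : l < n) :
    |β l| ≤ 3 * κ * ((l : ℝ) + 1) ^ (D - 1) := by
  obtain ⟨g, h1, h2, -⟩ := h.exists_main
  have e1 := h1 l hl hl'
  have e2 := h2 l hl hl'
  have hp : 0 ≤ ((l : ℝ) + 1) ^ (D - 1) := by positivity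
  have e3 : ((l : ℝ) + 1) ^ (D - 2) ≤ ((l : ℝ) + 1) ^ (D - 1) :=
    Real.rpow_le_rpow_of_exponent_le (by linarith [l.cast_nonneg (α := ℝ)]) (by linarith)
  have e4 : |β l| ≤ |β l - g l| + |g l| := by
    have := abs_add_le (β l - g l) (g l); simpa using this
  have e5 : τ * ((l : ℝ) + 1) ^ (D - 1) ≤ ((l : ℝ) + 1) ^ (D - 1) := by nlinarith
  have e6 : κ * (((l : ℝ) + 1) ^ (D - 2) + τ * ((l : ℝ) + 1) ^ (D - 1))
      ≤ κ * (2 * ((l : ℝ) + 1) ^ (D - 1)) := mul_le_mul_of_nonneg_left (by linarith) hκ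
  linarith

/-- The sum is cut at lag 1/λ. Below the cut absolute values sum to order λ^(-D)/D; above it Abel
summation gives (1/λ)^(D-1)/λ = λ^(-D). -/
theorem SlowlyVarying.norm_sum_le_rpow {D κ τ : ℝ} {m n : ℕ} {β : ℕ → ℝ}
    (h : SlowlyVarying D κ τ m n β) (hD0 : 0 < D) (hD1 : D < 1 / 4) (hκ : 0 ≤ κ) (hτ : 0 ≤ τ)
    (hτ1 : τ ≤ 1)
    (hτn : τ * ((n : ℝ) - m) ≤ 1) {lam : ℝ} (h0 : 0 < lam) (hpi : lam ≤ Real.pi) :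
    ‖∑ l ∈ Finset.Ico m n, (β l : ℂ) * phase lam l‖ ≤ κ * (50 + 15 / D) * lam ^ (-D) := by
  rcases le_or_gt n m with hnm | hmn
  · rw [Finset.Ico_eq_empty_of_le hnm]; simp only [Finset.sum_empty, norm_zero]; positivity
  have hlam4 : lam ≤ 4 := hpi.trans Real.pi_le_four
  set L : ℕ := ⌈1 / lam⌉₊ with hL
  have hL1 : 1 / lam ≤ L := Nat.le_ceil _
  have hL2 : (L : ℝ) ≤ 5 / lam := by
    have := (Nat.ceil_lt_add_one (by positivity : (0 : ℝ) ≤ 1 / lam)).le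
    refine this.trans ?_
    rw [div_add_one h0.ne']; gcongr; linarith
  have head : ∀ k, ‖∑ l ∈ Finset.Ico m (min k n), (β l : ℂ) * phase lam l‖
      ≤ 3 * κ * (1 / D * (k : ℝ) ^ D) := by
    intro k
    calc _ ≤ ∑ l ∈ Finset.Ico m (min k n), 3 * κ * ((l : ℝ) + 1) ^ (D - 1) := by
          refine (norm_sum_le _ _).trans (Finset.sum_le_sum fun l hl => ?_)
          rw [norm_mul, norm_phase, mul_one, Complex.norm_real, Real.norm_eq_abs]
          have := Finset.mem_Ico.1 hl
          exact h.abs_le hκ hτ1 this.1 (by omega)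
      _ ≤ ∑ l ∈ Finset.range k, 3 * κ * ((l : ℝ) + 1) ^ (D - 1) := by
          refine Finset.sum_le_sum_of_subset_of_nonneg (fun l hl => ?_)
            (fun l _ _ => by positivity)
          have := Finset.mem_Ico.1 hl
          exact Finset.mem_range.2 (by omega)
      _ ≤ _ := by
          rw [← Finset.mul_sum]
          exact mul_le_mul_of_nonneg_left (sum_range_rpow_le hD0 (by linarith) k) (by positivity)
  have hLD : (L : ℝ) ^ D ≤ 5 * lam ^ (-D) := by
    calc (L : ℝ) ^ D ≤ (5 / lam) ^ D := Real.rpow_le_rpow (by positivity) hL2 hD0.le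
      _ = 5 ^ D * lam ^ (-D) := by
          rw [Real.div_rpow (by norm_num) h0.le, Real.rpow_neg h0.le]; rfl
      _ ≤ 5 ^ (1 : ℝ) * lam ^ (-D) := by
          gcongr
          · norm_num
          · linarith
      _ = _ := by rw [Real.rpow_one]
  have hhead := (head L).trans (mul_le_mul_of_nonneg_left
    (mul_le_mul_of_nonneg_left hLD (by positivity)) (by positivity))
  have tail : ∀ k, L ≤ k + 1 → m ≤ k → ‖∑ l ∈ Finset.Ico k n, (β l : ℂ) * phase lam l‖
      ≤ 50 * κ * lam ^ (-D) := by
    intro k hk hmk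
    have hτk : τ * ((n : ℝ) - k) ≤ 1 := by
      refine le_trans (mul_le_mul_of_nonneg_left (sub_le_sub_left ?_ _) hτ) hτn
      exact_mod_cast hmk
    refine ((h.mono hmk le_rfl).norm_sum_le_div hD0 hD1 hκ hτ hτk h0 hpi).trans ?_
    have hk' : 1 / lam ≤ (k : ℝ) + 1 := hL1.trans (by exact_mod_cast hk)
    have e1 : ((k : ℝ) + 1) ^ (D - 1) ≤ (1 / lam) ^ (D - 1) :=
      Real.rpow_le_rpow_of_nonpos (by positivity) hk' (by linarith)
    have e2 : (1 / lam) ^ (D - 1) / lam = lam ^ (-D) := by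
      rw [one_div, Real.inv_rpow h0.le, ← Real.rpow_neg h0.le,
        div_eq_iff h0.ne', ← Real.rpow_add_one h0.ne']
      congr 1; ring
    rw [mul_div_assoc]
    refine mul_le_mul_of_nonneg_left ?_ (by positivity)
    rw [← e2]; gcongr
  have hfin : 3 * κ * (1 / D * (5 * lam ^ (-D))) + 50 * κ * lam ^ (-D)
      = κ * (50 + 15 / D) * lam ^ (-D) := by ring
  rw [← hfin]
  have hnn : 0 ≤ 3 * κ * (1 / D * (5 * lam ^ (-D))) := by positivity
  have hnn2 : 0 ≤ 50 * κ * lam ^ (-D) := by positivity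
  rcases le_or_gt L m with hLm | hLm
  · linarith [tail m (by omega) le_rfl]
  rcases le_or_gt n L with hnL | hnL
  · rw [min_eq_right hnL] at hhead; linarith
  rw [min_eq_left hnL.le] at hhead
  rw [← Finset.sum_Ico_consecutive _ hLm.le hnL.le]
  exact (norm_add_le _ _).trans (add_le_add hhead (tail L (by omega) hLm.le))

end LongMemory

/-! ### The coefficients of the model are slowly varying. -/

namespace LongMemory

theorem exists_lipschitz_of_continuousOn_derivWithin {g : ℝ → ℝ}
    (h1 : DifferentiableOn ℝ g (Icc 0 1)) (h2 : ContinuousOn (derivWithin g (Icc 0 1)) (Icc 0 1)) :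
    ∃ K : ℝ, 0 ≤ K ∧ ∀ u ∈ Icc (0 : ℝ) 1, ∀ v ∈ Icc (0 : ℝ) 1, |g u - g v| ≤ K * |u - v| := by
  obtain ⟨K, hK⟩ := isCompact_Icc.exists_bound_of_continuousOn h2
  refine ⟨K, (norm_nonneg _).trans (hK 0 (by simp)), fun u hu v hv => ?_⟩
  exact (convex_Icc (0 : ℝ) 1).norm_image_sub_le_of_norm_derivWithin_le h1 hK hv hu

theorem exists_bound_on_unit {g : ℝ → ℝ} (h : ContinuousOn g (Icc 0 1)) :
    ∃ K : ℝ, 0 ≤ K ∧ ∀ u ∈ Icc (0 : ℝ) 1, |g u| ≤ K := by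
  obtain ⟨K, hK⟩ := isCompact_Icc.exists_bound_of_continuousOn h
  exact ⟨K, (norm_nonneg _).trans (hK 0 (by simp)), hK⟩

theorem TwiceDifferentiableOnUnit.exists_lipschitz {g : ℝ → ℝ} (h : TwiceDifferentiableOnUnit g) :
    ∃ K : ℝ, 0 ≤ K ∧ ∀ u ∈ Icc (0 : ℝ) 1, ∀ v ∈ Icc (0 : ℝ) 1, |g u - g v| ≤ K * |u - v| :=
  exists_lipschitz_of_continuousOn_derivWithin h.1 h.2.continuousOn

theorem TwiceDifferentiableOnUnit.le_dSup {d : ℝ → ℝ} (h : TwiceDifferentiableOnUnit d) {u : ℝ}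
    (hu : u ∈ Icc (0 : ℝ) 1) : d u ≤ dSup d :=
  le_csSup (isCompact_Icc.image_of_continuousOn h.1.continuousOn).bddAbove (mem_image_of_mem d hu)

theorem idx_pos (l : ℕ) : 0 < idx l := by
  unfold idx; split_ifs with h
  · exact one_pos
  · exact_mod_cast Nat.pos_of_ne_zero h

theorem add_one_le_two_mul_idx (l : ℕ) : (l : ℝ) + 1 ≤ 2 * idx l := by
  unfold idx; split_ifs with h
  · simp [h]
  · have : (1 : ℝ) ≤ l := by exact_mod_cast Nat.one_le_iff_ne_zero.2 h
    linarith

theorem div_idx_rpow_le {s : ℝ} (hs : 0 ≤ s) (hs2 : s ≤ 2) (l : ℕ) {C : ℝ} (hC : 0 ≤ C) :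
    C / idx l ^ s ≤ 4 * C * ((l : ℝ) + 1) ^ (-s) := by
  have h1 : ((l : ℝ) + 1) ^ s ≤ 4 * idx l ^ s := by
    calc ((l : ℝ) + 1) ^ s ≤ (2 * idx l) ^ s :=
          Real.rpow_le_rpow (by positivity) (add_one_le_two_mul_idx l) hs
      _ = 2 ^ s * idx l ^ s := Real.mul_rpow (by norm_num) (idx_pos l).le
      _ ≤ 2 ^ (2 : ℝ) * idx l ^ s := by
          have := (Real.rpow_pos_of_pos (idx_pos l) s).le
          gcongr
          norm_num
      _ = _ := by norm_num
  have h2 := Real.rpow_pos_of_pos (idx_pos l) s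
  have h3 : 0 < ((l : ℝ) + 1) ^ s := by positivity
  rw [Real.rpow_neg (by positivity), ← div_eq_mul_inv, div_le_div_iff₀ h2 h3]
  nlinarith

/-- The asymptotics are extended to every lag, with `l + 1` in place of `idx l`. The finitely many
small lags are handled by boundedness of continuous functions on [0,1]. -/
theorem IsLocallyStationary.psi_asymp_all {Ω : Type*} [MeasurableSpace Ω] {P : Measure Ω}
    {X : ℕ → ℕ → Ω → ℝ} {Z : ℤ → Ω → ℝ} {ψT : ℕ → ℕ → ℕ → ℝ} {ψ : ℕ → ℝ → ℝ} {a d : ℝ → ℝ}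
    (hX : IsLocallyStationary P X Z ψT ψ a d) (hd : dSup d < 1 / 4) :
    ∃ C : ℝ, 0 ≤ C ∧ ∀ l : ℕ, ∀ u ∈ Icc (0 : ℝ) 1,
      |ψ l u - a u * ((l : ℝ) + 1) ^ (d u - 1)| ≤ C * ((l : ℝ) + 1) ^ (dSup d - 2) := by
  obtain ⟨C, hC⟩ := hX.psi_asymp
  obtain ⟨L, hL⟩ := eventually_atTop.1 hC
  obtain ⟨Ka, hKa0, hKa⟩ := exists_bound_on_unit hX.a_diff.1.continuousOn
  have hψ : ∀ l, ∃ K : ℝ, 0 ≤ K ∧ ∀ u ∈ Icc (0 : ℝ) 1, |ψ l u| ≤ K :=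
    fun l => exists_bound_on_unit (hX.psi_contDiff l).continuousOn
  choose K hK0 hK using hψ
  have hd0 : ∀ u ∈ Icc (0 : ℝ) 1, 0 ≤ d u := hX.d_nonneg
  have hdS : ∀ u ∈ Icc (0 : ℝ) 1, d u ≤ dSup d := fun u hu => hX.d_diff.le_dSup hu
  have hdS0 : 0 ≤ dSup d := (hd0 0 (by simp)).trans (hdS 0 (by simp))
  set L' := max L 1 with hL'
  set C1 := (∑ l ∈ Finset.range L', K l + Ka) * (L' : ℝ) ^ 2 with hC1
  have hC1' : 0 ≤ C1 := by
    have : 0 ≤ ∑ l ∈ Finset.range L', K l := Finset.sum_nonneg fun l _ => hK0 l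
    positivity
  refine ⟨C1 + (4 * |C| + Ka * 4), by positivity, fun l u hu => ?_⟩
  have hpos : 0 ≤ ((l : ℝ) + 1) ^ (dSup d - 2) := by positivity
  rcases lt_or_ge l L' with hl | hl
  · have h1 : |ψ l u - a u * ((l : ℝ) + 1) ^ (d u - 1)|
        ≤ ∑ l ∈ Finset.range L', K l + Ka := by
      refine (abs_sub _ _).trans (add_le_add ((hK l u hu).trans ?_) ?_)
      · exact Finset.single_le_sum (f := K) (fun l _ => hK0 l) (Finset.mem_range.2 hl)
      · rw [abs_mul, abs_of_nonneg (by positivity : 0 ≤ ((l : ℝ) + 1) ^ (d u - 1))]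
        have : ((l : ℝ) + 1) ^ (d u - 1) ≤ 1 :=
          Real.rpow_le_one_of_one_le_of_nonpos (by linarith [l.cast_nonneg (α := ℝ)])
            (by linarith [hdS u hu])
        nlinarith [hKa u hu, abs_nonneg (a u)]
    -- For l < L' the target rate is at least L'^(-2); this is the origin of the factor L'² in `C1`.
    have h2 : 1 ≤ (L' : ℝ) ^ 2 * ((l : ℝ) + 1) ^ (dSup d - 2) := by
      have e1 : ((l : ℝ) + 1) ^ (-2 : ℝ) ≤ ((l : ℝ) + 1) ^ (dSup d - 2) :=
        Real.rpow_le_rpow_of_exponent_le (by linarith [l.cast_nonneg (α := ℝ)]) (by linarith)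
      have e2 : (l : ℝ) + 1 ≤ L' := by exact_mod_cast hl
      have e3 : 1 ≤ (L' : ℝ) ^ 2 * ((l : ℝ) + 1) ^ (-2 : ℝ) := by
        rw [Real.rpow_neg (by positivity), Real.rpow_two, ← div_eq_mul_inv,
          le_div_iff₀ (by positivity), one_mul]
        gcongr
      exact e3.trans (mul_le_mul_of_nonneg_left e1 (by positivity))
    have h3 : 0 ≤ ∑ l ∈ Finset.range L', K l + Ka :=
      add_nonneg (Finset.sum_nonneg fun l _ => hK0 l) hKa0
    have h4 : C1 * ((l : ℝ) + 1) ^ (dSup d - 2) = (∑ l ∈ Finset.range L', K l + Ka) *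
      ((L' : ℝ) ^ 2 * ((l : ℝ) + 1) ^ (dSup d - 2)) := by rw [hC1]; ring
    have h5 : 0 ≤ (4 * |C| + Ka * 4) * ((l : ℝ) + 1) ^ (dSup d - 2) := by positivity
    rw [add_mul, h4]
    nlinarith
  · have hl1 : (1 : ℝ) ≤ l := by exact_mod_cast (le_max_right L 1).trans hl
    have hl0 : l ≠ 0 := by rintro rfl; norm_num at hl1
    have hidx : idx l = l := by simp [idx, hl0]
    have h1 := hL l ((le_max_left L 1).trans hl) u hu
    have h2 : C / idx l ^ (2 - dSup d) ≤ 4 * |C| * ((l : ℝ) + 1) ^ (dSup d - 2) := by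
      have e := div_idx_rpow_le (s := 2 - dSup d) (by linarith) (by linarith) l (abs_nonneg C)
      rw [neg_sub] at e
      refine le_trans ?_ e
      have := Real.rpow_pos_of_pos (idx_pos l) (2 - dSup d)
      gcongr
      exact le_abs_self C
    have h3 : |a u / idx l ^ (1 - d u) - a u * ((l : ℝ) + 1) ^ (d u - 1)|
        ≤ Ka * 4 * ((l : ℝ) + 1) ^ (dSup d - 2) := by
      have hl0' : (0 : ℝ) < l := by linarith
      have e0 : a u / idx l ^ (1 - d u) = a u * (l : ℝ) ^ (d u - 1) := by
        rw [hidx, div_eq_mul_inv, ← Real.rpow_neg hl0'.le, neg_sub]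
      rw [e0, ← mul_sub, abs_mul]
      have e1 : 0 ≤ (l : ℝ) ^ (d u - 1) - ((l : ℝ) + 1) ^ (d u - 1) := sub_nonneg.2
        (Real.rpow_le_rpow_of_nonpos hl0' (by linarith) (by linarith [hdS u hu]))
      have e2 := rpow_sub_one_sub_le (p := d u - 1) (by linarith [hd0 u hu])
        (by linarith [hdS u hu]) hl0'
      have e3 : (l : ℝ) ^ (d u - 1 - 1) ≤ 4 * ((l : ℝ) + 1) ^ (dSup d - 2) := by
        have f1 : (l : ℝ) ^ (d u - 1 - 1) ≤ (l : ℝ) ^ (dSup d - 2) :=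
          Real.rpow_le_rpow_of_exponent_le hl1 (by linarith [hdS u hu])
        have f2 := div_idx_rpow_le (s := 2 - dSup d) (by linarith) (by linarith) l zero_le_one
        rw [hidx, one_div, ← Real.rpow_neg hl0'.le, neg_sub] at f2
        linarith
      rw [abs_of_nonneg e1]
      have := hKa u hu
      have h6 : 0 ≤ 4 * ((l : ℝ) + 1) ^ (dSup d - 2) := by positivity
      nlinarith [abs_nonneg (a u)]
    have h4 := abs_sub_le (ψ l u) (a u / idx l ^ (1 - d u)) (a u * ((l : ℝ) + 1) ^ (d u - 1))
    have h5 : 0 ≤ C1 * ((l : ℝ) + 1) ^ (dSup d - 2) := by positivity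
    linarith

/-- Varying the exponent costs a logarithm: 1 - exp(-x) ≤ x with x = (p - q) log y, and then log y ≤
y^η/η. This loss of η is what the gap between d_∞ and D pays for. -/
theorem abs_rpow_sub_rpow_le {y p q r η : ℝ} (hy : 1 ≤ y) (hp : p ≤ r) (hq : q ≤ r)
    (hη : 0 < η) : |y ^ p - y ^ q| ≤ |p - q| * (1 / η * y ^ (r + η)) := by
  have hy0 : 0 < y := by linarith
  wlog hpq : q ≤ p generalizing p q
  · rw [abs_sub_comm, abs_sub_comm p]; exact this hq hp (by linarith)
  have h1 : y ^ q ≤ y ^ p := Real.rpow_le_rpow_of_exponent_le hy hpq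
  rw [abs_of_nonneg (by linarith), abs_of_nonneg (by linarith)]
  have hlog := Real.log_le_rpow_div hy0.le hη
  have h2 : y ^ p - y ^ q ≤ (p - q) * Real.log y * y ^ p := by
    have e1 : y ^ q = y ^ p * Real.exp (-(Real.log y * (p - q))) := by
      rw [Real.rpow_def_of_pos hy0, Real.rpow_def_of_pos hy0, ← Real.exp_add]; congr 1; ring
    have e2 := Real.one_sub_le_exp_neg (Real.log y * (p - q))
    have e3 : 0 < y ^ p := by positivity
    rw [e1]; nlinarith
  have h3 : y ^ p ≤ y ^ r := Real.rpow_le_rpow_of_exponent_le hy hp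
  have h4 : 0 ≤ Real.log y := Real.log_nonneg hy
  calc y ^ p - y ^ q ≤ (p - q) * (Real.log y * y ^ p) := by linarith
    _ ≤ (p - q) * (y ^ η / η * y ^ r) := by
        apply mul_le_mul_of_nonneg_left _ (by linarith)
        exact mul_le_mul hlog h3 (by positivity) (by positivity)
    _ = _ := by rw [Real.rpow_add hy0]; ring

/-- Increments of the leading term `a(v) x ^ (d(v) - 1)`. -/
theorem exists_increment_bound {a d : ℝ → ℝ} (ha : TwiceDifferentiableOnUnit a)
    (hd : TwiceDifferentiableOnUnit d) (hd0 : ∀ u ∈ Icc (0 : ℝ) 1, 0 ≤ d u) {D : ℝ}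
    (hD : dSup d < D) (hD1 : D < 1 / 4) :
    ∃ κ : ℝ, 0 ≤ κ ∧
      (∀ x : ℝ, 1 ≤ x → ∀ v ∈ Icc (0 : ℝ) 1, |a v * x ^ (d v - 1)| ≤ κ * x ^ (D - 1)) ∧
      ∀ x : ℝ, 1 ≤ x → ∀ v ∈ Icc (0 : ℝ) 1, ∀ v' ∈ Icc (0 : ℝ) 1,
        |a v' * (x + 1) ^ (d v' - 1) - a v * x ^ (d v - 1)|
          ≤ κ * (x ^ (D - 2) + |v' - v| * x ^ (D - 1)) := by
  obtain ⟨Ka, hKa0, hKa⟩ := exists_bound_on_unit ha.1.continuousOn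
  obtain ⟨La, hLa0, hLa⟩ := ha.exists_lipschitz
  obtain ⟨Ld, hLd0, hLd⟩ := hd.exists_lipschitz
  set η := D - dSup d with hη
  have hη0 : 0 < η := by linarith
  refine ⟨Ka + La + Ka * Ld * (1 / η), by positivity, fun x hx v hv => ?_,
    fun x hx v hv v' hv' => ?_⟩
  · have hx0 : 0 < x := by linarith
    have hdv := hd.le_dSup hv
    rw [abs_mul, abs_of_nonneg (by positivity : 0 ≤ x ^ (d v - 1))]
    have h1 : x ^ (d v - 1) ≤ x ^ (D - 1) := Real.rpow_le_rpow_of_exponent_le hx (by linarith)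
    have h2 : Ka ≤ Ka + La + Ka * Ld * (1 / η) := by
      have : 0 ≤ Ka * Ld * (1 / η) := by positivity
      linarith
    exact mul_le_mul ((hKa v hv).trans h2) h1 (by positivity) (by positivity)
  · have hx0 : 0 < x := by linarith
    have hdv := hd.le_dSup hv
    have hdv' := hd.le_dSup hv'
    -- The increment is split into a change of a, a change of the exponent d, and a change of the
    -- base x. The first two carry |v' - v|; the last gains a power of x.
    have e : a v' * (x + 1) ^ (d v' - 1) - a v * x ^ (d v - 1)
        = (a v' - a v) * (x + 1) ^ (d v' - 1)
          + a v * ((x + 1) ^ (d v' - 1) - (x + 1) ^ (d v - 1))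
          + a v * ((x + 1) ^ (d v - 1) - x ^ (d v - 1)) := by ring
    have hanti : (x + 1) ^ (D - 1) ≤ x ^ (D - 1) :=
      Real.rpow_le_rpow_of_nonpos hx0 (by linarith) (by linarith)
    have t1 : |(a v' - a v) * (x + 1) ^ (d v' - 1)| ≤ La * |v' - v| * x ^ (D - 1) := by
      rw [abs_mul, abs_of_nonneg (by positivity : 0 ≤ (x + 1) ^ (d v' - 1))]
      have h1 : (x + 1) ^ (d v' - 1) ≤ (x + 1) ^ (D - 1) :=
        Real.rpow_le_rpow_of_exponent_le (by linarith) (by linarith)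
      exact mul_le_mul (hLa v' hv' v hv) (h1.trans hanti) (by positivity) (by positivity)
    have t2 : |a v * ((x + 1) ^ (d v' - 1) - (x + 1) ^ (d v - 1))|
        ≤ Ka * (Ld * |v' - v| * (1 / η * x ^ (D - 1))) := by
      rw [abs_mul]
      have h1 := abs_rpow_sub_rpow_le (y := x + 1) (p := d v' - 1) (q := d v - 1)
        (r := dSup d - 1) (η := η) (by linarith) (by linarith) (by linarith) hη0
      have h2 : dSup d - 1 + η = D - 1 := by rw [hη]; ring
      rw [h2] at h1
      have h3 : |d v' - 1 - (d v - 1)| ≤ Ld * |v' - v| := by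
        have := hLd v' hv' v hv; rwa [sub_sub_sub_cancel_right]
      refine mul_le_mul (hKa v hv) (h1.trans ?_) (abs_nonneg _) hKa0
      exact mul_le_mul h3 (mul_le_mul_of_nonneg_left hanti (by positivity)) (by positivity)
        (by positivity)
    have t3 : |a v * ((x + 1) ^ (d v - 1) - x ^ (d v - 1))| ≤ Ka * x ^ (D - 2) := by
      rw [abs_mul, abs_sub_comm]
      have e1 : 0 ≤ x ^ (d v - 1) - (x + 1) ^ (d v - 1) := sub_nonneg.2
        (Real.rpow_le_rpow_of_nonpos hx0 (by linarith) (by linarith))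
      have e2 := rpow_sub_one_sub_le (p := d v - 1) (by linarith [hd0 v hv])
        (by linarith) hx0
      have e3 : x ^ (d v - 1 - 1) ≤ x ^ (D - 2) :=
        Real.rpow_le_rpow_of_exponent_le hx (by linarith)
      rw [abs_of_nonneg e1]
      exact mul_le_mul (hKa v hv) (e2.trans e3) e1 hKa0
    rw [e]
    refine (abs_add_three _ _ _).trans ((add_le_add (add_le_add t1 t2) t3).trans ?_)
    have p1 : 0 ≤ x ^ (D - 2) := by positivity
    have p2 : 0 ≤ |v' - v| * x ^ (D - 1) := by positivity
    have p3 : 0 ≤ Ka * Ld * (1 / η) := by positivity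
    have q1 : 0 ≤ (La + Ka * Ld * (1 / η)) * x ^ (D - 2) := by positivity
    have q2 : 0 ≤ Ka * (|v' - v| * x ^ (D - 1)) := by positivity
    linarith

section Model

variable {Ω : Type*} [MeasurableSpace Ω] {P : Measure Ω}
  {X : ℕ → ℕ → Ω → ℝ} {Z : ℤ → Ω → ℝ} {ψT : ℕ → ℕ → ℕ → ℝ} {ψ : ℕ → ℝ → ℝ} {a d : ℝ → ℝ}

theorem IsLocallyStationary.dSup_nonneg (hX : IsLocallyStationary P X Z ψT ψ a d) :
    0 ≤ dSup d :=
  (hX.d_nonneg 0 (by simp)).trans (hX.d_diff.le_dSup (by simp))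

theorem IsLocallyStationary.approx_rpow (hX : IsLocallyStationary P X Z ψT ψ a d) {D : ℝ}
    (hD : dSup d < D) (hD1 : D < 1 / 4) :
    ∃ C : ℝ, 0 ≤ C ∧ ∀ T t : ℕ, 1 ≤ t → t ≤ T → ∀ l : ℕ,
      |ψT t T l - ψ l ((t : ℝ) / T)| ≤ C * (1 / T * ((l : ℝ) + 1) ^ (D - 1)) := by
  obtain ⟨C, hC⟩ := hX.approx
  refine ⟨4 * |C|, by positivity, fun T t ht htT l => (hC T t ht htT l).trans ?_⟩
  have hT : (0 : ℝ) < T := by exact_mod_cast (by omega : 0 < T)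
  have h0 := hX.dSup_nonneg
  have h1 := div_idx_rpow_le (s := 1 - dSup d) (by linarith) (by linarith) l (abs_nonneg C)
  rw [neg_sub] at h1
  have h2 : ((l : ℝ) + 1) ^ (dSup d - 1) ≤ ((l : ℝ) + 1) ^ (D - 1) :=
    Real.rpow_le_rpow_of_exponent_le (by linarith [l.cast_nonneg (α := ℝ)]) (by linarith)
  have hp := Real.rpow_pos_of_pos (idx_pos l) (1 - dSup d)
  calc C / (T * idx l ^ (1 - dSup d)) = 1 / T * (C / idx l ^ (1 - dSup d)) := by
        field_simp
    _ ≤ 1 / T * (|C| / idx l ^ (1 - dSup d)) := by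
        gcongr; exact le_abs_self C
    _ ≤ 1 / T * (4 * |C| * ((l : ℝ) + 1) ^ (D - 1)) := by
        gcongr
        exact h1.trans (by gcongr)
    _ = _ := by ring

theorem div_mem_unit {t T : ℕ} (ht : 1 ≤ t) (htT : t ≤ T) : (t : ℝ) / T ∈ Icc (0 : ℝ) 1 := by
  have hT : (0 : ℝ) < T := by exact_mod_cast (by omega : 0 < T)
  exact ⟨by positivity, (div_le_one hT).2 (by exact_mod_cast htT)⟩

/-- The first clause freezes time, so there is no drift. In the second an innovation is fixed, so
the observation time advances with the lag and each step moves rescaled time by 1/T. -/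
theorem IsLocallyStationary.exists_slowlyVarying (hX : IsLocallyStationary P X Z ψT ψ a d) {D : ℝ}
    (hD : dSup d < D) (hD1 : D < 1 / 4) :
    ∃ κ : ℝ, 0 ≤ κ ∧
      (∀ u ∈ Icc (0 : ℝ) 1, ∀ n, SlowlyVarying D κ 0 0 n (fun l => ψ l u)) ∧
      ∀ (T m n : ℕ) (τ : ℕ → ℕ), (∀ l, m ≤ l → l < n → 1 ≤ τ l ∧ τ l ≤ T) →
        (∀ l, m ≤ l → l + 1 < n → τ (l + 1) = τ l + 1) →
        SlowlyVarying D κ (1 / T) m n (fun l => ψT (τ l) T l) := by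
  obtain ⟨κ, hκ0, hκ1, hκ2⟩ := exists_increment_bound hX.a_diff hX.d_diff hX.d_nonneg hD hD1
  obtain ⟨C, hC0, hC⟩ := hX.psi_asymp_all (hD.trans hD1)
  obtain ⟨C', hC0', hC'⟩ := hX.approx_rpow hD hD1
  have hx : ∀ l : ℕ, (1 : ℝ) ≤ (l : ℝ) + 1 := fun l => by linarith [l.cast_nonneg (α := ℝ)]
  have hCD : ∀ l : ℕ, ∀ u ∈ Icc (0 : ℝ) 1,
      |ψ l u - a u * ((l : ℝ) + 1) ^ (d u - 1)| ≤ C * ((l : ℝ) + 1) ^ (D - 2) := fun l u hu =>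
    (hC l u hu).trans (mul_le_mul_of_nonneg_left
      (Real.rpow_le_rpow_of_exponent_le (hx l) (by linarith)) hC0)
  refine ⟨κ + C + C', by positivity, fun u hu n => ⟨fun l => a u * ((l : ℝ) + 1) ^ (d u - 1),
    fun l _ _ => ?_, fun l _ _ => ?_, fun l _ _ => ?_⟩, fun T m n τ h1 h2 =>
    ⟨fun l => a ((τ l : ℝ) / T) * ((l : ℝ) + 1) ^ (d ((τ l : ℝ) / T) - 1),
    fun l hl hl' => ?_, fun l hl hl' => ?_, fun l hl hl' => ?_⟩⟩
  · have := hCD l u hu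
    have p : 0 ≤ ((l : ℝ) + 1) ^ (D - 2) := by positivity
    simp only [zero_mul, add_zero]
    nlinarith
  · have := hκ1 _ (hx l) u hu
    have p : 0 ≤ ((l : ℝ) + 1) ^ (D - 1) := by positivity
    nlinarith
  · have := hκ2 _ (hx l) u hu u hu
    have p : 0 ≤ ((l : ℝ) + 1) ^ (D - 2) := by positivity
    simp only [sub_self, abs_zero, zero_mul, add_zero] at this ⊢
    push_cast
    nlinarith
  · obtain ⟨ht, htT⟩ := h1 l hl hl'
    have e1 := hCD l _ (div_mem_unit ht htT)
    have e2 := hC' T (τ l) ht htT l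
    have p : 0 ≤ ((l : ℝ) + 1) ^ (D - 2) := by positivity
    have p' : 0 ≤ 1 / (T : ℝ) * ((l : ℝ) + 1) ^ (D - 1) := by positivity
    have e3 := abs_sub_le (ψT (τ l) T l) (ψ l ((τ l : ℝ) / T))
      (a ((τ l : ℝ) / T) * ((l : ℝ) + 1) ^ (d ((τ l : ℝ) / T) - 1))
    nlinarith
  · obtain ⟨ht, htT⟩ := h1 l hl hl'
    have := hκ1 _ (hx l) _ (div_mem_unit ht htT)
    have p : 0 ≤ ((l : ℝ) + 1) ^ (D - 1) := by positivity
    nlinarith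
  · obtain ⟨ht, htT⟩ := h1 l hl (by omega)
    obtain ⟨ht', htT'⟩ := h1 (l + 1) (by omega) hl'
    have := hκ2 _ (hx l) _ (div_mem_unit ht htT) _ (div_mem_unit ht' htT')
    have hτ : |((τ (l + 1) : ℕ) : ℝ) / T - (τ l : ℝ) / T| = 1 / T := by
      rw [h2 l hl hl', ← sub_div]; push_cast
      rw [add_sub_cancel_left, abs_of_nonneg (by positivity)]
    rw [hτ] at this
    push_cast
    have p : 0 ≤ ((l : ℝ) + 1) ^ (D - 2) := by positivity
    have p' : 0 ≤ 1 / (T : ℝ) * ((l : ℝ) + 1) ^ (D - 1) := by positivity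
    nlinarith

/-- For boundedly many lags, the coefficients are uniformly close to those at a frozen time. -/
theorem IsLocallyStationary.exists_frozen_bound (hX : IsLocallyStationary P X Z ψT ψ a d)
    (hd : dSup d < 1 / 4) (L : ℕ) :
    ∃ K : ℝ, 0 ≤ K ∧ ∀ T t : ℕ, 1 ≤ t → t ≤ T → ∀ v ∈ Icc (0 : ℝ) 1, ∀ l < L,
      |ψT t T l - ψ l v| ≤ K * (1 / T + |(t : ℝ) / T - v|) := by
  obtain ⟨D, hD, hD1⟩ := exists_between hd
  obtain ⟨C, hC0, hC⟩ := hX.approx_rpow hD hD1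
  have hψ : ∀ l, ∃ K : ℝ, 0 ≤ K ∧
      ∀ u ∈ Icc (0 : ℝ) 1, ∀ v ∈ Icc (0 : ℝ) 1, |ψ l u - ψ l v| ≤ K * |u - v| := fun l =>
    exists_lipschitz_of_continuousOn_derivWithin
      ((hX.psi_contDiff l).differentiableOn (by norm_num))
      ((hX.psi_contDiff l).continuousOn_derivWithin (uniqueDiffOn_Icc zero_lt_one) (by norm_num))
  choose K hK0 hK using hψ
  have hS : 0 ≤ ∑ l ∈ Finset.range L, K l := Finset.sum_nonneg fun l _ => hK0 l
  refine ⟨C + ∑ l ∈ Finset.range L, K l, by positivity, fun T t ht htT v hv l hl => ?_⟩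
  have e1 := hC T t ht htT l
  have e2 := hK l _ (div_mem_unit ht htT) v hv
  have e3 := abs_sub_le (ψT t T l) (ψ l ((t : ℝ) / T)) (ψ l v)
  have e4 : ((l : ℝ) + 1) ^ (D - 1) ≤ 1 :=
    Real.rpow_le_one_of_one_le_of_nonpos (by linarith [l.cast_nonneg (α := ℝ)]) (by linarith)
  have e5 : K l ≤ ∑ l ∈ Finset.range L, K l :=
    Finset.single_le_sum (f := K) (fun l _ => hK0 l) (Finset.mem_range.2 hl)
  have e6 : C * (1 / T * ((l : ℝ) + 1) ^ (D - 1)) ≤ C * (1 / T) := by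
    have : 1 / (T : ℝ) * ((l : ℝ) + 1) ^ (D - 1) ≤ 1 / T :=
      mul_le_of_le_one_right (by positivity) e4
    exact mul_le_mul_of_nonneg_left this hC0
  have e7 : K l * |(t : ℝ) / T - v| ≤ (∑ l ∈ Finset.range L, K l) * |(t : ℝ) / T - v| := by
    gcongr
  have e8 : 0 ≤ (∑ l ∈ Finset.range L, K l) * (1 / (T : ℝ)) := by positivity
  have e9 : 0 ≤ C * |(t : ℝ) / T - v| := by positivity
  linarith

end Model

end LongMemory

/-! ### Moments of Gaussian linear combinations. -/

namespace LongMemory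

section Gaussian

/-- The even moments of the standard normal distribution. -/
noncomputable def gaussMoment (q : ℕ) : ℝ := ∫ x, x ^ (2 * q) ∂(gaussianReal 0 1)

theorem gaussMoment_nonneg (q : ℕ) : 0 ≤ gaussMoment q :=
  integral_nonneg fun x => (even_two_mul q).pow_nonneg x

theorem gaussMoment_one : gaussMoment 1 = 1 := by
  have h := variance_fun_id_gaussianReal (μ := 0) (v := 1)
  rw [variance_eq_integral (by fun_prop)] at h
  simpa [gaussMoment, integral_id_gaussianReal] using h

/-- The fourth moment is the fourth derivative at 0 of the moment generating function exp(t²/2). -/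
theorem gaussMoment_two : gaussMoment 2 = 3 := by
  have h := iteratedDeriv_mgf_zero (X := id) (μ := gaussianReal 0 1)
    (by rw [integrableExpSet_id_gaussianReal]; simp) 4
  have hm : gaussMoment 2 = iteratedDeriv 4 (mgf id (gaussianReal 0 1)) 0 := by
    rw [h]; rfl
  have e0 : mgf id (gaussianReal 0 1) = fun t => Real.exp (t ^ 2 / 2) := by
    rw [mgf_id_gaussianReal]; ext t; simp
  have hexp : ∀ t : ℝ, HasDerivAt (fun t => Real.exp (t ^ 2 / 2)) (t * Real.exp (t ^ 2 / 2)) t := by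
    intro t
    have := (((hasDerivAt_id t).pow 2).div_const 2).exp
    convert! this using 1
    simp; ring
  -- Differentiating p(t) exp(t²/2) replaces the polynomial p by p' + t p.
  have step : ∀ (p q : ℝ → ℝ), (∀ t, HasDerivAt p (q t) t) →
      deriv (fun t => p t * Real.exp (t ^ 2 / 2))
        = fun t => (q t + p t * t) * Real.exp (t ^ 2 / 2) := by
    intro p q hp
    ext t
    have h := ((hp t).fun_mul (hexp t)).deriv
    rw [h]; ring
  have d1 : deriv (fun t : ℝ => Real.exp (t ^ 2 / 2)) = fun t => t * Real.exp (t ^ 2 / 2) := by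
    ext t; exact (hexp t).deriv
  have d2 := step (fun t => t) (fun _ => 1) (fun t => hasDerivAt_id t)
  have d3 := step (fun t => 1 + t * t) (fun t => 2 * t)
    (fun t => by convert! ((hasDerivAt_id t).mul (hasDerivAt_id t)).const_add 1 using 1; simp; ring)
  have d4 := step (fun t => 2 * t + (1 + t * t) * t) (fun t => 2 + (2 * t * t + (1 + t * t)))
    (fun t => by
      have h1 : HasDerivAt (fun t : ℝ => t * t) (2 * t) t := by
        convert! (hasDerivAt_id t).mul (hasDerivAt_id t) using 1; simp; ring
      convert! ((hasDerivAt_id t).const_mul 2).add ((h1.const_add 1).mul (hasDerivAt_id t)) using 1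
      simp)
  rw [hm, e0]
  simp only [iteratedDeriv_succ, iteratedDeriv_zero]
  rw [d1, d2, d3, d4]
  norm_num

variable {Ω : Type*} [MeasurableSpace Ω] {P : Measure Ω} {ι : Type*} {W : ι → Ω → ℝ}

theorem hasLaw_linear_comb [IsProbabilityMeasure P]
    (hW : iIndepFun W P) (hg : ∀ i, HasLaw (W i) (gaussianReal 0 1) P)
    (S : Finset ι) (c : ι → ℝ) :
    HasLaw (fun ω => ∑ i ∈ S, c i * W i ω) (gaussianReal 0 (∑ i ∈ S, c i ^ 2).toNNReal) P := by
  classical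
  induction S using Finset.induction_on with
  | empty => simpa [gaussianReal_zero_var] using
      hasLaw_dirac_of_ae_eq (P := P) (X := fun _ : Ω => (0 : ℝ)) (x := 0) (by rfl)
  | insert i S hi ih =>
    have hind : iIndepFun (fun i ω => c i * W i ω) P :=
      hW.comp (fun i x => c i * x) (fun i => by fun_prop)
    have hae : ∀ i, AEMeasurable (fun ω => c i * W i ω) P :=
      fun i => (hg i).aemeasurable.const_mul _
    have h1 := hind.indepFun_finsetSum_of_notMem₀ hae hi
    have h2 : (∑ j ∈ S, fun ω => c j * W j ω) = fun ω => ∑ j ∈ S, c j * W j ω := by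
      ext ω; simp
    rw [h2] at h1
    have h3 := h1.hasLaw_fun_add ih (gaussianReal_const_mul (hg i) (c i))
    rw [gaussianReal_conv_gaussianReal] at h3
    convert! h3 using 1
    · ext ω; rw [Finset.sum_insert hi, add_comm]
    · congr 1
      · simp
      · ext
        have p : 0 ≤ ∑ j ∈ S, c j ^ 2 := Finset.sum_nonneg fun j _ => sq_nonneg _
        rw [Finset.sum_insert hi, Real.coe_toNNReal _ (by positivity)]
        simp [p, add_comm]

theorem memLp_of_hasLaw_gaussianReal {Y : Ω → ℝ} {v : NNReal} (h : HasLaw Y (gaussianReal 0 v) P)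
    {p : ENNReal} (hp : p ≠ ⊤) : MemLp Y p P := by
  have h1 := memLp_id_gaussianReal' (μ := 0) (v := v) p hp
  rw [← h.map_eq] at h1
  simpa using (memLp_map_measure_iff aestronglyMeasurable_id h.aemeasurable).1 h1

theorem integral_pow_of_hasLaw {Y : Ω → ℝ} {v : ℝ} (hv : 0 ≤ v)
    (h : HasLaw Y (gaussianReal 0 v.toNNReal) P) (q : ℕ) :
    ∫ ω, Y ω ^ (2 * q) ∂P = v ^ q * gaussMoment q := by
  have h1 := h.integral_comp (f := fun x : ℝ => x ^ (2 * q)) (by fun_prop)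
  have h2 : gaussianReal 0 v.toNNReal = (gaussianReal 0 1).map (Real.sqrt v * ·) := by
    rw [gaussianReal_map_const_mul]
    congr 1
    · simp
    · ext; simp [Real.sq_sqrt hv, hv]
  rw [h2, integral_map (by fun_prop) (by fun_prop)] at h1
  refine (h1.trans ?_)
  simp only [mul_pow, pow_mul, Real.sq_sqrt hv]
  rw [integral_const_mul, gaussMoment]
  simp only [pow_mul]

theorem integral_linear_comb_pow [IsProbabilityMeasure P]
    (hW : iIndepFun W P) (hg : ∀ i, HasLaw (W i) (gaussianReal 0 1) P)
    (S : Finset ι) (c : ι → ℝ) (q : ℕ) :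
    ∫ ω, (∑ i ∈ S, c i * W i ω) ^ (2 * q) ∂P = (∑ i ∈ S, c i ^ 2) ^ q * gaussMoment q :=
  integral_pow_of_hasLaw (Finset.sum_nonneg fun _ _ => sq_nonneg _)
    (hasLaw_linear_comb hW hg S c) q

theorem memLp_linear_comb [IsProbabilityMeasure P]
    (hW : iIndepFun W P) (hg : ∀ i, HasLaw (W i) (gaussianReal 0 1) P)
    (S : Finset ι) (c : ι → ℝ) {p : ENNReal} (hp : p ≠ ⊤) :
    MemLp (fun ω => ∑ i ∈ S, c i * W i ω) p P :=
  memLp_of_hasLaw_gaussianReal (hasLaw_linear_comb hW hg S c) hp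

theorem integrable_linear_comb_pow [IsProbabilityMeasure P]
    (hW : iIndepFun W P) (hg : ∀ i, HasLaw (W i) (gaussianReal 0 1) P)
    (S : Finset ι) (c : ι → ℝ) {q : ℕ} (hq : q ≠ 0) :
    Integrable (fun ω => (∑ i ∈ S, c i * W i ω) ^ (2 * q)) P := by
  have h := (memLp_linear_comb hW hg S c (p := ((2 * q : ℕ) : ENNReal))
    (ENNReal.natCast_ne_top _)).integrable_norm_pow (by omega)
  refine h.congr (Eventually.of_forall fun ω => ?_)
  simp only [Real.norm_eq_abs]
  rw [(even_two_mul q).pow_abs]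

theorem re_linear_comb {Ω ι : Type*} {W : ι → Ω → ℝ} (S : Finset ι) (c : ι → ℂ) (ω : Ω) :
    (∑ i ∈ S, c i * (W i ω : ℂ)).re = ∑ i ∈ S, (c i).re * W i ω := by
  simp [Complex.re_sum]

theorem im_linear_comb {Ω ι : Type*} {W : ι → Ω → ℝ} (S : Finset ι) (c : ι → ℂ) (ω : Ω) :
    (∑ i ∈ S, c i * (W i ω : ℂ)).im = ∑ i ∈ S, (c i).im * W i ω := by
  simp [Complex.im_sum]

theorem norm_sq_linear_comb {Ω ι : Type*} {W : ι → Ω → ℝ} (S : Finset ι) (c : ι → ℂ) (ω : Ω) :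
    ‖∑ i ∈ S, c i * (W i ω : ℂ)‖ ^ 2
      = (∑ i ∈ S, (c i).re * W i ω) ^ 2 + (∑ i ∈ S, (c i).im * W i ω) ^ 2 := by
  rw [← re_linear_comb, ← im_linear_comb, Complex.sq_norm, Complex.normSq_apply]; ring

theorem sum_norm_sq_eq (S : Finset ι) (c : ι → ℂ) :
    ∑ i ∈ S, ‖c i‖ ^ 2 = ∑ i ∈ S, (c i).re ^ 2 + ∑ i ∈ S, (c i).im ^ 2 := by
  rw [← Finset.sum_add_distrib]
  refine Finset.sum_congr rfl fun i _ => ?_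
  rw [Complex.sq_norm, Complex.normSq_apply]; ring

theorem memLp_complex_comb (hg : ∀ i, HasLaw (W i) (gaussianReal 0 1) P) (S : Finset ι) (c : ι → ℂ) {p : ENNReal} (hp : p ≠ ⊤) :
    MemLp (fun ω => ∑ i ∈ S, c i * (W i ω : ℂ)) p P := by
  refine memLp_finsetSum S fun i _ => MemLp.const_mul ?_ (c i)
  exact (memLp_of_hasLaw_gaussianReal (hg i) hp).ofReal

theorem integral_norm_sq_comb [IsProbabilityMeasure P]
    (hW : iIndepFun W P) (hg : ∀ i, HasLaw (W i) (gaussianReal 0 1) P)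
    (S : Finset ι) (c : ι → ℂ) :
    ∫ ω, ‖∑ i ∈ S, c i * (W i ω : ℂ)‖ ^ 2 ∂P = ∑ i ∈ S, ‖c i‖ ^ 2 := by
  simp_rw [norm_sq_linear_comb]
  have i1 := integrable_linear_comb_pow hW hg S (fun i => (c i).re) one_ne_zero
  have i2 := integrable_linear_comb_pow hW hg S (fun i => (c i).im) one_ne_zero
  have e1 := integral_linear_comb_pow hW hg S (fun i => (c i).re) 1
  have e2 := integral_linear_comb_pow hW hg S (fun i => (c i).im) 1
  simp only [mul_one, pow_one, gaussMoment_one] at i1 i2 e1 e2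
  rw [integral_add i1 i2, e1, e2, sum_norm_sq_eq]

/-- Moments of the squared modulus of a Gaussian linear combination. -/
theorem integral_norm_pow_comb_le [IsProbabilityMeasure P]
    (hW : iIndepFun W P) (hg : ∀ i, HasLaw (W i) (gaussianReal 0 1) P)
    (S : Finset ι) (c : ι → ℂ) {q : ℕ} (hq : q ≠ 0) :
    ∫ ω, ‖∑ i ∈ S, c i * (W i ω : ℂ)‖ ^ (2 * q) ∂P
      ≤ 2 ^ q * gaussMoment q * (∑ i ∈ S, ‖c i‖ ^ 2) ^ q := by
  have i1 := integrable_linear_comb_pow hW hg S (fun i => (c i).re) hq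
  have i2 := integrable_linear_comb_pow hW hg S (fun i => (c i).im) hq
  have hq1 : q - 1 + 1 = q := by omega
  -- Convexity gives 2^(q-1); the remaining factor 2 of the final constant comes from adding the
  -- real and imaginary parts.
  have hpt : ∀ x y : ℝ, (x ^ 2 + y ^ 2) ^ q ≤ 2 ^ (q - 1) * (x ^ (2 * q) + y ^ (2 * q)) := by
    intro x y
    have := add_pow_le (sq_nonneg x) (sq_nonneg y) q
    simpa only [← pow_mul] using this
  calc _ ≤ ∫ ω, 2 ^ (q - 1) * ((∑ i ∈ S, (c i).re * W i ω) ^ (2 * q)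
        + (∑ i ∈ S, (c i).im * W i ω) ^ (2 * q)) ∂P := by
        refine integral_mono_of_nonneg (Eventually.of_forall fun ω => by positivity)
          ((i1.add i2).const_mul _) (Eventually.of_forall fun ω => ?_)
        simp only
        rw [pow_mul, norm_sq_linear_comb]
        exact hpt _ _
    _ = 2 ^ (q - 1) * gaussMoment q *
          ((∑ i ∈ S, (c i).re ^ 2) ^ q + (∑ i ∈ S, (c i).im ^ 2) ^ q) := by
        rw [integral_const_mul, integral_add i1 i2, integral_linear_comb_pow hW hg S,
          integral_linear_comb_pow hW hg S]
        ring
    _ ≤ 2 ^ (q - 1) * gaussMoment q * (2 * (∑ i ∈ S, ‖c i‖ ^ 2) ^ q) := by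
        have := gaussMoment_nonneg q
        refine mul_le_mul_of_nonneg_left ?_ (by positivity)
        have p1 : 0 ≤ ∑ i ∈ S, (c i).re ^ 2 := Finset.sum_nonneg fun _ _ => sq_nonneg _
        have p2 : 0 ≤ ∑ i ∈ S, (c i).im ^ 2 := Finset.sum_nonneg fun _ _ => sq_nonneg _
        rw [sum_norm_sq_eq, two_mul]
        gcongr <;> linarith
    _ = _ := by
        rw [show (2 : ℝ) ^ q = 2 ^ (q - 1) * 2 by rw [← pow_succ, hq1]]; ring

/-- The fourth absolute moment in the circular case. -/
theorem integral_norm_pow_four_comb [IsProbabilityMeasure P]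
    (hW : iIndepFun W P) (hg : ∀ i, HasLaw (W i) (gaussianReal 0 1) P)
    (S : Finset ι) (c : ι → ℂ) (h1 : ∑ i ∈ S, ‖c i‖ ^ 2 = 1) (h0 : ∑ i ∈ S, c i ^ 2 = 0) :
    ∫ ω, ‖∑ i ∈ S, c i * (W i ω : ℂ)‖ ^ 4 ∂P = 2 := by
  -- The vanishing of Σ c² says that the real and imaginary parts of the form are uncorrelated with
  -- equal variances, here 1/2 each.
  have hre : ∑ i ∈ S, (c i).re ^ 2 - ∑ i ∈ S, (c i).im ^ 2 = 0 := by
    have := congrArg Complex.re h0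
    rw [Complex.re_sum, Complex.zero_re] at this
    rw [← this, ← Finset.sum_sub_distrib]
    refine Finset.sum_congr rfl fun i _ => ?_
    rw [sq, sq, sq, Complex.mul_re]
  have him : ∑ i ∈ S, (c i).re * (c i).im = 0 := by
    have := congrArg Complex.im h0
    rw [Complex.im_sum, Complex.zero_im] at this
    have h2 : ∑ i ∈ S, (c i ^ 2).im = 2 * ∑ i ∈ S, (c i).re * (c i).im := by
      rw [Finset.mul_sum]
      refine Finset.sum_congr rfl fun i _ => ?_
      rw [sq, Complex.mul_im]; ring
    linarith
  rw [sum_norm_sq_eq] at h1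
  have hr : ∑ i ∈ S, (c i).re ^ 2 = 1 / 2 := by linarith
  have hi : ∑ i ∈ S, (c i).im ^ 2 = 1 / 2 := by linarith
  have hp : ∑ i ∈ S, ((c i).re + (c i).im) ^ 2 = 1 := by
    have : ∑ i ∈ S, ((c i).re + (c i).im) ^ 2 = ∑ i ∈ S, (c i).re ^ 2
        + 2 * ∑ i ∈ S, (c i).re * (c i).im + ∑ i ∈ S, (c i).im ^ 2 := by
      rw [Finset.mul_sum, ← Finset.sum_add_distrib, ← Finset.sum_add_distrib]
      exact Finset.sum_congr rfl fun i _ => by ring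
    rw [this, hr, hi, him]; norm_num
  have hm : ∑ i ∈ S, ((c i).re - (c i).im) ^ 2 = 1 := by
    have : ∑ i ∈ S, ((c i).re - (c i).im) ^ 2 = ∑ i ∈ S, (c i).re ^ 2
        - 2 * ∑ i ∈ S, (c i).re * (c i).im + ∑ i ∈ S, (c i).im ^ 2 := by
      rw [Finset.mul_sum, ← Finset.sum_sub_distrib, ← Finset.sum_add_distrib]
      exact Finset.sum_congr rfl fun i _ => by ring
    rw [this, hr, hi, him]; norm_num
  -- The identity (x² + y²)² = 2/3 x⁴ + 2/3 y⁴ + 1/6 (x+y)⁴ + 1/6 (x-y)⁴ reduces a mixed moment to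
  -- fourth moments of real linear forms, with variances 1/2, 1/2, 1, 1.
  have hpt : ∀ ω, ‖∑ i ∈ S, c i * (W i ω : ℂ)‖ ^ 4
      = (2 / 3 * (∑ i ∈ S, (c i).re * W i ω) ^ (2 * 2)
        + 2 / 3 * (∑ i ∈ S, (c i).im * W i ω) ^ (2 * 2))
        + (1 / 6 * (∑ i ∈ S, ((c i).re + (c i).im) * W i ω) ^ (2 * 2)
        + 1 / 6 * (∑ i ∈ S, ((c i).re - (c i).im) * W i ω) ^ (2 * 2)) := by
    intro ω
    have h4 : ‖∑ i ∈ S, c i * (W i ω : ℂ)‖ ^ 4 = (‖∑ i ∈ S, c i * (W i ω : ℂ)‖ ^ 2) ^ 2 := by ring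
    rw [h4, norm_sq_linear_comb]
    simp only [add_mul, sub_mul, Finset.sum_add_distrib, Finset.sum_sub_distrib]
    ring
  simp_rw [hpt]
  have I : ∀ b : ι → ℝ, Integrable (fun ω => (∑ i ∈ S, b i * W i ω) ^ (2 * 2)) P :=
    fun b => integrable_linear_comb_pow hW hg S b two_ne_zero
  have gen : ∀ A B C D : Ω → ℝ, Integrable A P → Integrable B P → Integrable C P →
      Integrable D P → ∫ ω, ((2 / 3 * A ω + 2 / 3 * B ω) + (1 / 6 * C ω + 1 / 6 * D ω)) ∂P
        = (2 / 3 * ∫ ω, A ω ∂P + 2 / 3 * ∫ ω, B ω ∂P)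
          + (1 / 6 * ∫ ω, C ω ∂P + 1 / 6 * ∫ ω, D ω ∂P) := by
    intro A B C D hA hB hC hD
    rw [integral_add (f := fun ω => 2 / 3 * A ω + 2 / 3 * B ω)
      (g := fun ω => 1 / 6 * C ω + 1 / 6 * D ω) ((hA.const_mul _).add (hB.const_mul _))
      ((hC.const_mul _).add (hD.const_mul _)),
      integral_add (hA.const_mul _) (hB.const_mul _),
      integral_add (hC.const_mul _) (hD.const_mul _)]
    simp only [integral_const_mul]
  rw [gen _ _ _ _ (I _) (I _) (I _) (I _)]
  rw [integral_linear_comb_pow hW hg S, integral_linear_comb_pow hW hg S,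
    integral_linear_comb_pow hW hg S, integral_linear_comb_pow hW hg S, hr, hi, hp, hm,
    gaussMoment_two]
  norm_num

end Gaussian

/-- Fourth moment bounds pass to limits in `L²`. -/
theorem fourth_moment_of_tendsto {Ω : Type*} [MeasurableSpace Ω] {P : Measure Ω}
    {f : ℕ → Ω → ℂ} {e : Ω → ℂ} {B : ℝ} (hf : ∀ n, MemLp (f n) 4 P)
    (hB : ∀ᶠ n in atTop, ∫ ω, ‖f n ω‖ ^ 4 ∂P ≤ B) (he : AEStronglyMeasurable e P)
    (hlim : Tendsto (fun n => eLpNorm (f n - e) 2 P) atTop (𝓝 0)) :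
    MemLp e 4 P ∧ ∫ ω, ‖e ω‖ ^ 4 ∂P ≤ B := by
  have hB0 : 0 ≤ B := by
    obtain ⟨n, hn⟩ := hB.exists
    exact (integral_nonneg fun ω => by positivity).trans hn
  have key : ∀ g : Ω → ℂ, MemLp g 4 P →
      eLpNorm g 4 P = ENNReal.ofReal ((∫ ω, ‖g ω‖ ^ 4 ∂P) ^ (1 / 4 : ℝ)) := by
    intro g hg
    rw [hg.eLpNorm_eq_integral_rpow_norm (by norm_num) (by norm_num)]
    norm_num
  -- Convergence in L² gives an almost everywhere convergent subsequence, along which the L⁴ norm is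
  -- lower semicontinuous.
  obtain ⟨ns, hns, hae⟩ := (tendstoInMeasure_of_tendsto_eLpNorm two_ne_zero
    (fun n => (hf n).1) he hlim).exists_seq_tendsto_ae
  have hle : eLpNorm e 4 P ≤ ENNReal.ofReal (B ^ (1 / 4 : ℝ)) := by
    refine Lp.eLpNorm_le_of_ae_tendsto (u := atTop) (f := fun n => f (ns n)) ?_
      (fun n => (hf _).1) hae
    filter_upwards [hns.tendsto_atTop.eventually hB] with n hn
    rw [key _ (hf _)]
    refine ENNReal.ofReal_le_ofReal (Real.rpow_le_rpow ?_ hn (by norm_num))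
    exact integral_nonneg fun ω => by positivity
  have hmem : MemLp e 4 P := ⟨he, hle.trans_lt ENNReal.ofReal_lt_top⟩
  refine ⟨hmem, ?_⟩
  rw [key _ hmem, ENNReal.ofReal_le_ofReal_iff (by positivity)] at hle
  have h0 : 0 ≤ ∫ ω, ‖e ω‖ ^ 4 ∂P := integral_nonneg fun ω => by positivity
  exact (Real.rpow_le_rpow_iff h0 hB0 (by norm_num)).1 hle

end LongMemory

/-! ### Block Fourier transforms as linear forms in the innovations. -/

namespace LongMemory

/-- The (unnormalised) discrete Fourier transform of `x b, …, x (b + N - 1)`. -/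
noncomputable def blockDFT (x : ℕ → ℝ) (N b : ℕ) (lam : ℝ) : ℂ :=
  ∑ s ∈ Finset.range N, (x (b + s) : ℂ) * phase lam s

/-- The first time of the `j`-th block. -/
def blockStart (N j : ℕ) : ℕ := N * (j - 1) + 1

theorem blockStart_add_le {N M j : ℕ} (hj : 1 ≤ j) (hjM : j ≤ M) {s : ℕ} (hs : s < N) :
    blockStart N j + s ≤ N * M := by
  have h : N * (j - 1) + N = N * j := by
    rw [← Nat.mul_succ]; congr 1; omega
  have : N * j ≤ N * M := Nat.mul_le_mul_left _ hjM
  unfold blockStart; omega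

/-- Because N is even, u_j T is an integer and the floor is exact. The window is then the j-th
block, which lies in {1, …, T}, so the extension by zero plays no part. -/
theorem localPeriodogram_blockMid (x : ℕ → ℝ) {N M j : ℕ} (hN : 0 < N) (hNe : Even N)
    (hj : 1 ≤ j) (hjM : j ≤ M) (lam : ℝ) :
    localPeriodogram x (N * M) N (blockMid (N * M) N j) lam
      = 1 / (2 * Real.pi * N) * ‖blockDFT x N (blockStart N j) lam‖ ^ 2 := by
  have hM : 0 < M := by omega
  have hT : ((N * M : ℕ) : ℝ) ≠ 0 := by exact_mod_cast (Nat.mul_pos hN hM).ne'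
  obtain ⟨h, rfl⟩ := hNe
  have hfl : ⌊blockMid ((h + h) * M) (h + h) j * (((h + h) * M : ℕ) : ℝ)⌋
      = (((h + h) * (j - 1) + h : ℕ) : ℤ) := by
    unfold blockMid
    rw [div_mul_cancel₀ _ hT]
    have : ((h + h : ℕ) : ℝ) * ((j : ℝ) - 1) + ((h + h : ℕ) : ℝ) / 2
        = (((h + h) * (j - 1) + h : ℕ) : ℝ) := by
      push_cast [Nat.cast_sub hj]; ring
    rw [this, Int.floor_natCast]
  unfold localPeriodogram blockDFT
  congr 3
  refine Finset.sum_congr rfl fun s hs => ?_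
  have hs' := Finset.mem_range.1 hs
  rw [hfl]
  have hidx : (((h + h) * (j - 1) + h : ℕ) : ℤ) - (((h + h) / 2 : ℕ) : ℤ) + 1 + (s : ℤ)
      = ((blockStart (h + h) j + s : ℕ) : ℤ) := by
    have : (h + h) / 2 = h := by omega
    rw [this]; unfold blockStart; push_cast; ring
  have hle := blockStart_add_le hj hjM hs'
  have h1 : 1 ≤ blockStart (h + h) j + s := by unfold blockStart; omega
  rw [hidx, zeroExtend, if_pos ⟨by exact_mod_cast h1, by exact_mod_cast hle⟩, Int.toNat_natCast]
  rfl

/-- Reordering a double sum along the lines `N - 1 - s + l = i`. -/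
theorem sum_range_sum_range_eq {E : Type*} [AddCommMonoid E] (F : ℕ → ℕ → ℕ → E) (N n : ℕ) :
    ∑ s ∈ Finset.range N, ∑ l ∈ Finset.range n, F s l (N - 1 + l - s)
      = ∑ i ∈ Finset.range (N + n), ∑ l ∈ Finset.Ico (i + 1 - N) (min (i + 1) n),
          F (N - 1 + l - i) l i := by
  rw [Finset.sum_sigma', Finset.sum_sigma']
  -- For fixed l, the reflection s ↦ N - 1 + l - s is its own inverse, so the same map serves both
  -- ways.
  refine Finset.sum_bij' (fun p _ => ⟨N - 1 + p.2 - p.1, p.2⟩) (fun p _ => ⟨N - 1 + p.2 - p.1, p.2⟩)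
    ?_ ?_ ?_ ?_ ?_
  · rintro ⟨s, l⟩ h
    simp only [Finset.mem_sigma, Finset.mem_range, Finset.mem_Ico] at h ⊢
    omega
  · rintro ⟨i, l⟩ h
    simp only [Finset.mem_sigma, Finset.mem_range, Finset.mem_Ico] at h ⊢
    omega
  · rintro ⟨s, l⟩ h
    simp only [Finset.mem_sigma, Finset.mem_range] at h
    have : N - 1 + l - (N - 1 + l - s) = s := by omega
    simp [this]
  · rintro ⟨i, l⟩ h
    simp only [Finset.mem_sigma, Finset.mem_range, Finset.mem_Ico] at h
    have : N - 1 + l - (N - 1 + l - i) = i := by omega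
    simp [this]
  · rintro ⟨s, l⟩ h
    simp only [Finset.mem_sigma, Finset.mem_range] at h
    have : N - 1 + l - (N - 1 + l - s) = s := by omega
    simp [this]

/-- The coefficient of `Z_{b+N-1-i}` in `∑_s X_{b+s} exp(-iλs) - A ∑_s Z_{b+s} exp(-iλs)`, where
`X` is the moving average with coefficients `φ t l`, truncated at lag `n`. -/
noncomputable def errCoef (φ : ℕ → ℕ → ℝ) (N b n : ℕ) (A : ℂ) (lam : ℝ) (i : ℕ) : ℂ :=
  (∑ l ∈ Finset.Ico (i + 1 - N) (min (i + 1) n),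
    (φ (b + (N - 1 + l - i)) l : ℂ) * phase lam (N - 1 + l - i))
    - if i < N then A * phase lam (N - 1 - i) else 0

/-- Multiplying by `phase lam i` turns the phase at s = N - 1 + l - i into `phase lam (N - 1) *
phase lam l`. Up to a unimodular factor the coefficient is thus a window of the transfer function
series, less `A` inside the block. -/
theorem norm_errCoef (φ : ℕ → ℕ → ℝ) (N b n : ℕ) (A : ℂ) (lam : ℝ) (i : ℕ) :
    ‖errCoef φ N b n A lam i‖ = ‖(∑ l ∈ Finset.Ico (i + 1 - N) (min (i + 1) n),
      (φ (b + (N - 1 + l - i)) l : ℂ) * phase lam l) - if i < N then A else 0‖ := by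
  have h : phase lam i * errCoef φ N b n A lam i = phase lam (N - 1) *
      ((∑ l ∈ Finset.Ico (i + 1 - N) (min (i + 1) n),
        (φ (b + (N - 1 + l - i)) l : ℂ) * phase lam l) - if i < N then A else 0) := by
    unfold errCoef
    rw [mul_sub, mul_sub, Finset.mul_sum, Finset.mul_sum]
    congr 1
    · refine Finset.sum_congr rfl fun l hl => ?_
      have := Finset.mem_Ico.1 hl
      have e : phase lam i * phase lam (N - 1 + l - i) = phase lam (N - 1) * phase lam l := by
        rw [← phase_add, ← phase_add]; congr 1; omega
      linear_combination (φ (b + (N - 1 + l - i)) l : ℂ) * e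
    · split_ifs with hi
      · have e : phase lam i * phase lam (N - 1 - i) = phase lam (N - 1) := by
          rw [← phase_add]; congr 1; omega
        linear_combination A * e
      · simp
  have h2 := congrArg norm h
  rwa [norm_mul, norm_mul, norm_phase, norm_phase, one_mul, one_mul] at h2

/-- Innovations are numbered backwards from the end of the block: lag l at position s meets the
innovation i = N - 1 - s + l. Those with i < N lie in the block, the others precede it. -/
theorem truncated_blockDFT_eq {Ω : Type*} (φ : ℕ → ℕ → ℝ) (Z : ℤ → Ω → ℝ) (N b n : ℕ) (A : ℂ)
    (lam : ℝ) (ω : Ω) :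
    blockDFT (fun t => ∑ l ∈ Finset.range n, φ t l * Z ((t : ℤ) - l) ω) N b lam
        - A * blockDFT (fun t => Z t ω) N b lam
      = ∑ i ∈ Finset.range (N + n),
        errCoef φ N b n A lam i * (Z ((b : ℤ) + N - 1 - i) ω : ℂ) := by
  unfold errCoef
  simp only [sub_mul, Finset.sum_sub_distrib]
  congr 1
  · unfold blockDFT
    have h1 := sum_range_sum_range_eq (fun s l i => (φ (b + s) l : ℂ) * phase lam s *
      (Z ((b : ℤ) + N - 1 - i) ω : ℂ)) N n
    simp only [Finset.sum_mul]
    rw [← h1]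
    refine Finset.sum_congr rfl fun s hs => ?_
    have hs' := Finset.mem_range.1 hs
    push_cast
    rw [Finset.sum_mul]
    refine Finset.sum_congr rfl fun l _ => ?_
    have : (b : ℤ) + s - l = (b : ℤ) + N - 1 - ((N - 1 + l - s : ℕ) : ℤ) := by omega
    rw [this]; ring
  · rw [Finset.sum_range_add]
    have h0 : ∀ x ∈ Finset.range n, (if N + x < N then A * phase lam (N - 1 - (N + x)) else 0) *
        (Z ((b : ℤ) + N - 1 - ((N + x : ℕ) : ℤ)) ω : ℂ) = 0 := fun x _ => by
      rw [if_neg (by omega), zero_mul]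
    rw [Finset.sum_eq_zero h0, add_zero, blockDFT, Finset.mul_sum, ← Finset.sum_range_reflect]
    refine Finset.sum_congr rfl fun i hi => ?_
    have hi' := Finset.mem_range.1 hi
    rw [if_pos hi']
    have : ((b + (N - 1 - i) : ℕ) : ℤ) = (b : ℤ) + N - 1 - i := by omega
    rw [this]; ring

end LongMemory

/-! ### The transfer function and variance bounds for block transforms. -/

namespace LongMemory

/-- The partial sums are Cauchy by the Abel bound on tails. This is needed because `limUnder`
carries information only when the limit exists. -/
theorem tendsto_transferFunction {ψ : ℕ → ℝ → ℝ} {u D κ : ℝ} (hD0 : 0 < D) (hD1 : D < 1 / 4)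
    (hκ : 0 ≤ κ) (h : ∀ n, SlowlyVarying D κ 0 0 n (fun l => ψ l u)) {lam : ℝ} (h0 : 0 < lam)
    (hpi : lam ≤ Real.pi) :
    Tendsto (fun n => ∑ l ∈ Finset.range n, (ψ l u : ℂ) * phase lam l) atTop
      (𝓝 (transferFunction ψ u lam)) := by
  have hc : CauchySeq (fun n => ∑ l ∈ Finset.range n, (ψ l u : ℂ) * phase lam l) := by
    refine cauchySeq_of_le_tendsto_0 (fun m : ℕ => 2 * (50 * κ * ((m : ℝ) + 1) ^ (D - 1) / lam))
      ?_ ?_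
    · intro n m N hn hm
      have key : ∀ k, N ≤ k → dist (∑ l ∈ Finset.range k, (ψ l u : ℂ) * phase lam l)
          (∑ l ∈ Finset.range N, (ψ l u : ℂ) * phase lam l)
          ≤ 50 * κ * ((N : ℝ) + 1) ^ (D - 1) / lam := by
        intro k hk
        rw [dist_eq_norm, ← Finset.sum_Ico_eq_sub _ hk]
        exact ((h k).mono (Nat.zero_le N) le_rfl).norm_sum_le_div hD0 hD1 hκ le_rfl (by simp)
          h0 hpi
      have := dist_triangle_right (∑ l ∈ Finset.range n, (ψ l u : ℂ) * phase lam l)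
        (∑ l ∈ Finset.range m, (ψ l u : ℂ) * phase lam l)
        (∑ l ∈ Finset.range N, (ψ l u : ℂ) * phase lam l)
      linarith [key n hn, key m hm]
    · have h1 : Tendsto (fun m : ℕ => ((m : ℝ) + 1) ^ (-(1 - D))) atTop (𝓝 0) :=
        (tendsto_rpow_neg_atTop (by linarith)).comp
          (tendsto_atTop_add_const_right _ _ tendsto_natCast_atTop_atTop)
      have h2 := ((h1.const_mul (50 * κ)).div_const lam).const_mul 2
      simp only [neg_sub] at h2
      simpa using h2
  obtain ⟨x, hx⟩ := cauchySeq_tendsto_of_complete hc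
  have : transferFunction ψ u lam = x := hx.limUnder_eq
  rwa [this]

theorem norm_transferFunction_sub_le {ψ : ℕ → ℝ → ℝ} {u D κ : ℝ} (hD0 : 0 < D) (hD1 : D < 1 / 4)
    (hκ : 0 ≤ κ) (h : ∀ n, SlowlyVarying D κ 0 0 n (fun l => ψ l u)) {lam : ℝ} (h0 : 0 < lam)
    (hpi : lam ≤ Real.pi) (m : ℕ) :
    ‖transferFunction ψ u lam - ∑ l ∈ Finset.range m, (ψ l u : ℂ) * phase lam l‖
      ≤ 50 * κ * ((m : ℝ) + 1) ^ (D - 1) / lam := by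
  refine le_of_tendsto ((tendsto_transferFunction hD0 hD1 hκ h h0 hpi).sub_const _).norm ?_
  filter_upwards [eventually_ge_atTop m] with n hn
  rw [← Finset.sum_Ico_eq_sub _ hn]
  exact ((h n).mono (Nat.zero_le m) le_rfl).norm_sum_le_div hD0 hD1 hκ le_rfl (by simp) h0 hpi

theorem norm_transferFunction_le {ψ : ℕ → ℝ → ℝ} {u D κ : ℝ} (hD0 : 0 < D) (hD1 : D < 1 / 4)
    (hκ : 0 ≤ κ) (h : ∀ n, SlowlyVarying D κ 0 0 n (fun l => ψ l u)) {lam : ℝ} (h0 : 0 < lam)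
    (hpi : lam ≤ Real.pi) :
    ‖transferFunction ψ u lam‖ ≤ κ * (50 + 15 / D) * lam ^ (-D) := by
  refine le_of_tendsto (tendsto_transferFunction hD0 hD1 hκ h h0 hpi).norm
    (Eventually.of_forall fun n => ?_)
  rw [Finset.range_eq_Ico]
  exact (h n).norm_sum_le_rpow hD0 hD1 hκ le_rfl zero_le_one (by simp) h0 hpi

section Variance

variable {φ : ℕ → ℕ → ℝ} {N T b n : ℕ} {D κ lam : ℝ}

/-- The lag coefficients met by one innovation inside one block are slowly varying. -/
def BlockSlowlyVarying (D κ : ℝ) (φ : ℕ → ℕ → ℝ) (T N b : ℕ) : Prop :=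
  ∀ i, SlowlyVarying D κ (1 / T) (i + 1 - N) (i + 1) (fun l => φ (b + (N - 1 + l - i)) l)

/-- One innovation meets at most N lags inside a block, each with drift 1/T, so the total drift is
at most N/T ≤ 1. -/
theorem inv_natCast_mul_le_one (hNT : N ≤ T) (hT : 0 < T) {i m : ℕ} (hm : i + 1 - N ≤ m)
    {m' : ℕ} (hm' : m' ≤ i + 1) : 1 / (T : ℝ) * ((m' : ℝ) - m) ≤ 1 := by
  have hT' : (0 : ℝ) < T := by exact_mod_cast hT
  rw [one_div, inv_mul_le_iff₀ hT', mul_one]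
  have h1 : m' ≤ m + N := by omega
  have h2 : (m' : ℝ) ≤ m + N := by exact_mod_cast h1
  have h3 : (N : ℝ) ≤ T := by exact_mod_cast hNT
  linarith

/-- The innovation N + q lies q + 1 steps before the block, so its window starts at lag q + 1. -/
theorem norm_errCoef_past_le (h : BlockSlowlyVarying D κ φ T N b) (hD0 : 0 < D) (hD1 : D < 1 / 4)
    (hκ : 0 ≤ κ) (hNT : N ≤ T) (hT : 0 < T) (h0 : 0 < lam) (hpi : lam ≤ Real.pi) (A : ℂ)
    (q : ℕ) :
    ‖errCoef φ N b n A lam (N + q)‖ ≤ 50 * κ / lam * ((q : ℝ) + 1) ^ (D - 1) := by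
  rw [norm_errCoef, if_neg (by omega), sub_zero]
  refine (((h (N + q)).mono le_rfl (min_le_left _ n)).norm_sum_le_div hD0 hD1 hκ (by positivity)
    (inv_natCast_mul_le_one hNT hT le_rfl (min_le_left _ n)) h0 hpi).trans ?_
  have : N + q + 1 - N = q + 1 := by omega
  rw [this]
  have h1 : (((q + 1 : ℕ) : ℝ) + 1) ^ (D - 1) ≤ ((q : ℝ) + 1) ^ (D - 1) :=
    Real.rpow_le_rpow_of_nonpos (by positivity) (by push_cast; linarith) (by linarith)
  rw [div_mul_eq_mul_div]
  gcongr

/-- Squares decay like q^(2D-2), which is summable since 2D < 1. The constant is 50² · 8, where 4/(1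
- 2D) ≤ 8. -/
theorem sum_past_sq_le (h : BlockSlowlyVarying D κ φ T N b) (hD0 : 0 < D) (hD1 : D < 1 / 4)
    (hκ : 0 ≤ κ) (hNT : N ≤ T) (hT : 0 < T) (h0 : 0 < lam) (hpi : lam ≤ Real.pi) (A : ℂ)
    {m m' : ℕ} (hm : m ≤ m') :
    ∑ q ∈ Finset.Ico m m', ‖errCoef φ N b n A lam (N + q)‖ ^ 2
      ≤ 20000 * κ ^ 2 / lam ^ 2 * ((m : ℝ) + 1) ^ (2 * D - 1) := by
  calc _ ≤ ∑ q ∈ Finset.Ico m m', (50 * κ / lam) ^ 2 * ((q : ℝ) + 1) ^ (-(1 - 2 * D) - 1) := by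
        refine Finset.sum_le_sum fun q _ => ?_
        have h1 := norm_errCoef_past_le (n := n) h hD0 hD1 hκ hNT hT h0 hpi A q
        have h2 := pow_le_pow_left₀ (norm_nonneg _) h1 2
        refine h2.trans_eq ?_
        rw [mul_pow, ← Real.rpow_natCast (((q : ℝ) + 1) ^ (D - 1)) 2, ← Real.rpow_mul (by positivity)]
        congr 2; push_cast; ring
    _ ≤ (50 * κ / lam) ^ 2 * (4 / (1 - 2 * D) * ((m : ℝ) + 1) ^ (-(1 - 2 * D))) := by
        rw [← Finset.mul_sum]
        exact mul_le_mul_of_nonneg_left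
          (sum_Ico_rpow_neg_le (by linarith) (by linarith) hm) (by positivity)
    _ ≤ (50 * κ / lam) ^ 2 * (8 * ((m : ℝ) + 1) ^ (-(1 - 2 * D))) := by
        have : 4 / (1 - 2 * D) ≤ 8 := by
          rw [div_le_iff₀ (by linarith)]; linarith
        gcongr
    _ = _ := by rw [neg_sub]; ring

/-- Variance bound for the Fourier transform of a block. -/
theorem sum_errCoef_zero_sq_le (h : BlockSlowlyVarying D κ φ T N b) (hD0 : 0 < D)
    (hD1 : D < 1 / 4) (hκ : 0 ≤ κ) (hNT : N ≤ T) (hT : 0 < T) (h0 : 0 < lam)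
    (hpi : lam ≤ Real.pi) (hN : 1 ≤ N * lam) :
    ∑ i ∈ Finset.range (N + n), ‖errCoef φ N b n 0 lam i‖ ^ 2
      ≤ (2 * (κ * (50 + 15 / D)) ^ 2 + 20000 * κ ^ 2) * N * lam ^ (-(2 * D)) := by
  have hN0 : (0 : ℝ) < N := by
    by_contra hcon
    have : (N : ℝ) = 0 := le_antisymm (not_lt.1 hcon) (Nat.cast_nonneg N)
    rw [this] at hN; linarith
  have hsq : (lam ^ (-D)) ^ 2 = lam ^ (-(2 * D)) := by
    rw [← Real.rpow_natCast, ← Real.rpow_mul h0.le]; congr 1; push_cast; ring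
  have hterm : ∀ i, ‖errCoef φ N b n 0 lam i‖ ^ 2 ≤ (κ * (50 + 15 / D)) ^ 2 * lam ^ (-(2 * D)) := by
    intro i
    rw [← hsq, ← mul_pow]
    refine pow_le_pow_left₀ (norm_nonneg _) ?_ 2
    rw [norm_errCoef, ite_self, sub_zero]
    have hT1 : 1 / (T : ℝ) ≤ 1 := by
      rw [div_le_one (by exact_mod_cast hT)]; exact_mod_cast hT
    exact ((h i).mono le_rfl (min_le_left _ n)).norm_sum_le_rpow hD0 hD1 hκ (by positivity) hT1
      (inv_natCast_mul_le_one hNT hT le_rfl (min_le_left _ n)) h0 hpi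
  -- The last 2N innovations are each bounded by λ^(-2D). Earlier ones contribute N^(2D-1)/λ², which
  -- is at most N λ^(-2D) because Nλ ≥ 1.
  have hfirst : ∑ i ∈ Finset.range (2 * N), ‖errCoef φ N b n 0 lam i‖ ^ 2
      ≤ 2 * N * ((κ * (50 + 15 / D)) ^ 2 * lam ^ (-(2 * D))) := by
    refine (Finset.sum_le_sum fun i _ => hterm i).trans_eq ?_
    simp
  have hlast : ∑ q ∈ Finset.Ico N (N + n), ‖errCoef φ N b n 0 lam (N + q)‖ ^ 2
      ≤ 20000 * κ ^ 2 * N * lam ^ (-(2 * D)) := by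
    refine (sum_past_sq_le h hD0 hD1 hκ hNT hT h0 hpi 0 (by omega)).trans ?_
    have e1 : ((N : ℝ) + 1) ^ (2 * D - 1) ≤ (N : ℝ) ^ (2 * D - 1) :=
      Real.rpow_le_rpow_of_nonpos hN0 (by linarith) (by linarith)
    have e2 : (N : ℝ) ^ (2 * D - 1) = N * (N : ℝ) ^ (2 * D - 2) := by
      rw [mul_comm (N : ℝ), ← Real.rpow_add_one hN0.ne']; congr 1; ring
    have e3 : (N : ℝ) ^ (2 * D - 2) ≤ (1 / lam) ^ (2 * D - 2) := by
      refine Real.rpow_le_rpow_of_nonpos (by positivity) ?_ (by linarith)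
      rwa [div_le_iff₀ h0]
    have e4 : (1 / lam) ^ (2 * D - 2) = lam ^ (-(2 * D)) * lam ^ 2 := by
      rw [one_div, Real.inv_rpow h0.le, ← Real.rpow_neg h0.le, ← Real.rpow_two,
        ← Real.rpow_add h0]
      congr 1; ring
    rw [e4] at e3
    have e5 : ((N : ℝ) + 1) ^ (2 * D - 1) ≤ N * (lam ^ (-(2 * D)) * lam ^ 2) := by
      rw [e2] at e1; exact e1.trans (by gcongr)
    calc 20000 * κ ^ 2 / lam ^ 2 * ((N : ℝ) + 1) ^ (2 * D - 1)
        ≤ 20000 * κ ^ 2 / lam ^ 2 * (N * (lam ^ (-(2 * D)) * lam ^ 2)) := by gcongr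
      _ = _ := by field_simp
  calc _ ≤ ∑ i ∈ Finset.range (2 * N + n), ‖errCoef φ N b n 0 lam i‖ ^ 2 :=
        Finset.sum_le_sum_of_subset_of_nonneg (Finset.range_mono (by omega))
          (fun _ _ _ => by positivity)
    _ = ∑ i ∈ Finset.range (2 * N), ‖errCoef φ N b n 0 lam i‖ ^ 2
          + ∑ q ∈ Finset.Ico N (N + n), ‖errCoef φ N b n 0 lam (N + q)‖ ^ 2 := by
        rw [Finset.sum_range_add, Finset.sum_Ico_eq_sum_range]
        congr 1
        have : N + n - N = n := by omega
        rw [this]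
        refine Finset.sum_congr rfl fun x _ => ?_
        rw [← add_assoc, two_mul]
    _ ≤ _ := by linarith

/-- Variance bound for the error in the local approximation of a block Fourier transform. -/
theorem sum_errCoef_sq_le (h : BlockSlowlyVarying D κ φ T N b) (hD0 : 0 < D)
    (hD1 : D < 1 / 4) (hκ : 0 ≤ κ) (hNT : N ≤ T) (hT : 0 < T) (h0 : 0 < lam)
    (hpi : lam ≤ Real.pi) {g : ℕ → ℝ} {A : ℂ}
    (hA : ∀ m : ℕ, ‖A - ∑ l ∈ Finset.range m, (g l : ℂ) * phase lam l‖
      ≤ 50 * κ * ((m : ℝ) + 1) ^ (D - 1) / lam)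
    {L : ℕ} {ε : ℝ} (hg : ∀ s < N, ∀ l < L, |φ (b + s) l - g l| ≤ ε)
    (hn : N ≤ n) :
    ∑ i ∈ Finset.range (N + n), ‖errCoef φ N b n A lam i‖ ^ 2
      ≤ N * (L * ε + 100 * κ * ((L : ℝ) + 1) ^ (D - 1) / lam) ^ 2
        + (10000 * L + 20000) * κ ^ 2 / lam ^ 2 := by
  -- As n ≥ N, truncation at lag n does not affect innovations inside the block.
  have hmin : ∀ i < N, min (i + 1) n = i + 1 := fun i hi => min_eq_left (by omega)
  have hpres : ∀ i < N, ‖errCoef φ N b n A lam i‖ = ‖(∑ l ∈ Finset.range (i + 1),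
      (φ (b + (N - 1 + l - i)) l : ℂ) * phase lam l) - A‖ := by
    intro i hi
    rw [norm_errCoef, if_pos hi, hmin i hi, show i + 1 - N = 0 by omega, Finset.range_eq_Ico]
  have hsmall : ∀ i < N, ‖errCoef φ N b n A lam i‖ ≤ 100 * κ / lam := by
    intro i hi
    rw [hpres i hi]
    have h1 := ((h i).mono (by omega : i + 1 - N ≤ 0) le_rfl).norm_sum_le_div hD0 hD1 hκ (by positivity)
      (inv_natCast_mul_le_one hNT hT (by omega) le_rfl) h0 hpi
    have h2 := hA 0
    simp only [Finset.range_zero, Finset.sum_empty, sub_zero, Nat.cast_zero, zero_add,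
      Real.one_rpow, mul_one] at h1 h2
    rw [← Finset.range_eq_Ico] at h1
    refine (norm_sub_le _ _).trans ((add_le_add h1 h2).trans_eq ?_)
    ring
  -- Lags below L are compared with the frozen coefficients, at a cost of ε each. The two remaining
  -- tails, of the drifting and of the frozen series, are Abel bounds from lag L. The fewer than L
  -- innovations with shorter sums get the crude bound `hsmall`.
  have hlarge : ∀ i < N, L ≤ i + 1 → ‖errCoef φ N b n A lam i‖
      ≤ L * ε + 100 * κ * ((L : ℝ) + 1) ^ (D - 1) / lam := by
    intro i hi hL
    rw [hpres i hi]
    have h1 := ((h i).mono (by omega : i + 1 - N ≤ L) le_rfl).norm_sum_le_div hD0 hD1 hκ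
      (by positivity) (inv_natCast_mul_le_one hNT hT (by omega) le_rfl) h0 hpi
    have h2 := hA L
    have h3 : ‖∑ l ∈ Finset.range L,
        ((φ (b + (N - 1 + l - i)) l - g l : ℝ) : ℂ) * phase lam l‖ ≤ L * ε := by
      refine (norm_sum_le _ _).trans ?_
      calc _ ≤ ∑ l ∈ Finset.range L, ε := by
            refine Finset.sum_le_sum fun l hl => ?_
            have hl' := Finset.mem_range.1 hl
            rw [norm_mul, norm_phase, mul_one, Complex.norm_real, Real.norm_eq_abs]
            exact hg _ (by omega) l hl'
        _ = _ := by simp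
    have hsplit : (∑ l ∈ Finset.range (i + 1),
        (φ (b + (N - 1 + l - i)) l : ℂ) * phase lam l) - A
        = ∑ l ∈ Finset.range L, ((φ (b + (N - 1 + l - i)) l - g l : ℝ) : ℂ) * phase lam l
          + ∑ l ∈ Finset.Ico L (i + 1), (φ (b + (N - 1 + l - i)) l : ℂ) * phase lam l
          - (A - ∑ l ∈ Finset.range L, (g l : ℂ) * phase lam l) := by
      rw [← Finset.sum_range_add_sum_Ico _ hL]
      simp only [Complex.ofReal_sub, sub_mul, Finset.sum_sub_distrib]
      ring
    rw [hsplit]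
    refine (norm_sub_le _ _).trans ((add_le_add ((norm_add_le _ _).trans (add_le_add h3 h1))
      h2).trans_eq ?_)
    ring
  have hpast := sum_past_sq_le (n := n) h hD0 hD1 hκ hNT hT h0 hpi A (Nat.zero_le n)
  rw [← Finset.range_eq_Ico] at hpast
  simp only [Nat.cast_zero, zero_add, Real.one_rpow, mul_one] at hpast
  have hmain : ∑ i ∈ Finset.range N, ‖errCoef φ N b n A lam i‖ ^ 2
      ≤ N * (L * ε + 100 * κ * ((L : ℝ) + 1) ^ (D - 1) / lam) ^ 2
        + L * (100 * κ / lam) ^ 2 := by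
    calc _ ≤ ∑ i ∈ Finset.range N, ((L * ε + 100 * κ * ((L : ℝ) + 1) ^ (D - 1) / lam) ^ 2
          + if i < L then (100 * κ / lam) ^ 2 else 0) := by
          refine Finset.sum_le_sum fun i hi => ?_
          have hi' := Finset.mem_range.1 hi
          split_ifs with hiL
          · have := pow_le_pow_left₀ (norm_nonneg _) (hsmall i hi') 2
            have h2 := sq_nonneg (L * ε + 100 * κ * ((L : ℝ) + 1) ^ (D - 1) / lam)
            linarith
          · have := pow_le_pow_left₀ (norm_nonneg _) (hlarge i hi' (by omega)) 2
            linarith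
      _ ≤ _ := by
          rw [Finset.sum_add_distrib, Finset.sum_const, Finset.card_range, nsmul_eq_mul,
            ← Finset.sum_filter, Finset.sum_const, nsmul_eq_mul]
          gcongr
          have : Finset.filter (fun i => i < L) (Finset.range N) ⊆ Finset.range L := by
            intro i hi; simp at hi ⊢; omega
          simpa using Finset.card_le_card this
  rw [Finset.sum_range_add]
  refine (add_le_add hmain hpast).trans_eq ?_
  ring

end Variance

end LongMemory

/-! ### Fourth-moment bounds for the blocks. -/

namespace LongMemory

section Model

variable {Ω : Type*} [MeasurableSpace Ω] {P : Measure Ω}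
  {X : ℕ → ℕ → Ω → ℝ} {Z : ℤ → Ω → ℝ} {ψT : ℕ → ℕ → ℕ → ℝ} {ψ : ℕ → ℝ → ℝ} {a d : ℝ → ℝ}

theorem one_le_blockStart_add (N j s : ℕ) : 1 ≤ blockStart N j + s := by
  unfold blockStart; omega

theorem IsLocallyStationary.aestronglyMeasurable_blockDFT
    (hX : IsLocallyStationary P X Z ψT ψ a d) {N M j : ℕ} (hj : 1 ≤ j) (hjM : j ≤ M) (lam : ℝ) :
    AEStronglyMeasurable (fun ω => blockDFT (fun t => X t (N * M) ω) N (blockStart N j) lam) P := by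
  unfold blockDFT
  refine Finset.aestronglyMeasurable_fun_sum _ fun s hs => ?_
  have h := hX.aemeasurable (N * M) (blockStart N j + s) (one_le_blockStart_add N j s)
    (blockStart_add_le hj hjM (Finset.mem_range.1 hs))
  exact (Complex.continuous_ofReal.comp_aestronglyMeasurable h.aestronglyMeasurable).mul_const _

/-- The moving average is truncated at lag n, the Gaussian bound is applied with constant 2² · 3 =
12, and n tends to infinity by `fourth_moment_of_tendsto`. -/
theorem IsLocallyStationary.block_error_moment [IsProbabilityMeasure P]
    (hX : IsLocallyStationary P X Z ψT ψ a d) {N M j : ℕ} (hj : 1 ≤ j) (hjM : j ≤ M) (lam : ℝ)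
    (A : ℂ) {V : ℝ}
    (hV : ∀ n, N ≤ n → ∑ i ∈ Finset.range (N + n),
      ‖errCoef (fun t l => ψT t (N * M) l) N (blockStart N j) n A lam i‖ ^ 2 ≤ V) :
    MemLp (fun ω => blockDFT (fun t => X t (N * M) ω) N (blockStart N j) lam
      - A * blockDFT (fun t => Z t ω) N (blockStart N j) lam) 4 P ∧
    ∫ ω, ‖blockDFT (fun t => X t (N * M) ω) N (blockStart N j) lam
      - A * blockDFT (fun t => Z t ω) N (blockStart N j) lam‖ ^ 4 ∂P ≤ 12 * V ^ 2 := by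
  set b := blockStart N j with hb
  have hW : iIndepFun (fun i : ℕ => Z ((b : ℤ) + N - 1 - i)) P :=
    hX.indep.precomp (g := fun i : ℕ => (b : ℤ) + N - 1 - i) (fun i k h => by
      simp only at h; omega)
  have hg : ∀ i : ℕ, HasLaw (Z ((b : ℤ) + N - 1 - i)) (gaussianReal 0 1) P :=
    fun i => hX.gaussian _
  set f : ℕ → Ω → ℂ := fun n ω =>
    blockDFT (fun t => ∑ l ∈ Finset.range n, ψT t (N * M) l * Z ((t : ℤ) - l) ω) N b lam
      - A * blockDFT (fun t => Z t ω) N b lam with hf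
  have hfeq : ∀ n, f n = fun ω => ∑ i ∈ Finset.range (N + n),
      errCoef (fun t l => ψT t (N * M) l) N b n A lam i * (Z ((b : ℤ) + N - 1 - i) ω : ℂ) := by
    intro n; ext ω
    exact truncated_blockDFT_eq (fun t l => ψT t (N * M) l) Z N b n A lam ω
  have hZ : AEStronglyMeasurable (fun ω => A * blockDFT (fun t => Z t ω) N b lam) P := by
    unfold blockDFT
    refine (Finset.aestronglyMeasurable_fun_sum _ fun s hs => ?_).const_mul _
    exact (Complex.continuous_ofReal.comp_aestronglyMeasurable
      (hX.gaussian _).aemeasurable.aestronglyMeasurable).mul_const _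
  refine fourth_moment_of_tendsto (f := f) (fun n => ?_) ?_
    ((hX.aestronglyMeasurable_blockDFT hj hjM lam).sub hZ) ?_
  · rw [hfeq]
    exact memLp_complex_comb hg _ _ (by norm_num)
  · filter_upwards [eventually_ge_atTop N] with n hn
    rw [hfeq]
    have h1 := integral_norm_pow_comb_le hW hg (Finset.range (N + n))
      (errCoef (fun t l => ψT t (N * M) l) N b n A lam) two_ne_zero
    have h2 : (∑ i ∈ Finset.range (N + n),
      ‖errCoef (fun t l => ψT t (N * M) l) N b n A lam i‖ ^ 2) ^ 2 ≤ V ^ 2 :=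
      pow_le_pow_left₀ (Finset.sum_nonneg fun _ _ => by positivity) (hV n hn) 2
    rw [gaussMoment_two] at h1
    norm_num at h1
    linarith
  · have hdiff : ∀ n, f n - (fun ω => blockDFT (fun t => X t (N * M) ω) N b lam
        - A * blockDFT (fun t => Z t ω) N b lam)
        = ∑ s ∈ Finset.range N, fun ω => ((∑ l ∈ Finset.range n, ψT (b + s) (N * M) l *
          Z (((b + s : ℕ) : ℤ) - l) ω - X (b + s) (N * M) ω : ℝ) : ℂ) * phase lam s := by
      intro n; ext ω
      simp only [hf, Pi.sub_apply, blockDFT, Finset.sum_apply, sub_sub_sub_cancel_right,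
        ← Finset.sum_sub_distrib]
      refine Finset.sum_congr rfl fun s _ => ?_
      push_cast
      ring
    have hconv : Tendsto (fun n => ∑ s ∈ Finset.range N, eLpNorm
        (fun ω => X (b + s) (N * M) ω - ∑ l ∈ Finset.range n, ψT (b + s) (N * M) l *
          Z (((b + s : ℕ) : ℤ) - l) ω) 2 P) atTop (𝓝 0) := by
      have := tendsto_finsetSum (Finset.range N) fun s hs =>
        hX.ma_representation (N * M) (b + s) (one_le_blockStart_add N j s)
          (blockStart_add_le hj hjM (Finset.mem_range.1 hs))
      simpa using this
    refine tendsto_of_tendsto_of_tendsto_of_le_of_le tendsto_const_nhds hconv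
      (fun n => zero_le) fun n => ?_
    simp only
    rw [hdiff]
    refine (eLpNorm_sum_le (fun s hs => ?_) (by norm_num)).trans
      (Finset.sum_le_sum fun s hs => ?_)
    · refine (Complex.continuous_ofReal.comp_aestronglyMeasurable ?_).mul_const _
      refine AEStronglyMeasurable.sub ?_ ?_
      · exact Finset.aestronglyMeasurable_fun_sum _ fun l _ =>
          ((hX.gaussian _).aemeasurable.aestronglyMeasurable).const_mul _
      · exact (hX.aemeasurable (N * M) (b + s) (one_le_blockStart_add N j s)
          (blockStart_add_le hj hjM (Finset.mem_range.1 hs))).aestronglyMeasurable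
    · refine (eLpNorm_congr_norm_ae (Eventually.of_forall fun ω => ?_)).le
      rw [norm_mul, norm_phase, mul_one, Complex.norm_real, norm_sub_rev]

theorem abs_blockTime_sub_le {N M j s : ℕ} {u : ℝ} (hN : 0 < N) (hj : 1 ≤ j) (hjM : j ≤ M)
    (hs : s < N) (hu : u = blockMid (N * M) N j) :
    |((blockStart N j + s : ℕ) : ℝ) / ((N * M : ℕ) : ℝ) - u| ≤ 1 / M := by
  have hM : (0 : ℝ) < M := by exact_mod_cast (by omega : 0 < M)
  have hN' : (0 : ℝ) < N := by exact_mod_cast hN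
  have h1 : ((blockStart N j + s : ℕ) : ℝ) / ((N * M : ℕ) : ℝ) - u
      = (1 + (s : ℝ) - N / 2) / (N * M) := by
    rw [hu, blockMid, ← sub_div, blockStart]
    push_cast [Nat.cast_sub hj]
    congr 1; ring
  have h2 : (s : ℝ) + 1 ≤ N := by exact_mod_cast hs
  rw [h1, abs_div, abs_of_pos (by positivity : (0 : ℝ) < N * M), div_le_div_iff₀ (by positivity) hM]
  have : |1 + (s : ℝ) - N / 2| ≤ N := by
    rw [abs_le]; constructor <;> linarith [s.cast_nonneg (α := ℝ)]
  nlinarith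

theorem blockMid_mem_unit {N M j : ℕ} (hN : 0 < N) (hj : 1 ≤ j) (hjM : j ≤ M) :
    blockMid (N * M) N j ∈ Icc (0 : ℝ) 1 := by
  have hM : (0 : ℝ) < M := by exact_mod_cast (by omega : 0 < M)
  have hN' : (0 : ℝ) < N := by exact_mod_cast hN
  have h1 : (1 : ℝ) ≤ j := by exact_mod_cast hj
  have h2 : (j : ℝ) ≤ M := by exact_mod_cast hjM
  unfold blockMid
  push_cast
  refine ⟨?_, ?_⟩
  · have : 0 ≤ (N : ℝ) * ((j : ℝ) - 1) := mul_nonneg hN'.le (by linarith)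
    positivity
  · rw [div_le_one (by positivity)]; nlinarith

/-- Fourth moment bounds for block Fourier transforms and for the error in approximating them by
those of the innovations, in terms of constants not depending on the block. -/
theorem IsLocallyStationary.exists_block_bounds [IsProbabilityMeasure P]
    (hX : IsLocallyStationary P X Z ψT ψ a d) (hd : dSup d < 1 / 4) :
    ∃ D C : ℝ, 0 < D ∧ D < 1 / 4 ∧ 0 < C ∧
      (∀ u ∈ Icc (0 : ℝ) 1, ∀ lam, 0 < lam → lam ≤ Real.pi →
        ‖transferFunction ψ u lam‖ ^ 2 ≤ C * lam ^ (-(2 * D)) ∧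
        Tendsto (fun n => ∑ l ∈ Finset.range n, (ψ l u : ℂ) * phase lam l) atTop
          (𝓝 (transferFunction ψ u lam))) ∧
      (∀ N M j : ℕ, 0 < N → 1 ≤ j → j ≤ M → ∀ lam, 0 < lam → lam ≤ Real.pi → 1 ≤ N * lam →
        MemLp (fun ω => blockDFT (fun t => X t (N * M) ω) N (blockStart N j) lam) 4 P ∧
        ∫ ω, ‖blockDFT (fun t => X t (N * M) ω) N (blockStart N j) lam‖ ^ 4 ∂P
          ≤ C * (N * lam ^ (-(2 * D))) ^ 2) ∧
      ∀ L : ℕ, ∃ K : ℝ, ∀ N M j : ℕ, 0 < N → 1 ≤ j → j ≤ M →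
        ∀ lam, 0 < lam → lam ≤ Real.pi →
        MemLp (fun ω => blockDFT (fun t => X t (N * M) ω) N (blockStart N j) lam
          - transferFunction ψ (blockMid (N * M) N j) lam
            * blockDFT (fun t => Z t ω) N (blockStart N j) lam) 4 P ∧
        ∫ ω, ‖blockDFT (fun t => X t (N * M) ω) N (blockStart N j) lam
          - transferFunction ψ (blockMid (N * M) N j) lam
            * blockDFT (fun t => Z t ω) N (blockStart N j) lam‖ ^ 4 ∂P
          ≤ 12 * (N * ((K / M + C * ((L : ℝ) + 1) ^ (D - 1) / lam) ^ 2
            + C * (L + 1) / (N * lam ^ 2))) ^ 2 := by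
  obtain ⟨D, hD, hD1⟩ := exists_between hd
  have hD0 : 0 < D := hX.dSup_nonneg.trans_lt hD
  obtain ⟨κ, hκ, hκψ, hκT⟩ := hX.exists_slowlyVarying hD hD1
  have hBSV : ∀ N M j : ℕ, 0 < N → 1 ≤ j → j ≤ M →
      BlockSlowlyVarying D κ (fun t l => ψT t (N * M) l) (N * M) N (blockStart N j) := by
    intro N M j hN hj hjM i
    refine hκT (N * M) _ _ (fun l => blockStart N j + (N - 1 + l - i)) (fun l h1 h2 =>
      ⟨one_le_blockStart_add _ _ _, blockStart_add_le hj hjM (by omega)⟩) (fun l h1 h2 => ?_)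
    omega
  set B := 2 * (κ * (50 + 15 / D)) ^ 2 + 20000 * κ ^ 2 with hB
  have hB0 : 0 ≤ B := by positivity
  -- A single constant that dominates those of the three bounds; the summand 1 makes it positive.
  set C := 1 + B + 12 * B ^ 2 + 100 * κ with hC
  have hC0 : 0 < C := by positivity
  refine ⟨D, C, hD0, hD1, hC0, fun u hu lam h0 hpi =>
    ⟨?_, tendsto_transferFunction hD0 hD1 hκ (hκψ u hu) h0 hpi⟩,
    fun N M j hN hj hjM lam h0 hpi hNl => ?_, fun L => ?_⟩
  · have h1 := pow_le_pow_left₀ (norm_nonneg _)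
      (norm_transferFunction_le hD0 hD1 hκ (hκψ u hu) h0 hpi) 2
    have hsq : (lam ^ (-D)) ^ 2 = lam ^ (-(2 * D)) := by
      rw [← Real.rpow_natCast, ← Real.rpow_mul h0.le]; congr 1; push_cast; ring
    rw [mul_pow, hsq] at h1
    refine h1.trans (mul_le_mul_of_nonneg_right ?_ (by positivity))
    have : 0 ≤ (κ * (50 + 15 / D)) ^ 2 := by positivity
    nlinarith [sq_nonneg κ, sq_nonneg B]
  · have hM : 0 < M := by omega
    -- With A = 0 the error is the block transform itself.
    have := hX.block_error_moment hj hjM lam 0 (V := B * N * lam ^ (-(2 * D))) fun n _ =>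
      sum_errCoef_zero_sq_le (hBSV N M j hN hj hjM) hD0 hD1 hκ (Nat.le_mul_of_pos_right N hM)
        (Nat.mul_pos hN hM) h0 hpi hNl
    simp only [zero_mul, sub_zero] at this
    refine ⟨this.1, this.2.trans ?_⟩
    have e : 12 * (B * N * lam ^ (-(2 * D))) ^ 2 = 12 * B ^ 2 * (N * lam ^ (-(2 * D))) ^ 2 := by
      ring
    rw [e]
    gcongr
    linarith
  · obtain ⟨K, hK0, hK⟩ := hX.exists_frozen_bound hd L
    -- At most L lags each cost K(1/T + 1/M) ≤ 2K/M, the width of a block in rescaled time being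
    -- 1/M.
    refine ⟨L * (K * 2), fun N M j hN hj hjM lam h0 hpi => ?_⟩
    have hM : 0 < M := by omega
    have hM' : (0 : ℝ) < M := by exact_mod_cast hM
    have hN' : (0 : ℝ) < N := by exact_mod_cast hN
    have hu := blockMid_mem_unit hN hj hjM
    have := hX.block_error_moment hj hjM lam (transferFunction ψ (blockMid (N * M) N j) lam)
      fun n hn => sum_errCoef_sq_le (hBSV N M j hN hj hjM) hD0 hD1 hκ
        (Nat.le_mul_of_pos_right N hM) (Nat.mul_pos hN hM) h0 hpi
        (norm_transferFunction_sub_le hD0 hD1 hκ (hκψ _ hu) h0 hpi) (L := L)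
        (ε := K * 2 / M) (fun s hs l hl => by
          refine (hK (N * M) _ (one_le_blockStart_add N j s) (blockStart_add_le hj hjM hs) _ hu l
            hl).trans ?_
          have h1 := abs_blockTime_sub_le hN hj hjM hs rfl
          have h2 : 1 / ((N * M : ℕ) : ℝ) ≤ 1 / M := by
            push_cast
            apply one_div_le_one_div_of_le hM'
            have : (1 : ℝ) ≤ N := by exact_mod_cast hN
            nlinarith
          have h3 : K * 2 / M = K * (1 / M + 1 / M) := by ring
          rw [h3]
          exact mul_le_mul_of_nonneg_left (add_le_add h2 h1) hK0) hn
    refine ⟨this.1, this.2.trans ?_⟩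
    have hLC : 100 * κ ≤ C := by
      have : 0 ≤ 1 + B + 12 * B ^ 2 := by positivity
      linarith
    have hBC : 20000 * κ ^ 2 ≤ C := by
      have : 0 ≤ 12 * B ^ 2 + 100 * κ + 2 * (κ * (50 + 15 / D)) ^ 2 := by positivity
      linarith
    have hL1 : (0 : ℝ) ≤ L := L.cast_nonneg
    have e1 : (L : ℝ) * (K * 2 / M) = L * (K * 2) / M := by ring
    have e2 : (10000 * (L : ℝ) + 20000) * κ ^ 2 / lam ^ 2
        ≤ N * (C * (L + 1) / (N * lam ^ 2)) := by
      have : (N : ℝ) * (C * (L + 1) / (N * lam ^ 2)) = C * (L + 1) / lam ^ 2 := by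
        field_simp
      rw [this]
      refine div_le_div_of_nonneg_right ?_ (by positivity)
      nlinarith [mul_nonneg hL1 (sq_nonneg κ), mul_le_mul_of_nonneg_left hBC hL1]
    rw [e1, mul_add (N : ℝ)]
    gcongr

end Model

end LongMemory

/-! ### The innovation periodogram and Bartlett's approximation. -/

namespace LongMemory

/-- This is the circularity of the innovation transform: the squared character is an N-th root of
unity, different from 1 because 0 < 2k < N, so its geometric sum vanishes. -/
theorem sum_phase_sq_eq_zero {N k : ℕ} (hk : 1 ≤ k) (hkN : 2 * k < N) :
    ∑ s ∈ Finset.range N, phase (fourierFreq N k) s ^ 2 = 0 := by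
  have hN : (N : ℂ) ≠ 0 := by exact_mod_cast (by omega : N ≠ 0)
  have hNr : (0 : ℝ) < N := by exact_mod_cast (by omega : 0 < N)
  set z : ℂ := Complex.exp (-Complex.I * (fourierFreq N k : ℝ)) ^ 2 with hz
  have h1 : ∀ s, phase (fourierFreq N k) s ^ 2 = z ^ s := fun s => by
    rw [phase_eq_pow, hz, ← pow_mul, ← pow_mul, mul_comm s]
  simp_rw [h1]
  have hexp : z = Complex.exp (-(2 * Complex.I * (fourierFreq N k : ℝ))) := by
    rw [hz, ← Complex.exp_nat_mul]; congr 1; push_cast; ring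
  have hzN : z ^ N = 1 := by
    rw [hexp, ← Complex.exp_nat_mul, Complex.exp_eq_one_iff]
    refine ⟨-(2 * k), ?_⟩
    unfold fourierFreq
    push_cast
    field_simp
  have hz1 : z ≠ 1 := by
    rw [hexp, Ne, Complex.exp_eq_one_iff]
    rintro ⟨n, hn⟩
    have him := congrArg Complex.im hn
    simp at him
    unfold fourierFreq at him
    have h2 : (n : ℝ) * N = -(2 * k) := by
      have hpi := Real.pi_pos
      have h3 : -(2 * (2 * Real.pi * k / N)) * N = n * (2 * Real.pi) * N := by rw [him]
      have h4 : -(2 * (2 * Real.pi * k / N)) * N = -(2 * k) * (2 * Real.pi) := by field_simp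
      rw [h4] at h3
      have h5 : (2 * Real.pi) * ((n : ℝ) * N - -(2 * k)) = 0 := by linarith
      rcases mul_eq_zero.1 h5 with h | h
      · linarith
      · linarith
    have h3 : n * (N : ℤ) = -(2 * k) := by exact_mod_cast h2
    have hk' : (1 : ℤ) ≤ k := by exact_mod_cast hk
    have hkN' : (2 : ℤ) * k < N := by exact_mod_cast hkN
    rcases lt_or_ge n 0 with hn0 | hn0
    · nlinarith
    · nlinarith
  rw [geom_sum_eq hz1, hzN, sub_self, zero_div]

section Noise

variable {Ω : Type*} [MeasurableSpace Ω] {P : Measure Ω} {Z : ℤ → Ω → ℝ}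

theorem blockDFT_noise_eq {Ω : Type*} (Z : ℤ → Ω → ℝ) (N b : ℕ) (lam : ℝ) (ω : Ω) :
    blockDFT (fun t => Z t ω) N b lam
      = ∑ s ∈ Finset.range N, phase lam s * (Z ((b + s : ℕ) : ℤ) ω : ℂ) := by
  unfold blockDFT
  exact Finset.sum_congr rfl fun s _ => mul_comm _ _

theorem memLp_blockDFT_noise (hg : ∀ i, HasLaw (Z i) (gaussianReal 0 1) P) (N b : ℕ) (lam : ℝ)
    {p : ENNReal} (hp : p ≠ ⊤) : MemLp (fun ω => blockDFT (fun t => Z t ω) N b lam) p P := by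
  simp_rw [blockDFT_noise_eq]
  exact memLp_complex_comb (W := fun s : ℕ => Z ((b + s : ℕ) : ℤ)) (fun _ => hg _) _ _ hp

theorem indep_shift (hZ : iIndepFun Z P) (b : ℕ) :
    iIndepFun (fun s : ℕ => Z ((b + s : ℕ) : ℤ)) P :=
  hZ.precomp (g := fun s : ℕ => ((b + s : ℕ) : ℤ)) (fun i k h => by simp only at h; omega)

theorem integral_norm_pow_noise_le [IsProbabilityMeasure P] (hZ : iIndepFun Z P)
    (hg : ∀ i, HasLaw (Z i) (gaussianReal 0 1) P) (N b : ℕ) (lam : ℝ) {q : ℕ} (hq : q ≠ 0) :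
    ∫ ω, ‖blockDFT (fun t => Z t ω) N b lam‖ ^ (2 * q) ∂P
      ≤ 2 ^ q * gaussMoment q * (N : ℝ) ^ q := by
  simp_rw [blockDFT_noise_eq]
  refine (integral_norm_pow_comb_le (indep_shift hZ b) (fun _ => hg _) _ (phase lam) hq).trans_eq ?_
  simp [norm_phase]

theorem integral_norm_sq_noise [IsProbabilityMeasure P] (hZ : iIndepFun Z P)
    (hg : ∀ i, HasLaw (Z i) (gaussianReal 0 1) P) (N b : ℕ) (lam : ℝ) :
    ∫ ω, ‖blockDFT (fun t => Z t ω) N b lam‖ ^ 2 ∂P = N := by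
  simp_rw [blockDFT_noise_eq]
  rw [integral_norm_sq_comb (indep_shift hZ b) (fun _ => hg _) _ (phase lam)]
  simp [norm_phase]

/-- Dividing by √N reduces this to the circular case. The strict inequality matters: at 2k = N the
transform is real and the moment is 3N². -/
theorem integral_norm_pow_four_noise [IsProbabilityMeasure P] (hZ : iIndepFun Z P)
    (hg : ∀ i, HasLaw (Z i) (gaussianReal 0 1) P) {N k : ℕ} (b : ℕ) (hk : 1 ≤ k)
    (hkN : 2 * k < N) :
    ∫ ω, ‖blockDFT (fun t => Z t ω) N b (fourierFreq N k)‖ ^ 4 ∂P = 2 * (N : ℝ) ^ 2 := by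
  have hN : (0 : ℝ) < N := by exact_mod_cast (by omega : 0 < N)
  set r : ℝ := Real.sqrt N with hr
  have hr0 : 0 < r := Real.sqrt_pos.2 hN
  have hr2 : r ^ 2 = N := Real.sq_sqrt hN.le
  have h := integral_norm_pow_four_comb (indep_shift hZ b) (fun _ => hg _) (Finset.range N)
    (fun s => ((r⁻¹ : ℝ) : ℂ) * phase (fourierFreq N k) s)
    (by simp [norm_phase, hr2]; field_simp)
    (by simp_rw [mul_pow]; rw [← Finset.mul_sum, sum_phase_sq_eq_zero hk hkN, mul_zero])
  have hpt : ∀ ω, ‖blockDFT (fun t => Z t ω) N b (fourierFreq N k)‖ ^ 4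
      = (N : ℝ) ^ 2 * ‖∑ s ∈ Finset.range N, ((r⁻¹ : ℝ) : ℂ) * phase (fourierFreq N k) s *
        (Z ((b + s : ℕ) : ℤ) ω : ℂ)‖ ^ 4 := by
    intro ω
    simp_rw [mul_assoc]
    rw [← Finset.mul_sum, ← blockDFT_noise_eq, norm_mul, mul_pow, Complex.norm_real,
      Real.norm_eq_abs, abs_of_pos (by positivity), ← hr2]
    field_simp
  simp_rw [hpt]
  rw [integral_const_mul, h, mul_comm]

end Noise

theorem memLp_norm_sq {Ω : Type*} [MeasurableSpace Ω] {P : Measure Ω} {J : Ω → ℂ}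
    (h : MemLp J 4 P) : MemLp (fun ω => ‖J ω‖ ^ 2) 2 P := by
  rw [memLp_two_iff_integrable_sq
    (show AEStronglyMeasurable (fun ω => ‖J ω‖ ^ 2) P from h.1.norm.pow 2)]
  have := (show MemLp J ((4 : ℕ) : ENNReal) P by exact_mod_cast h).integrable_norm_pow (by norm_num)
  refine this.congr (Eventually.of_forall fun ω => ?_)
  simp only; ring

theorem integrable_norm_pow_four {Ω : Type*} [MeasurableSpace Ω] {P : Measure Ω} {J : Ω → ℂ}
    (h : MemLp J 4 P) : Integrable (fun ω => ‖J ω‖ ^ 4) P :=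
  (show MemLp J ((4 : ℕ) : ENNReal) P by exact_mod_cast h).integrable_norm_pow (by norm_num)

theorem integral_sq_norm_sq_sub_le {Ω : Type*} [MeasurableSpace Ω] {P : Measure Ω} {J J' : Ω → ℂ}
    (h : MemLp J 4 P) (h' : MemLp J' 4 P) :
    ∫ ω, (‖J ω‖ ^ 2 - ‖J' ω‖ ^ 2) ^ 2 ∂P
      ≤ 2 * ∫ ω, ‖J ω‖ ^ 4 ∂P + 2 * ∫ ω, ‖J' ω‖ ^ 4 ∂P := by
  rw [← integral_const_mul, ← integral_const_mul, ← integral_add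
    ((integrable_norm_pow_four h).const_mul 2) ((integrable_norm_pow_four h').const_mul 2)]
  refine integral_mono_of_nonneg (Eventually.of_forall fun ω => by positivity)
    (((integrable_norm_pow_four h).const_mul 2).add ((integrable_norm_pow_four h').const_mul 2))
    (Eventually.of_forall fun ω => ?_)
  simp only
  nlinarith [sq_nonneg (‖J ω‖ ^ 2 + ‖J' ω‖ ^ 2)]

/-- With e = |J - J'| and y = |J'|, the integrand is at most e²(e + 2y)². The mixed term e²y² is
split by a weighted inequality between the means; the weight v is left free to match the size of the
error. -/
theorem integral_sq_norm_sq_sub_le_of_error {Ω : Type*} [MeasurableSpace Ω] {P : Measure Ω}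
    {J J' : Ω → ℂ} (h : MemLp (fun ω => J ω - J' ω) 4 P) (h' : MemLp J' 4 P) {v : ℝ}
    (hv : 0 < v) :
    ∫ ω, (‖J ω‖ ^ 2 - ‖J' ω‖ ^ 2) ^ 2 ∂P
      ≤ (2 + 4 / v) * ∫ ω, ‖J ω - J' ω‖ ^ 4 ∂P + 4 * v * ∫ ω, ‖J' ω‖ ^ 4 ∂P := by
  rw [← integral_const_mul, ← integral_const_mul, ← integral_add
    ((integrable_norm_pow_four h).const_mul _) ((integrable_norm_pow_four h').const_mul _)]
  refine integral_mono_of_nonneg (Eventually.of_forall fun ω => by positivity)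
    (((integrable_norm_pow_four h).const_mul _).add ((integrable_norm_pow_four h').const_mul _))
    (Eventually.of_forall fun ω => ?_)
  simp only
  set x := ‖J ω‖
  set y := ‖J' ω‖
  set e := ‖J ω - J' ω‖
  have hy : 0 ≤ y := norm_nonneg _
  have hx : 0 ≤ x := norm_nonneg _
  have he : 0 ≤ e := norm_nonneg _
  have hxy : |x - y| ≤ e := abs_norm_sub_norm_le _ _
  have hsum : x + y ≤ e + 2 * y := by have := (abs_le.1 hxy).2; linarith
  have h1 : (x ^ 2 - y ^ 2) ^ 2 ≤ e ^ 2 * (e + 2 * y) ^ 2 := by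
    have : (x ^ 2 - y ^ 2) ^ 2 = |x - y| ^ 2 * (x + y) ^ 2 := by rw [sq_abs]; ring
    rw [this]; gcongr
  have h2 : e ^ 2 * (e + 2 * y) ^ 2 ≤ 2 * e ^ 4 + 8 * (e ^ 2 * y ^ 2) := by
    nlinarith [mul_nonneg (sq_nonneg e) (sq_nonneg (e - 2 * y))]
  have h3 : 8 * (e ^ 2 * y ^ 2) ≤ 4 / v * e ^ 4 + 4 * v * y ^ 4 := by
    have h4 : 4 / v * e ^ 4 + 4 * v * y ^ 4 - 8 * (e ^ 2 * y ^ 2)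
        = 4 / v * (e ^ 2 - v * y ^ 2) ^ 2 := by field_simp; ring
    have : 0 ≤ 4 / v * (e ^ 2 - v * y ^ 2) ^ 2 := by positivity
    linarith
  linarith

/-- The normalised periodogram of the innovations over the `j`-th block. -/
noncomputable def noisePeriodogram {Ω : Type*} (Z : ℤ → Ω → ℝ) (N j : ℕ) (lam : ℝ) (ω : Ω) : ℝ :=
  1 / (N : ℝ) * ‖blockDFT (fun t => Z t ω) N (blockStart N j) lam‖ ^ 2

section Model

variable {Ω : Type*} [MeasurableSpace Ω] {P : Measure Ω} [IsProbabilityMeasure P]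
  {X : ℕ → ℕ → Ω → ℝ} {Z : ℤ → Ω → ℝ} {ψT : ℕ → ℕ → ℕ → ℝ} {ψ : ℕ → ℝ → ℝ} {a d : ℝ → ℝ}

theorem spectralDensity_nonneg (ψ : ℕ → ℝ → ℝ) (u lam : ℝ) : 0 ≤ spectralDensity ψ u lam := by
  have := Real.pi_pos
  unfold spectralDensity; positivity

/-- The mean square distance of the local periodogram from its Bartlett approximation. -/
noncomputable def bartlettError (P : Measure Ω) (X : ℕ → ℕ → Ω → ℝ) (Z : ℤ → Ω → ℝ)
    (ψ : ℕ → ℝ → ℝ) (N M j : ℕ) (lam : ℝ) : ℝ :=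
  ∫ ω, (localPeriodogram (fun t => X t (N * M) ω) (N * M) N (blockMid (N * M) N j) lam
    - spectralDensity ψ (blockMid (N * M) N j) lam * noisePeriodogram Z N j lam ω) ^ 2 ∂P

/-- The last two clauses are the domination and the pointwise limit needed for dominated convergence
over the grid. The limit is stated along moving blocks and frequencies because the nodes ⌈uM⌉ and
⌈xN⌉ move with n. -/
theorem IsLocallyStationary.exists_bartlett
    (hX : IsLocallyStationary P X Z ψT ψ a d) (hd : dSup d < 1 / 4) :
    ∃ D C : ℝ, 0 < D ∧ D < 1 / 4 ∧ 0 < C ∧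
      (∀ u ∈ Icc (0 : ℝ) 1, ∀ lam, 0 < lam → lam ≤ Real.pi →
        spectralDensity ψ u lam ≤ C * lam ^ (-(2 * D)) ∧
        Tendsto (fun n => ∑ l ∈ Finset.range n, (ψ l u : ℂ) * phase lam l) atTop
          (𝓝 (transferFunction ψ u lam))) ∧
      (∀ N M j : ℕ, 0 < N → Even N → 1 ≤ j → j ≤ M → ∀ lam, 0 < lam → lam ≤ Real.pi →
        1 ≤ N * lam →
        MemLp (fun ω => localPeriodogram (fun t => X t (N * M) ω) (N * M) N
          (blockMid (N * M) N j) lam) 2 P ∧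
        bartlettError P X Z ψ N M j lam ≤ C * lam ^ (-(4 * D))) ∧
      ∀ N M j : ℕ → ℕ, ∀ lam : ℕ → ℝ, ∀ lam0 : ℝ, (∀ n, 0 < N n) → (∀ n, Even (N n)) →
        (∀ᶠ n in atTop, 1 ≤ j n ∧ j n ≤ M n) → (∀ᶠ n in atTop, 0 < lam n ∧ lam n ≤ Real.pi) →
        Tendsto N atTop atTop → Tendsto M atTop atTop → 0 < lam0 →
        Tendsto lam atTop (𝓝 lam0) →
        Tendsto (fun n => bartlettError P X Z ψ (N n) (M n) (j n) (lam n)) atTop (𝓝 0) := by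
  obtain ⟨D, C, hD0, hD1, hC, hA, hJ, hE⟩ := hX.exists_block_bounds hd
  have hpi3 := Real.pi_gt_three
  have hpow : ∀ lam : ℝ, 0 < lam → (lam ^ (-(2 * D))) ^ 2 = lam ^ (-(4 * D)) := fun lam h0 => by
    rw [← Real.rpow_natCast, ← Real.rpow_mul h0.le]; congr 1; push_cast; ring
  set U : ℕ → ℕ → ℝ → Ω → ℂ := fun N j lam ω =>
    blockDFT (fun t => Z t ω) N (blockStart N j) lam with hU
  set J : ℕ → ℕ → ℕ → ℝ → Ω → ℂ := fun N M j lam ω =>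
    blockDFT (fun t => X t (N * M) ω) N (blockStart N j) lam with hJdef
  set J' : ℕ → ℕ → ℕ → ℝ → Ω → ℂ := fun N M j lam ω =>
    transferFunction ψ (blockMid (N * M) N j) lam * U N j lam ω with hJ'def
  have hU4 : ∀ N j lam, MemLp (U N j lam) 4 P := fun N j lam =>
    memLp_blockDFT_noise hX.gaussian N _ lam (by norm_num)
  have hJ'4 : ∀ N M j lam, MemLp (J' N M j lam) 4 P := fun N M j lam =>
    (hU4 N j lam).const_mul _
  have hJ'bd : ∀ N M j : ℕ, 0 < N → 1 ≤ j → j ≤ M → ∀ lam, 0 < lam → lam ≤ Real.pi →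
      ∫ ω, ‖J' N M j lam ω‖ ^ 4 ∂P ≤ 12 * C ^ 2 * (N : ℝ) ^ 2 * lam ^ (-(4 * D)) := by
    intro N M j hN hj hjM lam h0 hpi
    have h1 := integral_norm_pow_noise_le hX.indep hX.gaussian N (blockStart N j) lam two_ne_zero
    rw [gaussMoment_two] at h1
    norm_num at h1
    have h2 := (hA _ (blockMid_mem_unit hN hj hjM) lam h0 hpi).1
    have h3 : ‖transferFunction ψ (blockMid (N * M) N j) lam‖ ^ 4
        ≤ C ^ 2 * lam ^ (-(4 * D)) := by
      rw [← hpow lam h0, ← mul_pow]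
      calc _ = (‖transferFunction ψ (blockMid (N * M) N j) lam‖ ^ 2) ^ 2 := by ring
        _ ≤ _ := pow_le_pow_left₀ (sq_nonneg _) h2 2
    simp only [hJ'def, norm_mul, mul_pow]
    rw [integral_const_mul]
    have h4 : 0 ≤ ∫ ω, ‖U N j lam ω‖ ^ 4 ∂P := integral_nonneg fun ω => by positivity
    calc _ ≤ (C ^ 2 * lam ^ (-(4 * D))) * (12 * (N : ℝ) ^ 2) :=
          mul_le_mul h3 h1 h4 (by positivity)
      _ = _ := by ring
  have herr : ∀ N M j : ℕ, 0 < N → Even N → 1 ≤ j → j ≤ M → ∀ lam,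
      bartlettError P X Z ψ N M j lam
        ≤ 1 / (N : ℝ) ^ 2 * ∫ ω, (‖J N M j lam ω‖ ^ 2 - ‖J' N M j lam ω‖ ^ 2) ^ 2 ∂P := by
    intro N M j hN hNe hj hjM lam
    have hN' : (0 : ℝ) < N := by exact_mod_cast hN
    have hpt : ∀ ω, (localPeriodogram (fun t => X t (N * M) ω) (N * M) N (blockMid (N * M) N j) lam
        - spectralDensity ψ (blockMid (N * M) N j) lam * noisePeriodogram Z N j lam ω) ^ 2
        = (1 / (2 * Real.pi * N)) ^ 2 * (‖J N M j lam ω‖ ^ 2 - ‖J' N M j lam ω‖ ^ 2) ^ 2 := by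
      intro ω
      rw [localPeriodogram_blockMid _ hN hNe hj hjM, noisePeriodogram, spectralDensity, ← mul_pow]
      simp only [hJ'def, hJdef, hU, norm_mul]
      congr 1
      field_simp
    unfold bartlettError
    simp_rw [hpt]
    rw [integral_const_mul]
    have h1 : (1 / (2 * Real.pi * N)) ^ 2 ≤ 1 / (N : ℝ) ^ 2 := by
      rw [div_pow, one_pow]
      apply one_div_le_one_div_of_le (by positivity)
      gcongr
      nlinarith
    exact mul_le_mul_of_nonneg_right h1 (integral_nonneg fun ω => by positivity)
  refine ⟨D, C + 2 * C + 24 * C ^ 2, hD0, hD1, by positivity, fun u hu lam h0 hpi => ?_,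
    fun N M j hN hNe hj hjM lam h0 hpi hNl => ?_, ?_⟩
  · obtain ⟨h1, h2⟩ := hA u hu lam h0 hpi
    refine ⟨?_, h2⟩
    have h3 : 1 / (2 * Real.pi) ≤ 1 := by rw [div_le_one (by positivity)]; linarith
    have h4 : 0 < lam ^ (-(2 * D)) := Real.rpow_pos_of_pos h0 _
    unfold spectralDensity
    calc _ ≤ 1 * (C * lam ^ (-(2 * D))) := by gcongr
      _ ≤ _ := by rw [one_mul]; gcongr; nlinarith [sq_nonneg C]
  · have hN' : (0 : ℝ) < N := by exact_mod_cast hN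
    obtain ⟨h4, hbd⟩ := hJ N M j hN hj hjM lam h0 hpi hNl
    refine ⟨?_, ?_⟩
    · simp_rw [localPeriodogram_blockMid _ hN hNe hj hjM]
      exact (memLp_norm_sq h4).const_mul _
    · refine (herr N M j hN hNe hj hjM lam).trans ?_
      have h5 := integral_sq_norm_sq_sub_le h4 (hJ'4 N M j lam)
      have h6 := hJ'bd N M j hN hj hjM lam h0 hpi
      rw [mul_pow, hpow lam h0] at hbd
      have h7 : 0 < lam ^ (-(4 * D)) := Real.rpow_pos_of_pos h0 _
      rw [one_div, inv_mul_le_iff₀ (by positivity)]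
      refine h5.trans ((add_le_add (mul_le_mul_of_nonneg_left hbd zero_le_two)
        (mul_le_mul_of_nonneg_left h6 zero_le_two)).trans ?_)
      have h8 : 0 ≤ C * (N : ℝ) ^ 2 * lam ^ (-(4 * D)) := by positivity
      nlinarith
  · intro N M j lam lam0 hN hNe hj hlam hNt hMt h0 hlt
    have hbd : ∀ L : ℕ, ∃ K : ℝ, ∀ᶠ n in atTop, ∀ w : ℝ,
        w = (K / M n + C * ((L : ℝ) + 1) ^ (D - 1) / lam n) ^ 2
            + C * (L + 1) / (N n * lam n ^ 2) →
        bartlettError P X Z ψ (N n) (M n) (j n) (lam n)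
          ≤ 24 * w ^ 2 + 48 * w + 48 * C ^ 2 * w * lam n ^ (-(4 * D)) := by
      intro L
      obtain ⟨K, hK⟩ := hE L
      refine ⟨K, ?_⟩
      filter_upwards [hj, hlam] with n hjn hln w hw
      have hN' : (0 : ℝ) < N n := by exact_mod_cast hN n
      have hw0 : 0 < w := by
        have h1 : 0 < C * (L + 1) / (N n * lam n ^ 2) := by
          have := hln.1
          positivity
        rw [hw]; positivity
      obtain ⟨h4, h5⟩ := hK (N n) (M n) (j n) (hN n) hjn.1 hjn.2 (lam n) hln.1 hln.2
      rw [← hw] at h5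
      -- The choice v = w balances the terms: the error moment is at most 12(Nw)², so 4/w times it
      -- is of order w, as is the other term.
      have h6 := integral_sq_norm_sq_sub_le_of_error (J := J (N n) (M n) (j n) (lam n))
        (J' := J' (N n) (M n) (j n) (lam n)) h4 (hJ'4 _ _ _ _) hw0
      have h7 := hJ'bd _ _ _ (hN n) hjn.1 hjn.2 (lam n) hln.1 hln.2
      refine (herr _ _ _ (hN n) (hNe n) hjn.1 hjn.2 _).trans ?_
      rw [one_div, inv_mul_le_iff₀ (by positivity)]
      refine h6.trans ((add_le_add (mul_le_mul_of_nonneg_left h5 (by positivity))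
        (mul_le_mul_of_nonneg_left h7 (by positivity))).trans_eq ?_)
      field_simp
      ring
    have hWlim : Tendsto (fun L : ℕ => (C * ((L : ℝ) + 1) ^ (D - 1) / lam0) ^ 2) atTop (𝓝 0) := by
      have h1 : Tendsto (fun m : ℕ => ((m : ℝ) + 1) ^ (-(1 - D))) atTop (𝓝 0) :=
        (tendsto_rpow_neg_atTop (by linarith)).comp
          (tendsto_atTop_add_const_right _ _ tendsto_natCast_atTop_atTop)
      have h2 := ((h1.const_mul C).div_const lam0).pow 2
      simp only [neg_sub] at h2
      simpa using h2
    have hHlim : Tendsto (fun L : ℕ =>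
        24 * ((C * ((L : ℝ) + 1) ^ (D - 1) / lam0) ^ 2) ^ 2
          + 48 * (C * ((L : ℝ) + 1) ^ (D - 1) / lam0) ^ 2
          + 48 * C ^ 2 * (C * ((L : ℝ) + 1) ^ (D - 1) / lam0) ^ 2 * lam0 ^ (-(4 * D)))
        atTop (𝓝 0) := by
      have := (((hWlim.pow 2).const_mul 24).add (hWlim.const_mul 48)).add
        ((hWlim.const_mul (48 * C ^ 2)).mul_const (lam0 ^ (-(4 * D))))
      simpa using this
    rw [Metric.tendsto_atTop]
    intro ε hε
    -- The cutoff L is fixed first, making the tail contribution small; `K` depends on L, and its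
    -- term disappears as M → ∞.
    obtain ⟨L, hL⟩ := (hHlim.eventually (gt_mem_nhds hε)).exists
    obtain ⟨K, hK⟩ := hbd L
    have hwn : Tendsto (fun n => (K / M n + C * ((L : ℝ) + 1) ^ (D - 1) / lam n) ^ 2
        + C * (L + 1) / (N n * lam n ^ 2)) atTop
        (𝓝 ((C * ((L : ℝ) + 1) ^ (D - 1) / lam0) ^ 2)) := by
      have h1 : Tendsto (fun n => K / (M n : ℝ)) atTop (𝓝 0) :=
        (tendsto_natCast_atTop_atTop.comp hMt).const_div_atTop K
      have h2 : Tendsto (fun n => C * ((L : ℝ) + 1) ^ (D - 1) / lam n) atTop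
          (𝓝 (C * ((L : ℝ) + 1) ^ (D - 1) / lam0)) := tendsto_const_nhds.div hlt h0.ne'
      have h3 : Tendsto (fun n => C * ((L : ℝ) + 1) / (N n * lam n ^ 2)) atTop (𝓝 0) :=
        ((tendsto_natCast_atTop_atTop.comp hNt).atTop_mul_pos (by positivity)
          (hlt.pow 2)).const_div_atTop _
      have := ((h1.add h2).pow 2).add h3
      simpa using this
    have hfin := (((hwn.pow 2).const_mul 24).add (hwn.const_mul 48)).add
        ((hwn.const_mul (48 * C ^ 2)).mul (hlt.rpow_const (p := -(4 * D)) (Or.inl h0.ne')))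
    obtain ⟨n0, hn0⟩ := eventually_atTop.1 ((hfin.eventually (gt_mem_nhds hL)).and hK)
    refine ⟨n0, fun n hn => ?_⟩
    obtain ⟨h1, h2⟩ := hn0 n hn
    have h3 : 0 ≤ bartlettError P X Z ψ (N n) (M n) (j n) (lam n) :=
      integral_nonneg fun ω => by positivity
    rw [Real.dist_eq, sub_zero, abs_of_nonneg h3]
    exact (h2 _ rfl).trans_lt h1

end Model

end LongMemory

/-! ### Double Riemann sums and concentration of block averages. -/

namespace LongMemory

section Riemann

variable {N M : ℕ → ℕ}

theorem ceil_mul_mem_Icc {N m : ℕ} {c x : ℝ} (hN : 0 < N) (hm : (m : ℝ) / N = c)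
    (hx : x ∈ Ioo 0 c) : ⌈x * N⌉₊ ∈ Finset.Icc 1 m := by
  have hN' : (0 : ℝ) < N := by exact_mod_cast hN
  rw [Finset.mem_Icc]
  refine ⟨Nat.ceil_pos.2 (mul_pos hx.1 hN'), Nat.ceil_le.2 ?_⟩
  rw [← le_div_iff₀ hN', hm]; exact hx.2.le

theorem half_div_eq {N : ℕ} (hN : 0 < N) (hNe : Even N) : ((N / 2 : ℕ) : ℝ) / N = 1 / 2 := by
  obtain ⟨h, rfl⟩ := hNe
  have h1 : (h + h) / 2 = h := by omega
  have h2 : (h : ℝ) ≠ 0 := by exact_mod_cast (by omega : h ≠ 0)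
  rw [h1]; push_cast; field_simp; norm_num

theorem tendsto_block_average (hMpos : ∀ n, 0 < M n) {C : ℝ} (hC : 0 ≤ C)
    {g : ℕ → ℕ → ℝ} {G : ℝ → ℝ}
    (hb : ∀ n, ∀ j ∈ Finset.Icc 1 (M n), |g n j| ≤ C)
    (hg : ∀ u ∈ Ioo (0 : ℝ) 1, Tendsto (fun n => g n ⌈u * M n⌉₊) atTop (𝓝 (G u))) :
    Tendsto (fun n => 1 / (M n : ℝ) * ∑ j ∈ Finset.Icc 1 (M n), g n j) atTop
      (𝓝 (∫ u in (0 : ℝ)..1, G u)) :=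
  tendsto_riemann_sum hMpos (fun n => div_self (by exact_mod_cast (hMpos n).ne'))
    zero_lt_one le_rfl hC (by simpa using hb) hg

theorem abs_block_average_le {M : ℕ} (hM : 0 < M) {C : ℝ} {g : ℕ → ℝ}
    (h : ∀ j ∈ Finset.Icc 1 M, |g j| ≤ C) : |1 / (M : ℝ) * ∑ j ∈ Finset.Icc 1 M, g j| ≤ C := by
  have hM' : (0 : ℝ) < M := by exact_mod_cast hM
  rw [abs_mul, abs_of_pos (by positivity), one_div, inv_mul_le_iff₀ hM']
  refine (Finset.abs_sum_le_sum_abs _ _).trans ((Finset.sum_le_sum h).trans_eq ?_)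
  simp

/-- Double Riemann sums over blocks and frequencies. -/
theorem tendsto_double_riemann_sum (hNpos : ∀ n, 0 < N n) (hMpos : ∀ n, 0 < M n)
    (hNe : ∀ n, Even (N n)) {C β : ℝ} (hC : 0 ≤ C) (hβ0 : 0 ≤ β) (hβ : β < 1)
    {h : ℕ → ℕ → ℕ → ℝ} {H : ℝ → ℝ → ℝ}
    (hb : ∀ n, ∀ j ∈ Finset.Icc 1 (M n), ∀ k ∈ Finset.Icc 1 (N n / 2),
      |h n j k| ≤ C * ((k : ℝ) / N n) ^ (-β))
    (hH : ∀ u ∈ Ioo (0 : ℝ) 1, ∀ x ∈ Ioo (0 : ℝ) (1 / 2),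
      Tendsto (fun n => h n ⌈u * M n⌉₊ ⌈x * N n⌉₊) atTop (𝓝 (H u x))) :
    Tendsto (fun n => 1 / (N n : ℝ) * ∑ k ∈ Finset.Icc 1 (N n / 2),
      (1 / (M n : ℝ) * ∑ j ∈ Finset.Icc 1 (M n), h n j k)) atTop
      (𝓝 (∫ x in (0 : ℝ)..(1 / 2), ∫ u in (0 : ℝ)..1, H u x)) := by
  refine tendsto_riemann_sum hNpos (fun n => half_div_eq (hNpos n) (hNe n)) hβ hβ0 hC
    (fun n k hk => abs_block_average_le (hMpos n) fun j hj => hb n j hj k hk) fun x hx => ?_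
  refine tendsto_block_average hMpos (C := C * x ^ (-β)) (by have := hx.1; positivity)
    (fun n j hj => ?_) (fun u hu => hH u hu x hx)
  refine (hb n j hj _ (ceil_mul_mem_Icc (hNpos n) (half_div_eq (hNpos n) (hNe n)) hx)).trans ?_
  have hN' : (0 : ℝ) < N n := by exact_mod_cast hNpos n
  refine mul_le_mul_of_nonneg_left (Real.rpow_le_rpow_of_nonpos hx.1 ?_ (by linarith)) hC
  rw [le_div_iff₀ hN']; exact Nat.le_ceil _

theorem sum_Icc_div_rpow_neg_le {N m : ℕ} (hN : 0 < N) (hm : m ≤ N) {β : ℝ} (hβ0 : 0 ≤ β)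
    (hβ : β < 1) :
    ∑ k ∈ Finset.Icc 1 m, ((k : ℝ) / N) ^ (-β) ≤ N * (1 / (1 - β)) := by
  have hN' : (0 : ℝ) < N := by exact_mod_cast hN
  have h1 : ∑ k ∈ Finset.Icc 1 m, ((k : ℝ) / N) ^ (-β)
      = (N : ℝ) ^ β * ∑ l ∈ Finset.range m, ((l : ℝ) + 1) ^ ((1 - β) - 1) := by
    clear hm
    induction m with
    | zero => simp
    | succ m ih =>
      rw [Finset.sum_Icc_succ_top (by omega), ih, Finset.sum_range_succ, mul_add]
      congr 1
      push_cast
      rw [Real.div_rpow (by positivity) hN'.le, Real.rpow_neg hN'.le β, div_inv_eq_mul, mul_comm]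
      congr 2; ring
  rw [h1]
  have h2 := sum_range_rpow_le (D := 1 - β) (by linarith) (by linarith) m
  have h3 : (m : ℝ) ^ (1 - β) ≤ (N : ℝ) ^ (1 - β) :=
    Real.rpow_le_rpow (by positivity) (by exact_mod_cast hm) (by linarith)
  have h4 : (N : ℝ) ^ β * (N : ℝ) ^ (1 - β) = N := by
    rw [← Real.rpow_add hN']; simp
  have h5 : 0 < 1 / (1 - β) := by
    have : 0 < 1 - β := by linarith
    positivity
  calc _ ≤ (N : ℝ) ^ β * (1 / (1 - β) * (N : ℝ) ^ (1 - β)) := by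
        refine mul_le_mul_of_nonneg_left (h2.trans ?_) (by positivity)
        exact mul_le_mul_of_nonneg_left h3 h5.le
    _ = (N : ℝ) ^ β * (N : ℝ) ^ (1 - β) * (1 / (1 - β)) := by ring
    _ = _ := by rw [h4]

end Riemann

section Noise

variable {Ω : Type*} [MeasurableSpace Ω] {P : Measure Ω} {Z : ℤ → Ω → ℝ}

/-- Blocks with different indices involve disjoint sets of innovation times. -/
theorem indepFun_blocks (hZ : iIndepFun Z P) (hg : ∀ i, HasLaw (Z i) (gaussianReal 0 1) P)
    {N j j' : ℕ} (hj : 1 ≤ j) (hj' : 1 ≤ j') (hne : j ≠ j') {Ψ Ψ' : (Fin N → ℝ) → ℝ}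
    (hΨ : Measurable Ψ) (hΨ' : Measurable Ψ') :
    IndepFun (fun ω => Ψ fun s => Z ((blockStart N j + s : ℕ) : ℤ) ω)
      (fun ω => Ψ' fun s => Z ((blockStart N j' + s : ℕ) : ℤ) ω) P := by
  classical
  set S : ℕ → Finset ℤ := fun j => Finset.univ.image fun s : Fin N =>
    ((blockStart N j + s : ℕ) : ℤ) with hS
  have hmem : ∀ j (s : Fin N), ((blockStart N j + s : ℕ) : ℤ) ∈ S j := fun j s =>
    Finset.mem_image_of_mem _ (Finset.mem_univ s)
  have hdisj : Disjoint (S j) (S j') := by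
    rw [Finset.disjoint_left]
    intro t h1 h2
    obtain ⟨s, -, hs⟩ := Finset.mem_image.1 h1
    obtain ⟨s', -, hs'⟩ := Finset.mem_image.1 h2
    have h3 : blockStart N j + s = blockStart N j' + s' := by exact_mod_cast hs.trans hs'.symm
    unfold blockStart at h3
    have h4 := s.2
    have h5 := s'.2
    rcases lt_or_gt_of_ne hne with h | h
    · have : N * (j - 1) + N ≤ N * (j' - 1) := by
        rw [← Nat.mul_succ]; exact Nat.mul_le_mul_left _ (by omega)
      omega
    · have : N * (j' - 1) + N ≤ N * (j - 1) := by
        rw [← Nat.mul_succ]; exact Nat.mul_le_mul_left _ (by omega)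
      omega
  have h := hZ.indepFun_finset₀ (S j) (S j') hdisj fun i => (hg i).aemeasurable
  exact h.comp (φ := fun v => Ψ fun s => v ⟨_, hmem j s⟩) (ψ := fun v => Ψ' fun s => v ⟨_, hmem j' s⟩)
    (hΨ.comp (measurable_pi_lambda _ fun s => measurable_pi_apply _))
    (hΨ'.comp (measurable_pi_lambda _ fun s => measurable_pi_apply _))

/-- The periodogram of a vector of length `N`. -/
noncomputable def vecPeriodogram (N : ℕ) (lam : ℝ) (v : Fin N → ℝ) : ℝ :=
  1 / (N : ℝ) * ‖∑ s : Fin N, (v s : ℂ) * phase lam s‖ ^ 2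

theorem measurable_vecPeriodogram (N : ℕ) (lam : ℝ) : Measurable (vecPeriodogram N lam) := by
  unfold vecPeriodogram; fun_prop

theorem noisePeriodogram_eq {Ω : Type*} (Z : ℤ → Ω → ℝ) (N j : ℕ) (lam : ℝ) (ω : Ω) :
    noisePeriodogram Z N j lam ω
      = vecPeriodogram N lam fun s => Z ((blockStart N j + s : ℕ) : ℤ) ω := by
  unfold noisePeriodogram vecPeriodogram blockDFT
  rw [Finset.sum_range]

theorem integrable_noisePeriodogram_pow (hg : ∀ i, HasLaw (Z i) (gaussianReal 0 1) P)
    (N j : ℕ) (lam : ℝ) {q : ℕ} (hq : q ≠ 0) :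
    Integrable (fun ω => noisePeriodogram Z N j lam ω ^ q) P := by
  have h := (memLp_blockDFT_noise hg N (blockStart N j) lam (p := ((2 * q : ℕ) : ENNReal))
    (ENNReal.natCast_ne_top _)).integrable_norm_pow (by omega)
  refine (h.const_mul ((1 / (N : ℝ)) ^ q)).congr (Eventually.of_forall fun ω => ?_)
  simp only [noisePeriodogram]
  rw [mul_pow, ← pow_mul]

theorem memLp_noisePeriodogram_pow (hg : ∀ i, HasLaw (Z i) (gaussianReal 0 1) P)
    (N j : ℕ) (lam : ℝ) {q : ℕ} (hq : q ≠ 0) :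
    MemLp (fun ω => noisePeriodogram Z N j lam ω ^ q) 2 P := by
  rw [memLp_two_iff_integrable_sq (integrable_noisePeriodogram_pow hg N j lam hq).1]
  simp_rw [← pow_mul]
  exact integrable_noisePeriodogram_pow hg N j lam (by omega)

theorem memLp_noisePeriodogram (hg : ∀ i, HasLaw (Z i) (gaussianReal 0 1) P)
    (N j : ℕ) (lam : ℝ) : MemLp (noisePeriodogram Z N j lam) 2 P := by
  simpa using memLp_noisePeriodogram_pow hg N j lam one_ne_zero

variable [IsProbabilityMeasure P]

theorem integral_noisePeriodogram_pow_le (hZ : iIndepFun Z P)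
    (hg : ∀ i, HasLaw (Z i) (gaussianReal 0 1) P) {N : ℕ} (hN : 0 < N) (j : ℕ) (lam : ℝ) {q : ℕ}
    (hq : q ≠ 0) :
    ∫ ω, noisePeriodogram Z N j lam ω ^ q ∂P ≤ 2 ^ q * gaussMoment q := by
  have hN' : (0 : ℝ) < N := by exact_mod_cast hN
  simp_rw [noisePeriodogram, mul_pow, ← pow_mul]
  rw [integral_const_mul, one_div, inv_pow, inv_mul_le_iff₀ (by positivity)]
  exact (integral_norm_pow_noise_le hZ hg N (blockStart N j) lam hq).trans_eq (mul_comm _ _)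

theorem integral_noisePeriodogram_sq_le (hZ : iIndepFun Z P)
    (hg : ∀ i, HasLaw (Z i) (gaussianReal 0 1) P) {N : ℕ} (hN : 0 < N) (j : ℕ) (lam : ℝ) :
    ∫ ω, noisePeriodogram Z N j lam ω ^ 2 ∂P ≤ 12 := by
  have := integral_noisePeriodogram_pow_le hZ hg hN j lam two_ne_zero
  rw [gaussMoment_two] at this
  linarith

theorem integral_noisePeriodogram (hZ : iIndepFun Z P)
    (hg : ∀ i, HasLaw (Z i) (gaussianReal 0 1) P) {N : ℕ} (hN : 0 < N) (j : ℕ) (lam : ℝ) :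
    ∫ ω, noisePeriodogram Z N j lam ω ∂P = 1 := by
  have hN' : (0 : ℝ) < N := by exact_mod_cast hN
  simp_rw [noisePeriodogram]
  rw [integral_const_mul, integral_norm_sq_noise hZ hg]
  field_simp

theorem integral_noisePeriodogram_sq (hZ : iIndepFun Z P)
    (hg : ∀ i, HasLaw (Z i) (gaussianReal 0 1) P) {N k : ℕ} (j : ℕ) (hk : 1 ≤ k)
    (hkN : 2 * k < N) :
    ∫ ω, noisePeriodogram Z N j (fourierFreq N k) ω ^ 2 ∂P = 2 := by
  have hN' : (0 : ℝ) < N := by exact_mod_cast (by omega : 0 < N)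
  simp_rw [noisePeriodogram, mul_pow, ← pow_mul]
  rw [integral_const_mul, integral_norm_pow_four_noise hZ hg _ hk hkN]
  field_simp

/-- Weighted averages of the squared innovation periodogram concentrate around their mean. -/
theorem variance_average_noise_sq_le (hZ : iIndepFun Z P)
    (hg : ∀ i, HasLaw (Z i) (gaussianReal 0 1) P) {N M m : ℕ} (hN : 0 < N) (hM : 0 < M)
    (lam : ℕ → ℝ) {w : ℕ → ℕ → ℝ} {B : ℝ}
    (hw : ∀ j ∈ Finset.Icc 1 M, ∑ k ∈ Finset.Icc 1 m, w j k ^ 2 ≤ N * B) :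
    MemLp (fun ω => 1 / (N : ℝ) * ∑ k ∈ Finset.Icc 1 m, (1 / (M : ℝ) * ∑ j ∈ Finset.Icc 1 M,
      (w j k * noisePeriodogram Z N j (lam k) ω) ^ 2)) 2 P ∧
    Var[fun ω => 1 / (N : ℝ) * ∑ k ∈ Finset.Icc 1 m, (1 / (M : ℝ) * ∑ j ∈ Finset.Icc 1 M,
      (w j k * noisePeriodogram Z N j (lam k) ω) ^ 2); P]
      ≤ 16 * gaussMoment 4 * B ^ 2 / M := by
  have hN' : (0 : ℝ) < N := by exact_mod_cast hN
  have hM' : (0 : ℝ) < M := by exact_mod_cast hM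
  set V : ℕ → Ω → ℝ := fun j ω => ∑ k ∈ Finset.Icc 1 m,
    w j k ^ 2 * noisePeriodogram Z N j (lam k) ω ^ 2 with hV
  have hVmem : ∀ j, MemLp (V j) 2 P := fun j => memLp_finsetSum _ fun k _ =>
    (memLp_noisePeriodogram_pow hg N j (lam k) two_ne_zero).const_mul _
  have heq : (fun ω => 1 / (N : ℝ) * ∑ k ∈ Finset.Icc 1 m, (1 / (M : ℝ) * ∑ j ∈ Finset.Icc 1 M,
      (w j k * noisePeriodogram Z N j (lam k) ω) ^ 2))
      = fun ω => 1 / ((N : ℝ) * M) * (∑ j ∈ Finset.Icc 1 M, V j) ω := by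
    ext ω
    rw [Finset.sum_apply]
    simp only [hV, mul_pow]
    rw [← Finset.mul_sum, Finset.sum_comm, ← mul_assoc]
    congr 1
    field_simp
  rw [heq]
  refine ⟨(memLp_finsetSum' _ fun j _ => hVmem j).const_mul _, ?_⟩
  have hind : (↑(Finset.Icc 1 M) : Set ℕ).Pairwise fun i j => IndepFun (V i) (V j) P := by
    intro i hi j hj hij
    have hi' := (Finset.mem_Icc.1 (Finset.mem_coe.1 hi)).1
    have hj' := (Finset.mem_Icc.1 (Finset.mem_coe.1 hj)).1
    have hform : ∀ i, V i = fun ω => (fun v : Fin N → ℝ => ∑ k ∈ Finset.Icc 1 m,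
        w i k ^ 2 * vecPeriodogram N (lam k) v ^ 2)
        fun s => Z ((blockStart N i + s : ℕ) : ℤ) ω := by
      intro i; ext ω; simp only [hV, noisePeriodogram_eq]
    rw [hform i, hform j]
    exact indepFun_blocks hZ hg hi' hj' hij
      (Finset.measurable_fun_sum _ fun k _ => ((measurable_vecPeriodogram N _).pow_const 2).const_mul _)
      (Finset.measurable_fun_sum _ fun k _ => ((measurable_vecPeriodogram N _).pow_const 2).const_mul _)
  have hVar : ∀ j ∈ Finset.Icc 1 M, Var[V j; P] ≤ 16 * gaussMoment 4 * (N * B) ^ 2 := by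
    intro j hj
    have hS0 : 0 ≤ ∑ k ∈ Finset.Icc 1 m, w j k ^ 2 := Finset.sum_nonneg fun _ _ => sq_nonneg _
    have hI : ∀ k, Integrable (fun ω => noisePeriodogram Z N j (lam k) ω ^ 4) P := fun k =>
      integrable_noisePeriodogram_pow hg N j (lam k) (by norm_num)
    -- Cauchy–Schwarz with weights w² needs only fourth moments at single frequencies, so dependence
    -- between frequencies within a block is harmless.
    calc Var[V j; P] ≤ ∫ ω, V j ω ^ 2 ∂P := variance_le_expectation_sq (hVmem j).1
      _ ≤ ∫ ω, (∑ k ∈ Finset.Icc 1 m, w j k ^ 2) * ∑ k ∈ Finset.Icc 1 m,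
            w j k ^ 2 * noisePeriodogram Z N j (lam k) ω ^ 4 ∂P := by
          refine integral_mono_of_nonneg (Eventually.of_forall fun ω => sq_nonneg _)
            ((integrable_finsetSum _ fun k _ => (hI k).const_mul _).const_mul _)
            (Eventually.of_forall fun ω => ?_)
          simp only [hV]
          refine Finset.sum_sq_le_sum_mul_sum_of_sq_le_mul _ (fun k _ => sq_nonneg _)
            (fun k _ => by positivity) fun k _ => le_of_eq (by ring)
      _ = (∑ k ∈ Finset.Icc 1 m, w j k ^ 2) * ∑ k ∈ Finset.Icc 1 m,
            w j k ^ 2 * ∫ ω, noisePeriodogram Z N j (lam k) ω ^ 4 ∂P := by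
          rw [integral_const_mul, integral_finsetSum _ fun k _ => (hI k).const_mul _]
          simp_rw [integral_const_mul]
      _ ≤ (∑ k ∈ Finset.Icc 1 m, w j k ^ 2) * ∑ k ∈ Finset.Icc 1 m,
            w j k ^ 2 * (16 * gaussMoment 4) := by
          gcongr with k hk
          have := integral_noisePeriodogram_pow_le hZ hg hN j (lam k) (q := 4) (by norm_num)
          linarith
      _ = 16 * gaussMoment 4 * (∑ k ∈ Finset.Icc 1 m, w j k ^ 2) ^ 2 := by
          rw [← Finset.sum_mul]; ring
      _ ≤ _ := by
          have := gaussMoment_nonneg 4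
          gcongr
          exact hw j hj
  -- The M independent blocks contribute M (NB)² against the normalisation (NM)², which leaves B²/M.
  rw [variance_const_mul, IndepFun.variance_sum (fun j _ => hVmem j) hind]
  calc _ ≤ (1 / ((N : ℝ) * M)) ^ 2 * ∑ j ∈ Finset.Icc 1 M, 16 * gaussMoment 4 * (N * B) ^ 2 :=
        mul_le_mul_of_nonneg_left (Finset.sum_le_sum hVar) (sq_nonneg _)
    _ = _ := by
        rw [Finset.sum_const, Nat.card_Icc, nsmul_eq_mul, Nat.add_sub_cancel]
        field_simp

/-- Weighted block averages of the innovation periodogram concentrate around their mean. -/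
theorem integral_average_noise_sub_sq_le (hZ : iIndepFun Z P)
    (hg : ∀ i, HasLaw (Z i) (gaussianReal 0 1) P) {N M : ℕ} (hN : 0 < N)
    (lam : ℝ) (w : ℕ → ℝ) :
    ∫ ω, (1 / (M : ℝ) * ∑ j ∈ Finset.Icc 1 M, (w j * noisePeriodogram Z N j lam ω - w j)) ^ 2 ∂P
      ≤ 12 / M * (1 / M * ∑ j ∈ Finset.Icc 1 M, w j ^ 2) := by
  set V : ℕ → Ω → ℝ := fun j ω => w j * noisePeriodogram Z N j lam ω with hV
  have hVmem : ∀ j, MemLp (V j) 2 P := fun j => (memLp_noisePeriodogram hg N j lam).const_mul _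
  have hint : ∀ j, Integrable (V j) P := fun j => (hVmem j).integrable (by norm_num)
  have hmean : ∀ j, ∫ ω, V j ω ∂P = w j := fun j => by
    simp only [hV]; rw [integral_const_mul, integral_noisePeriodogram hZ hg hN, mul_one]
  have hind : (↑(Finset.Icc 1 M) : Set ℕ).Pairwise fun i j => IndepFun (V i) (V j) P := by
    intro i hi j hj hij
    have hi' := (Finset.mem_Icc.1 (Finset.mem_coe.1 hi)).1
    have hj' := (Finset.mem_Icc.1 (Finset.mem_coe.1 hj)).1
    have hform : ∀ i, V i = fun ω => (fun v : Fin N → ℝ => w i * vecPeriodogram N lam v)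
        fun s => Z ((blockStart N i + s : ℕ) : ℤ) ω := by
      intro i; ext ω; simp only [hV, noisePeriodogram_eq]
    rw [hform i, hform j]
    exact indepFun_blocks hZ hg hi' hj' hij ((measurable_vecPeriodogram N _).const_mul _)
      ((measurable_vecPeriodogram N _).const_mul _)
  have hVar : ∀ j, Var[V j; P] ≤ 12 * w j ^ 2 := by
    intro j
    refine (variance_le_expectation_sq (hVmem j).1).trans ?_
    have : ∀ ω, (V j ^ 2) ω = w j ^ 2 * noisePeriodogram Z N j lam ω ^ 2 := fun ω => by
      simp only [hV, Pi.pow_apply]; ring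
    simp_rw [this]
    rw [integral_const_mul, mul_comm]
    exact mul_le_mul_of_nonneg_right (integral_noisePeriodogram_sq_le hZ hg hN j lam) (sq_nonneg _)
  have hsum : Var[∑ j ∈ Finset.Icc 1 M, V j; P] ≤ 12 * ∑ j ∈ Finset.Icc 1 M, w j ^ 2 := by
    rw [IndepFun.variance_sum (fun j _ => hVmem j) hind, Finset.mul_sum]
    exact Finset.sum_le_sum fun j _ => hVar j
  have hexp : ∫ ω, (∑ j ∈ Finset.Icc 1 M, V j) ω ∂P = ∑ j ∈ Finset.Icc 1 M, w j := by
    simp only [Finset.sum_apply]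
    rw [integral_finsetSum _ fun j _ => hint j]
    simp_rw [hmean]
  rw [variance_eq_integral (memLp_finsetSum' _ fun j _ => hVmem j).1.aemeasurable, hexp] at hsum
  simp only [Finset.sum_apply] at hsum
  simp_rw [mul_pow, Finset.sum_sub_distrib]
  rw [integral_const_mul]
  calc _ ≤ (1 / (M : ℝ)) ^ 2 * (12 * ∑ j ∈ Finset.Icc 1 M, w j ^ 2) :=
        mul_le_mul_of_nonneg_left hsum (sq_nonneg _)
    _ = _ := by ring

end Noise

end LongMemory

/-! ### Comparison in L¹ of averages of squares. -/

namespace LongMemory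

theorem tendstoInMeasure_of_tendsto_integral_abs {Ω : Type*} [MeasurableSpace Ω] {P : Measure Ω}
    {F : ℕ → Ω → ℝ} {c : ℝ} [IsFiniteMeasure P] (hF : ∀ n, Integrable (F n) P)
    (h : Tendsto (fun n => ∫ ω, |F n ω - c| ∂P) atTop (𝓝 0)) :
    TendstoInMeasure P F atTop (fun _ => c) := by
  refine tendstoInMeasure_of_tendsto_eLpNorm one_ne_zero (fun n => (hF n).1)
    aestronglyMeasurable_const ?_
  have h1 : ∀ n, eLpNorm (F n - fun _ => c) 1 P = ENNReal.ofReal (∫ ω, |F n ω - c| ∂P) := by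
    intro n
    rw [eLpNorm_one_eq_lintegral_enorm, ← ofReal_integral_norm_eq_lintegral_enorm
      ((hF n).sub (integrable_const c))]
    rfl
  simp_rw [h1]
  simpa using ENNReal.tendsto_ofReal h

/-- Both signs follow from (x - y ± ηy)²/η ≥ 0. The factor η in front of y² is later sent to zero
more slowly than the mean square error. -/
theorem abs_sq_sub_sq_le (x y : ℝ) {η : ℝ} (hη : 0 < η) :
    |x ^ 2 - y ^ 2| ≤ (1 + 1 / η) * (x - y) ^ 2 + η * y ^ 2 := by
  have h1 : 0 ≤ 1 / η * (x - y - η * y) ^ 2 := by positivity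
  have h2 : 0 ≤ 1 / η * (x - y + η * y) ^ 2 := by positivity
  have e1 : 1 / η * (x - y - η * y) ^ 2 = 1 / η * (x - y) ^ 2 - 2 * (x - y) * y + η * y ^ 2 := by
    field_simp; ring
  have e2 : 1 / η * (x - y + η * y) ^ 2 = 1 / η * (x - y) ^ 2 + 2 * (x - y) * y + η * y ^ 2 := by
    field_simp; ring
  rw [abs_le]
  constructor <;> nlinarith [sq_nonneg (x - y)]

/-- The average of an array over `M` blocks and `m` frequencies, normalised by `N M`. -/
noncomputable def gridAvg (N M m : ℕ) (h : ℕ → ℕ → ℝ) : ℝ :=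
  1 / (N : ℝ) * ∑ k ∈ Finset.Icc 1 m, (1 / (M : ℝ) * ∑ j ∈ Finset.Icc 1 M, h j k)

theorem gridAvg_mono {N M m : ℕ} {h h' : ℕ → ℕ → ℝ}
    (hle : ∀ j ∈ Finset.Icc 1 M, ∀ k ∈ Finset.Icc 1 m, h j k ≤ h' j k) :
    gridAvg N M m h ≤ gridAvg N M m h' := by
  unfold gridAvg
  gcongr with k hk j hj
  exact hle j hj k hk

theorem gridAvg_add (N M m : ℕ) (h h' : ℕ → ℕ → ℝ) :
    gridAvg N M m (fun j k => h j k + h' j k) = gridAvg N M m h + gridAvg N M m h' := by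
  simp only [gridAvg, Finset.sum_add_distrib, mul_add]

theorem gridAvg_sub (N M m : ℕ) (h h' : ℕ → ℕ → ℝ) :
    gridAvg N M m (fun j k => h j k - h' j k) = gridAvg N M m h - gridAvg N M m h' := by
  simp only [gridAvg, Finset.sum_sub_distrib, mul_sub]

theorem gridAvg_const_mul (N M m : ℕ) (c : ℝ) (h : ℕ → ℕ → ℝ) :
    gridAvg N M m (fun j k => c * h j k) = c * gridAvg N M m h := by
  simp only [gridAvg, Finset.mul_sum]
  refine Finset.sum_congr rfl fun k _ => Finset.sum_congr rfl fun j _ => ?_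
  ring

theorem abs_gridAvg_le (N M m : ℕ) (h : ℕ → ℕ → ℝ) :
    |gridAvg N M m h| ≤ gridAvg N M m fun j k => |h j k| := by
  unfold gridAvg
  rw [abs_mul, abs_of_nonneg (by positivity : (0 : ℝ) ≤ 1 / N)]
  gcongr
  refine (Finset.abs_sum_le_sum_abs _ _).trans (Finset.sum_le_sum fun k _ => ?_)
  rw [abs_mul, abs_of_nonneg (by positivity : (0 : ℝ) ≤ 1 / M)]
  gcongr
  exact Finset.abs_sum_le_sum_abs _ _

section Integral

variable {Ω : Type*} [MeasurableSpace Ω] {P : Measure Ω} {N M m : ℕ}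

theorem integrable_gridAvg {h : ℕ → ℕ → Ω → ℝ}
    (hint : ∀ j ∈ Finset.Icc 1 M, ∀ k ∈ Finset.Icc 1 m, Integrable (h j k) P) :
    Integrable (fun ω => gridAvg N M m fun j k => h j k ω) P := by
  unfold gridAvg
  exact (integrable_finsetSum _ fun k hk => (integrable_finsetSum _ fun j hj =>
    hint j hj k hk).const_mul _).const_mul _

theorem integral_gridAvg {h : ℕ → ℕ → Ω → ℝ}
    (hint : ∀ j ∈ Finset.Icc 1 M, ∀ k ∈ Finset.Icc 1 m, Integrable (h j k) P) :
    ∫ ω, gridAvg N M m (fun j k => h j k ω) ∂P = gridAvg N M m fun j k => ∫ ω, h j k ω ∂P := by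
  unfold gridAvg
  rw [integral_const_mul, integral_finsetSum _ fun k hk => (integrable_finsetSum _ fun j hj =>
    hint j hj k hk).const_mul _]
  congr 1
  refine Finset.sum_congr rfl fun k hk => ?_
  rw [integral_const_mul, integral_finsetSum _ fun j hj => hint j hj k hk]

theorem integral_abs_gridAvg_sq_sub_le {I g : ℕ → ℕ → Ω → ℝ}
    (hI : ∀ j ∈ Finset.Icc 1 M, ∀ k ∈ Finset.Icc 1 m, MemLp (I j k) 2 P)
    (hg : ∀ j ∈ Finset.Icc 1 M, ∀ k ∈ Finset.Icc 1 m, MemLp (g j k) 2 P) {η : ℝ} (hη : 0 < η) :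
    ∫ ω, |gridAvg N M m (fun j k => I j k ω ^ 2) - gridAvg N M m (fun j k => g j k ω ^ 2)| ∂P
      ≤ (1 + 1 / η) * gridAvg N M m (fun j k => ∫ ω, (I j k ω - g j k ω) ^ 2 ∂P)
        + η * gridAvg N M m (fun j k => ∫ ω, g j k ω ^ 2 ∂P) := by
  have i1 : ∀ j ∈ Finset.Icc 1 M, ∀ k ∈ Finset.Icc 1 m,
      Integrable (fun ω => (I j k ω - g j k ω) ^ 2) P := fun j hj k hk =>
    ((hI j hj k hk).sub (hg j hj k hk)).integrable_sq
  have i2 : ∀ j ∈ Finset.Icc 1 M, ∀ k ∈ Finset.Icc 1 m,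
      Integrable (fun ω => g j k ω ^ 2) P := fun j hj k hk => (hg j hj k hk).integrable_sq
  rw [← integral_gridAvg i1, ← integral_gridAvg i2, ← integral_const_mul, ← integral_const_mul,
    ← integral_add ((integrable_gridAvg i1).const_mul _) ((integrable_gridAvg i2).const_mul _)]
  refine integral_mono_of_nonneg (Eventually.of_forall fun ω => abs_nonneg _)
    (((integrable_gridAvg i1).const_mul _).add ((integrable_gridAvg i2).const_mul _))
    (Eventually.of_forall fun ω => ?_)
  simp only
  rw [← gridAvg_sub, ← gridAvg_const_mul, ← gridAvg_const_mul, ← gridAvg_add]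
  exact (abs_gridAvg_le _ _ _ _).trans
    (gridAvg_mono fun j _ k _ => abs_sq_sub_sq_le _ _ hη)

/-- The quadratic form in the block averages. -/
noncomputable def avgSq (N M m : ℕ) (h : ℕ → ℕ → ℝ) : ℝ :=
  1 / (N : ℝ) * ∑ k ∈ Finset.Icc 1 m, (1 / (M : ℝ) * ∑ j ∈ Finset.Icc 1 M, h j k) ^ 2

theorem sq_average_le (M : ℕ) (h : ℕ → ℝ) :
    (1 / (M : ℝ) * ∑ j ∈ Finset.Icc 1 M, h j) ^ 2
      ≤ 1 / (M : ℝ) * ∑ j ∈ Finset.Icc 1 M, h j ^ 2 := by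
  rcases Nat.eq_zero_or_pos M with rfl | hM
  · simp
  have hM' : (0 : ℝ) < M := by exact_mod_cast hM
  have h1 := sq_sum_le_card_mul_sum_sq (s := Finset.Icc 1 M) (f := h)
  rw [Nat.card_Icc, Nat.add_sub_cancel] at h1
  rw [mul_pow, one_div, inv_pow, inv_mul_le_iff₀ (by positivity)]
  refine h1.trans_eq ?_
  field_simp

theorem avgSq_le_gridAvg (N M m : ℕ) (h : ℕ → ℕ → ℝ) :
    avgSq N M m h ≤ gridAvg N M m fun j k => h j k ^ 2 := by
  unfold avgSq gridAvg
  gcongr with k hk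
  exact sq_average_le M _

/-- The array g stands between x and the deterministic w. The difference x - g is small entry by
entry, whereas g - w becomes small only after averaging over blocks, so its square is kept outside
the average. -/
theorem abs_avgSq_sub_le (N M m : ℕ) (x g w : ℕ → ℕ → ℝ) {η : ℝ} (hη : 0 < η) :
    |avgSq N M m x - avgSq N M m w|
      ≤ (1 + 1 / η) * (2 * gridAvg N M m (fun j k => (x j k - g j k) ^ 2)
          + 2 * avgSq N M m (fun j k => g j k - w j k)) + η * avgSq N M m w := by
  have h1 : |avgSq N M m x - avgSq N M m w|
      ≤ (1 + 1 / η) * avgSq N M m (fun j k => x j k - w j k) + η * avgSq N M m w := by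
    simp only [avgSq]
    rw [← mul_sub, ← Finset.sum_sub_distrib, abs_mul,
      abs_of_nonneg (by positivity : (0 : ℝ) ≤ 1 / N), mul_left_comm (1 + 1 / η),
      mul_left_comm η, ← mul_add, Finset.mul_sum, Finset.mul_sum, ← Finset.sum_add_distrib]
    gcongr
    refine (Finset.abs_sum_le_sum_abs _ _).trans (Finset.sum_le_sum fun k _ => ?_)
    refine (abs_sq_sub_sq_le _ _ hη).trans_eq ?_
    rw [Finset.sum_sub_distrib, mul_sub]
  have h2 : avgSq N M m (fun j k => x j k - w j k)
      ≤ 2 * avgSq N M m (fun j k => x j k - g j k) + 2 * avgSq N M m (fun j k => g j k - w j k) := by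
    simp only [avgSq]
    rw [mul_left_comm 2, mul_left_comm 2, ← mul_add, Finset.mul_sum _ _ (2 : ℝ),
      Finset.mul_sum _ _ (2 : ℝ),
      ← Finset.sum_add_distrib]
    gcongr with k hk
    have : ∑ j ∈ Finset.Icc 1 M, (x j k - w j k) = ∑ j ∈ Finset.Icc 1 M, (x j k - g j k)
        + ∑ j ∈ Finset.Icc 1 M, (g j k - w j k) := by
      rw [← Finset.sum_add_distrib]; exact Finset.sum_congr rfl fun j _ => by ring
    rw [this, mul_add]
    nlinarith [sq_nonneg (1 / (M : ℝ) * ∑ j ∈ Finset.Icc 1 M, (x j k - g j k)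
      - 1 / (M : ℝ) * ∑ j ∈ Finset.Icc 1 M, (g j k - w j k))]
  have h3 := avgSq_le_gridAvg N M m fun j k => x j k - g j k
  have h4 : 0 ≤ 1 + 1 / η := by positivity
  refine h1.trans (add_le_add_left (mul_le_mul_of_nonneg_left ?_ h4) _)
  linarith

theorem integrable_avgSq {h : ℕ → ℕ → Ω → ℝ}
    (hint : ∀ j ∈ Finset.Icc 1 M, ∀ k ∈ Finset.Icc 1 m, MemLp (h j k) 2 P) :
    Integrable (fun ω => avgSq N M m fun j k => h j k ω) P := by
  unfold avgSq
  exact (integrable_finsetSum _ fun k hk =>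
    ((memLp_finsetSum _ fun j hj => hint j hj k hk).const_mul _).integrable_sq).const_mul _

theorem integral_avgSq {h : ℕ → ℕ → Ω → ℝ}
    (hint : ∀ j ∈ Finset.Icc 1 M, ∀ k ∈ Finset.Icc 1 m, MemLp (h j k) 2 P) :
    ∫ ω, avgSq N M m (fun j k => h j k ω) ∂P = 1 / (N : ℝ) * ∑ k ∈ Finset.Icc 1 m,
      ∫ ω, (1 / (M : ℝ) * ∑ j ∈ Finset.Icc 1 M, h j k ω) ^ 2 ∂P := by
  unfold avgSq
  rw [integral_const_mul, integral_finsetSum _ fun k hk =>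
    ((memLp_finsetSum _ fun j hj => hint j hj k hk).const_mul _).integrable_sq]

theorem integral_abs_avgSq_sub_le [IsProbabilityMeasure P] {I g : ℕ → ℕ → Ω → ℝ} {w : ℕ → ℕ → ℝ}
    (hI : ∀ j ∈ Finset.Icc 1 M, ∀ k ∈ Finset.Icc 1 m, MemLp (I j k) 2 P)
    (hg : ∀ j ∈ Finset.Icc 1 M, ∀ k ∈ Finset.Icc 1 m, MemLp (g j k) 2 P) {η : ℝ} (hη : 0 < η) :
    ∫ ω, |avgSq N M m (fun j k => I j k ω) - avgSq N M m w| ∂P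
      ≤ (1 + 1 / η) * (2 * gridAvg N M m (fun j k => ∫ ω, (I j k ω - g j k ω) ^ 2 ∂P)
        + 2 * (1 / (N : ℝ) * ∑ k ∈ Finset.Icc 1 m,
          ∫ ω, (1 / (M : ℝ) * ∑ j ∈ Finset.Icc 1 M, (g j k ω - w j k)) ^ 2 ∂P))
        + η * avgSq N M m w := by
  have i1 : ∀ j ∈ Finset.Icc 1 M, ∀ k ∈ Finset.Icc 1 m,
      Integrable (fun ω => (I j k ω - g j k ω) ^ 2) P := fun j hj k hk =>
    ((hI j hj k hk).sub (hg j hj k hk)).integrable_sq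
  have i2 : ∀ j ∈ Finset.Icc 1 M, ∀ k ∈ Finset.Icc 1 m,
      MemLp (fun ω => g j k ω - w j k) 2 P := fun j hj k hk =>
    (hg j hj k hk).sub (memLp_const _)
  have hA := (integrable_gridAvg (N := N) i1).const_mul 2
  have hB := (integrable_avgSq (N := N) i2).const_mul 2
  have key : ∀ (A B : Ω → ℝ) (c : ℝ), Integrable A P → Integrable B P →
      ∫ ω, ((1 + 1 / η) * (A ω + B ω) + c) ∂P
        = (1 + 1 / η) * (∫ ω, A ω ∂P + ∫ ω, B ω ∂P) + c := by
    intro A B c hA hB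
    rw [integral_add (f := fun ω => (1 + 1 / η) * (A ω + B ω)) ((hA.add hB).const_mul _)
      (integrable_const c), integral_const_mul, integral_add hA hB]
    simp
  rw [← integral_gridAvg i1, ← integral_avgSq i2, ← integral_const_mul, ← integral_const_mul,
    ← key _ _ _ hA hB]
  exact integral_mono_of_nonneg (Eventually.of_forall fun ω => abs_nonneg _)
    (((hA.add hB).const_mul _).add (integrable_const _))
    (Eventually.of_forall fun ω => abs_avgSq_sub_le N M m _ _ _ hη)

/-- Integrates the elementary inequality x ≤ κ/2 + x²/(2κ). -/
theorem integral_abs_sub_integral_le [IsProbabilityMeasure P] {V : Ω → ℝ} (hV : MemLp V 2 P)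
    {κ : ℝ} (hκ : 0 < κ) (h : Var[V; P] ≤ κ ^ 2) : ∫ ω, |V ω - ∫ x, V x ∂P| ∂P ≤ κ := by
  rw [variance_eq_integral hV.1.aemeasurable] at h
  have i1 : Integrable (fun ω => (V ω - ∫ x, V x ∂P) ^ 2) P :=
    (hV.sub (memLp_const _)).integrable_sq
  calc ∫ ω, |V ω - ∫ x, V x ∂P| ∂P
      ≤ ∫ ω, (κ / 2 + 1 / (2 * κ) * (V ω - ∫ x, V x ∂P) ^ 2) ∂P := by
        refine integral_mono_of_nonneg (Eventually.of_forall fun ω => abs_nonneg _)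
          ((integrable_const _).add (i1.const_mul _)) (Eventually.of_forall fun ω => ?_)
        simp only
        rw [← sq_abs]
        set x := |V ω - ∫ x, V x ∂P|
        have : κ / 2 + 1 / (2 * κ) * x ^ 2 - x = 1 / (2 * κ) * (x - κ) ^ 2 := by
          field_simp; ring
        have h2 : 0 ≤ 1 / (2 * κ) * (x - κ) ^ 2 := by positivity
        linarith
    _ = κ / 2 + 1 / (2 * κ) * ∫ ω, (V ω - ∫ x, V x ∂P) ^ 2 ∂P := by
        rw [integral_add (integrable_const _) (i1.const_mul _), integral_const_mul]; simp
    _ ≤ κ / 2 + 1 / (2 * κ) * κ ^ 2 := by gcongr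
    _ = κ := by field_simp; ring

end Integral

end LongMemory

/-! ### Integrability of f² and the limiting functionals. -/

namespace LongMemory

theorem integral_symm_of_even {g : ℝ → ℝ} {b : ℝ} (hb : 0 ≤ b) (hg : IntervalIntegrable g volume 0 b)
    (he : ∀ x ∈ Ioc 0 b, g (-x) = g x) :
    ∫ x in (-b)..b, g x = 2 * ∫ x in (0 : ℝ)..b, g x := by
  have hcongr : EqOn (fun x => g (-x)) g (uIoc 0 b) := fun x hx => by
    rw [uIoc_of_le hb] at hx; exact he x hx
  have h1 : IntervalIntegrable (fun x => g (-x)) volume 0 b := hg.congr hcongr.symm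
  have h2 : IntervalIntegrable g volume (-b) 0 := by
    have := (h1.comp_mul_left (c := -1)).symm
    simpa [div_neg] using this
  rw [← intervalIntegral.integral_add_adjacent_intervals h2 hg]
  have h3 : ∫ x in (-b)..0, g x = ∫ x in (0 : ℝ)..b, g (-x) := by
    rw [intervalIntegral.integral_comp_neg]; simp
  rw [h3, intervalIntegral.integral_congr_ae (g := g) (Eventually.of_forall fun x hx => hcongr hx)]
  ring

/-- A symmetric density on the frequency axis with an integrable pole of order less than `1 / 2`. -/
structure IsPoleDensity (f : ℝ → ℝ → ℝ) (D C : ℝ) : Prop where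
  continuousOn : ContinuousOn (fun p : ℝ × ℝ => f p.1 p.2) (Icc 0 1 ×ˢ Ioc 0 Real.pi)
  nonneg : ∀ u lam, 0 ≤ f u lam
  le_rpow : ∀ u ∈ Icc (0 : ℝ) 1, ∀ lam ∈ Ioc 0 Real.pi, f u lam ≤ C * lam ^ (-(2 * D))
  even : ∀ u ∈ Icc (0 : ℝ) 1, ∀ lam ∈ Ioc 0 Real.pi, f u (-lam) = f u lam
  lt : D < 1 / 4

namespace IsPoleDensity

variable {f : ℝ → ℝ → ℝ} {D C : ℝ}

theorem integrable_rpow (h : IsPoleDensity f D C) :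
    Integrable (fun lam : ℝ => C ^ 2 * lam ^ (-(4 * D))) (volume.restrict (Ioc 0 Real.pi)) := by
  have h1 := h.lt
  have := (intervalIntegral.intervalIntegrable_rpow' (a := 0) (b := Real.pi)
    (r := -(4 * D)) (by linarith)).const_mul (C ^ 2)
  exact (intervalIntegrable_iff_integrableOn_Ioc_of_le Real.pi_pos.le).1 this

theorem sq_le (h : IsPoleDensity f D C) {u lam : ℝ} (hu : u ∈ Icc (0 : ℝ) 1)
    (hl : lam ∈ Ioc 0 Real.pi) : f u lam ^ 2 ≤ C ^ 2 * lam ^ (-(4 * D)) := by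
  have h1 := pow_le_pow_left₀ (h.nonneg u lam) (h.le_rpow u hu lam hl) 2
  refine h1.trans_eq ?_
  rw [mul_pow, ← Real.rpow_natCast (lam ^ (-(2 * D))), ← Real.rpow_mul hl.1.le]
  congr 2; push_cast; ring

theorem ae_prod_mem : ∀ᵐ p : ℝ × ℝ
      ∂((volume.restrict (Ioc (0 : ℝ) 1)).prod (volume.restrict (Ioc 0 Real.pi))), p ∈ Ioc (0 : ℝ) 1 ×ˢ Ioc 0 Real.pi := by
  rw [Measure.prod_restrict]
  exact ae_restrict_mem (measurableSet_Ioc.prod measurableSet_Ioc)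

theorem aestronglyMeasurable (h : IsPoleDensity f D C) :
    AEStronglyMeasurable (fun p : ℝ × ℝ => f p.1 p.2) ((volume.restrict (Ioc (0 : ℝ) 1)).prod (volume.restrict (Ioc 0 Real.pi))) := by
  rw [Measure.prod_restrict]
  exact (h.continuousOn.mono (prod_mono Ioc_subset_Icc_self le_rfl)).aestronglyMeasurable
    (measurableSet_Ioc.prod measurableSet_Ioc)

theorem memLp_two (h : IsPoleDensity f D C) :
    MemLp (fun p : ℝ × ℝ => f p.1 p.2) 2 ((volume.restrict (Ioc (0 : ℝ) 1)).prod (volume.restrict (Ioc 0 Real.pi))) := by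
  rw [memLp_two_iff_integrable_sq h.aestronglyMeasurable]
  refine (h.integrable_rpow.comp_snd (volume.restrict (Ioc (0 : ℝ) 1))).mono' (h.aestronglyMeasurable.pow 2) ?_
  filter_upwards [ae_prod_mem] with p hp
  rw [Real.norm_eq_abs, abs_of_nonneg (sq_nonneg _)]
  exact h.sq_le (Ioc_subset_Icc_self hp.1) hp.2

/-- Reflection in λ transports integrability to negative frequencies; the line λ = 0, where nothing
is assumed about f beyond nonnegativity, is a null set. -/
theorem integrableOn_sq (h : IsPoleDensity f D C) :
    IntegrableOn (fun p : ℝ × ℝ => f p.1 p.2 ^ 2)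
      (Icc (0 : ℝ) 1 ×ˢ Icc (-Real.pi) Real.pi) := by
  have h1 : IntegrableOn (fun p : ℝ × ℝ => f p.1 p.2 ^ 2) (Ioc (0 : ℝ) 1 ×ˢ Ioc 0 Real.pi) := by
    have := h.memLp_two.integrable_sq
    rwa [Measure.prod_restrict] at this
  have hmp : MeasurePreserving (Prod.map id Neg.neg : ℝ × ℝ → ℝ × ℝ) volume volume :=
    (MeasurePreserving.id volume).prod (Measure.measurePreserving_neg volume)
  have hemb : MeasurableEmbedding (Prod.map id Neg.neg : ℝ × ℝ → ℝ × ℝ) :=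
    MeasurableEmbedding.id.prodMap (MeasurableEquiv.neg ℝ).measurableEmbedding
  have h2 : IntegrableOn (fun p : ℝ × ℝ => f p.1 p.2 ^ 2)
      (Ioc (0 : ℝ) 1 ×ˢ Ico (-Real.pi) 0) := by
    have := (hmp.integrableOn_comp_preimage hemb).2 h1
    have hpre : (Prod.map id Neg.neg : ℝ × ℝ → ℝ × ℝ) ⁻¹' (Ioc (0 : ℝ) 1 ×ˢ Ioc 0 Real.pi)
        = Ioc (0 : ℝ) 1 ×ˢ Ico (-Real.pi) 0 := by
      ext ⟨u, l⟩
      simp only [mem_preimage, Prod.map_apply, id, mem_prod, mem_Ioc, mem_Ico]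
      constructor <;> rintro ⟨h1, h2, h3⟩ <;> exact ⟨h1, by linarith, by linarith⟩
    rw [hpre] at this
    refine this.congr_fun (fun p hp => ?_) (measurableSet_Ioc.prod measurableSet_Ico)
    have hl : -p.2 ∈ Ioc 0 Real.pi := ⟨by linarith [hp.2.2], by linarith [hp.2.1]⟩
    have := h.even p.1 (Ioc_subset_Icc_self hp.1) (-p.2) hl
    rw [neg_neg] at this
    simp [this]
  have h3 := h2.union h1
  rw [← prod_union] at h3
  refine h3.congr_set_ae (Measure.set_prod_ae_eq Ioc_ae_eq_Icc.symm ?_)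
  have h4 : (Ico (-Real.pi) 0 ∪ Ioc 0 Real.pi : Set ℝ) =ᵐ[volume] Icc (-Real.pi) Real.pi := by
    have hne : ∀ᵐ x : ℝ, x ≠ 0 := by simp [ae_iff]
    filter_upwards [hne] with x hx
    refine propext ?_
    change x ∈ Ico (-Real.pi) 0 ∪ Ioc 0 Real.pi ↔ x ∈ Icc (-Real.pi) Real.pi
    have hpi := Real.pi_pos
    simp only [mem_union, mem_Ico, mem_Ioc, mem_Icc]
    constructor
    · rintro (h | h) <;> constructor <;> linarith [h.1, h.2]
    · rintro ⟨h5, h6⟩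
      rcases lt_or_gt_of_ne hx with h | h
      · exact Or.inl ⟨h5, h⟩
      · exact Or.inr ⟨h, h6⟩
  exact h4.symm

theorem intervalIntegrable_slice (h : IsPoleDensity f D C) {u : ℝ} (hu : u ∈ Icc (0 : ℝ) 1) :
    IntervalIntegrable (fun lam => f u lam ^ 2) volume 0 Real.pi := by
  rw [intervalIntegrable_iff_integrableOn_Ioc_of_le Real.pi_pos.le]
  have hc : ContinuousOn (fun lam => f u lam) (Ioc 0 Real.pi) :=
    h.continuousOn.comp (f := fun lam => (u, lam)) (by fun_prop) fun lam hl => ⟨hu, hl⟩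
  refine h.integrable_rpow.mono' ((hc.pow 2).aestronglyMeasurable measurableSet_Ioc) ?_
  filter_upwards [ae_restrict_mem measurableSet_Ioc] with lam hl
  rw [Real.norm_eq_abs, abs_of_nonneg (sq_nonneg _)]
  exact h.sq_le hu hl

/-- The average over rescaled time, restricted to `(0, 1]`. -/
theorem average_eq (f : ℝ → ℝ → ℝ) (lam : ℝ) : ∫ u in (0 : ℝ)..1, f u lam = ∫ u, f u lam ∂(volume.restrict (Ioc (0 : ℝ) 1)) :=
  intervalIntegral.integral_of_le zero_le_one

theorem aestronglyMeasurable_average (h : IsPoleDensity f D C) :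
    AEStronglyMeasurable (fun lam => ∫ u in (0 : ℝ)..1, f u lam) (volume.restrict (Ioc 0 Real.pi)) := by
  simp_rw [average_eq]
  exact h.aestronglyMeasurable.prod_swap.integral_prod_right'

theorem average_sq_le (h : IsPoleDensity f D C) {lam : ℝ} (hl : lam ∈ Ioc 0 Real.pi) :
    (∫ u in (0 : ℝ)..1, f u lam) ^ 2 ≤ C ^ 2 * lam ^ (-(4 * D)) := by
  have h1 : ‖∫ u in (0 : ℝ)..1, f u lam‖ ≤ C * lam ^ (-(2 * D)) * |1 - 0| := by
    refine intervalIntegral.norm_integral_le_of_norm_le_const fun u hu => ?_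
    rw [uIoc_of_le zero_le_one] at hu
    rw [Real.norm_eq_abs, abs_of_nonneg (h.nonneg _ _)]
    exact h.le_rpow u (Ioc_subset_Icc_self hu) lam hl
  simp only [sub_zero, abs_one, mul_one] at h1
  have h2 := pow_le_pow_left₀ (norm_nonneg _) h1 2
  rw [Real.norm_eq_abs, sq_abs] at h2
  refine h2.trans_eq ?_
  rw [mul_pow, ← Real.rpow_natCast (lam ^ (-(2 * D))), ← Real.rpow_mul hl.1.le]
  congr 2; push_cast; ring

theorem memLp_average (h : IsPoleDensity f D C) :
    MemLp (fun lam => ∫ u in (0 : ℝ)..1, f u lam) 2 (volume.restrict (Ioc 0 Real.pi)) := by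
  rw [memLp_two_iff_integrable_sq h.aestronglyMeasurable_average]
  refine h.integrable_rpow.mono' (h.aestronglyMeasurable_average.pow 2) ?_
  filter_upwards [ae_restrict_mem measurableSet_Ioc] with lam hl
  rw [Real.norm_eq_abs, abs_of_nonneg (sq_nonneg _)]
  exact h.average_sq_le hl

theorem average_even (h : IsPoleDensity f D C) {lam : ℝ} (hl : lam ∈ Ioc 0 Real.pi) :
    ∫ u in (0 : ℝ)..1, f u (-lam) = ∫ u in (0 : ℝ)..1, f u lam := by
  refine intervalIntegral.integral_congr_ae (Eventually.of_forall fun u hu => ?_)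
  rw [uIoc_of_le zero_le_one] at hu
  exact h.even u (Ioc_subset_Icc_self hu) lam hl

theorem F1_eq (h : IsPoleDensity f D C) :
    F1 f = 1 / Real.pi * ∫ p, f p.1 p.2 ^ 2
      ∂((volume.restrict (Ioc (0 : ℝ) 1)).prod (volume.restrict (Ioc 0 Real.pi))) := by
  have hpi := Real.pi_pos
  have h1 : ∫ u in (0 : ℝ)..1, ∫ lam in (-Real.pi)..Real.pi, f u lam ^ 2
      = ∫ u in (0 : ℝ)..1, 2 * ∫ lam in (0 : ℝ)..Real.pi, f u lam ^ 2 := by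
    refine intervalIntegral.integral_congr_ae (Eventually.of_forall fun u hu => ?_)
    rw [uIoc_of_le zero_le_one] at hu
    refine integral_symm_of_even hpi.le (h.intervalIntegrable_slice (Ioc_subset_Icc_self hu))
      fun lam hl => ?_
    rw [h.even u (Ioc_subset_Icc_self hu) lam hl]
  rw [F1, h1, intervalIntegral.integral_const_mul, integral_prod _ h.memLp_two.integrable_sq,
    intervalIntegral.integral_of_le zero_le_one]
  simp_rw [intervalIntegral.integral_of_le hpi.le]
  field_simp

theorem F2_eq (h : IsPoleDensity f D C) :
    F2 f = 1 / (2 * Real.pi) * ∫ lam, (∫ u in (0 : ℝ)..1, f u lam) ^ 2 ∂(volume.restrict (Ioc 0 Real.pi)) := by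
  have hpi := Real.pi_pos
  have h1 : IntervalIntegrable (fun lam => (∫ u in (0 : ℝ)..1, f u lam) ^ 2) volume 0 Real.pi :=
    (intervalIntegrable_iff_integrableOn_Ioc_of_le hpi.le).2 h.memLp_average.integrable_sq
  rw [F2, integral_symm_of_even hpi.le h1 fun lam hl => by rw [h.average_even hl],
    intervalIntegral.integral_of_le hpi.le]
  field_simp
  ring

/-- In the expanded square, the cross term integrates over time to the square of the average, and so
cancels half of itself. -/
theorem integral_sub_average_sq (h : IsPoleDensity f D C) :
    ∫ p, (f p.1 p.2 - ∫ v in (0 : ℝ)..1, f v p.2) ^ 2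
      ∂((volume.restrict (Ioc (0 : ℝ) 1)).prod (volume.restrict (Ioc 0 Real.pi)))
      = ∫ p, f p.1 p.2 ^ 2
      ∂((volume.restrict (Ioc (0 : ℝ) 1)).prod (volume.restrict (Ioc 0 Real.pi))) - ∫ lam, (∫ u in (0 : ℝ)..1, f u lam) ^ 2 ∂(volume.restrict (Ioc 0 Real.pi)) := by
  set g : ℝ → ℝ := fun lam => ∫ v in (0 : ℝ)..1, f v lam with hg
  have hgm : MemLp (fun p : ℝ × ℝ => g p.2) 2 ((volume.restrict (Ioc (0 : ℝ) 1)).prod (volume.restrict (Ioc 0 Real.pi))) := h.memLp_average.comp_snd (volume.restrict (Ioc (0 : ℝ) 1))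
  have i1 := h.memLp_two.integrable_sq
  have i2 : Integrable (fun p : ℝ × ℝ => f p.1 p.2 * g p.2) ((volume.restrict (Ioc (0 : ℝ) 1)).prod (volume.restrict (Ioc 0 Real.pi))) :=
    h.memLp_two.integrable_mul hgm
  have i3 := hgm.integrable_sq
  have e : ∀ p : ℝ × ℝ, (f p.1 p.2 - g p.2) ^ 2
      = (f p.1 p.2 ^ 2 - 2 * (f p.1 p.2 * g p.2)) + g p.2 ^ 2 := fun p => by ring
  change ∫ p : ℝ × ℝ, (f p.1 p.2 - g p.2) ^ 2
      ∂((volume.restrict (Ioc (0 : ℝ) 1)).prod (volume.restrict (Ioc 0 Real.pi)))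
    = _ - ∫ lam, g lam ^ 2 ∂(volume.restrict (Ioc 0 Real.pi))
  simp_rw [e]
  rw [integral_add (f := fun p : ℝ × ℝ => f p.1 p.2 ^ 2 - 2 * (f p.1 p.2 * g p.2))
    (i1.sub (i2.const_mul 2)) i3, integral_sub i1 (i2.const_mul 2),
    integral_const_mul, integral_prod_symm _ i2, integral_prod_symm _ i3]
  have e1 : ∀ lam, ∫ u, f u lam * g lam ∂(volume.restrict (Ioc (0 : ℝ) 1)) = g lam ^ 2 := fun lam => by
    rw [integral_mul_const, ← average_eq, sq]
  have e2 : ∀ lam, ∫ _u, g lam ^ 2 ∂(volume.restrict (Ioc (0 : ℝ) 1)) = g lam ^ 2 := fun lam => by simp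
  simp only [e1, e2]
  ring

theorem Dsq_eq (h : IsPoleDensity f D C) :
    Dsq f = 2 * Real.pi * F1 f - 4 * Real.pi * F2 f := by
  have hpi := Real.pi_pos
  set g : ℝ → ℝ := fun lam => ∫ v in (0 : ℝ)..1, f v lam with hg
  have hgm : MemLp (fun p : ℝ × ℝ => g p.2) 2 ((volume.restrict (Ioc (0 : ℝ) 1)).prod (volume.restrict (Ioc 0 Real.pi))) := h.memLp_average.comp_snd (volume.restrict (Ioc (0 : ℝ) 1))
  have hm := (h.memLp_two.sub hgm).integrable_sq
  have hslice : ∀ u ∈ Icc (0 : ℝ) 1,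
      IntervalIntegrable (fun lam => (f u lam - g lam) ^ 2) volume 0 Real.pi := by
    intro u hu
    rw [intervalIntegrable_iff_integrableOn_Ioc_of_le hpi.le]
    have hc : ContinuousOn (fun lam => f u lam) (Ioc 0 Real.pi) :=
      h.continuousOn.comp (f := fun lam => (u, lam)) (by fun_prop) fun lam hl => ⟨hu, hl⟩
    have h1 : MemLp (fun lam => f u lam) 2 (volume.restrict (Ioc 0 Real.pi)) := by
      rw [memLp_two_iff_integrable_sq (hc.aestronglyMeasurable measurableSet_Ioc)]
      exact (intervalIntegrable_iff_integrableOn_Ioc_of_le hpi.le).1 (h.intervalIntegrable_slice hu)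
    exact (h1.sub h.memLp_average).integrable_sq
  have h1 : Dsq f = ∫ u in (0 : ℝ)..1, 2 * ∫ lam in (0 : ℝ)..Real.pi, (f u lam - g lam) ^ 2 := by
    refine intervalIntegral.integral_congr_ae (Eventually.of_forall fun u hu => ?_)
    rw [uIoc_of_le zero_le_one] at hu
    refine integral_symm_of_even hpi.le (hslice u (Ioc_subset_Icc_self hu)) fun lam hl => ?_
    rw [h.even u (Ioc_subset_Icc_self hu) lam hl, h.average_even hl]
  have h2 : Dsq f = 2 * ∫ p, (f p.1 p.2 - g p.2) ^ 2
      ∂((volume.restrict (Ioc (0 : ℝ) 1)).prod (volume.restrict (Ioc 0 Real.pi))) := by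
    rw [h1, intervalIntegral.integral_const_mul, intervalIntegral.integral_of_le zero_le_one]
    simp_rw [intervalIntegral.integral_of_le hpi.le]
    congr 1
    exact (integral_prod _ hm).symm
  rw [h2, hg, h.integral_sub_average_sq, h.F1_eq, h.F2_eq]
  field_simp
  ring

/-- The substitution is λ = 2πx, and the factor 2 is the second moment of the normalised innovation
periodogram. -/
theorem riemann_limit_F1 (h : IsPoleDensity f D C) :
    ∫ x in (0 : ℝ)..(1 / 2), ∫ u in (0 : ℝ)..1, 2 * f u (2 * Real.pi * x) ^ 2 = F1 f := by
  have hpi := Real.pi_pos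
  have h1 := intervalIntegral.integral_comp_mul_left (a := 0) (b := 1 / 2)
    (fun lam => ∫ u in (0 : ℝ)..1, 2 * f u lam ^ 2) (c := 2 * Real.pi) (by positivity)
  have e : 2 * Real.pi * (1 / 2) = Real.pi := by ring
  rw [h1, mul_zero, e, h.F1_eq, integral_prod_symm _ h.memLp_two.integrable_sq,
    intervalIntegral.integral_of_le hpi.le]
  simp_rw [intervalIntegral.integral_of_le zero_le_one, integral_const_mul]
  rw [smul_eq_mul]
  field_simp

theorem riemann_limit_F2 (h : IsPoleDensity f D C) :
    ∫ x in (0 : ℝ)..(1 / 2), (∫ u in (0 : ℝ)..1, f u (2 * Real.pi * x)) ^ 2 = F2 f := by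
  have hpi := Real.pi_pos
  have h1 := intervalIntegral.integral_comp_mul_left (a := 0) (b := 1 / 2)
    (fun lam => (∫ u in (0 : ℝ)..1, f u lam) ^ 2) (c := 2 * Real.pi) (by positivity)
  have e : 2 * Real.pi * (1 / 2) = Real.pi := by ring
  rw [h1, mul_zero, e, h.F2_eq, intervalIntegral.integral_of_le hpi.le, smul_eq_mul, one_div]

end IsPoleDensity

end LongMemory

/-! ### Passage to the limit for weighted arrays. -/

namespace LongMemory

/-- The choice η = √(S + 1/(n+1)) makes both S/η and ηR vanish; the summand 1/(n+1) keeps η positive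
when S is zero. -/
theorem tendsto_zero_of_quadratic_tradeoff {a S R r : ℕ → ℝ} {L : ℝ} (ha : ∀ n, 0 ≤ a n)
    (hS0 : ∀ n, 0 ≤ S n) (hS : Tendsto S atTop (𝓝 0)) (hR : Tendsto R atTop (𝓝 L))
    (hr : Tendsto r atTop (𝓝 0))
    (h : ∀ n, ∀ η : ℝ, 0 < η → a n ≤ (1 + 1 / η) * S n + η * R n + r n) :
    Tendsto a atTop (𝓝 0) := by
  set η : ℕ → ℝ := fun n => √(S n + 1 / ((n : ℝ) + 1)) with hη
  have hpos : ∀ n, 0 < S n + 1 / ((n : ℝ) + 1) := fun n =>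
    add_pos_of_nonneg_of_pos (hS0 n) (by positivity)
  have hη0 : ∀ n, 0 < η n := fun n => Real.sqrt_pos.2 (hpos n)
  have hηsq : ∀ n, S n ≤ η n * η n := fun n => by
    rw [hη, Real.mul_self_sqrt (hpos n).le]
    have : (0 : ℝ) ≤ 1 / ((n : ℝ) + 1) := by positivity
    linarith
  have hηlim : Tendsto η atTop (𝓝 0) := by
    have := (hS.add (tendsto_one_div_add_atTop_nhds_zero_nat (𝕜 := ℝ))).sqrt
    rwa [add_zero, Real.sqrt_zero] at this
  have hlim : Tendsto (fun n => S n + η n + η n * R n + r n) atTop (𝓝 0) := by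
    simpa using ((hS.add hηlim).add (hηlim.mul hR)).add hr
  refine squeeze_zero ha (fun n => (h n (η n) (hη0 n)).trans ?_) hlim
  have h1 : 1 / η n * S n ≤ η n := by
    rw [one_div, inv_mul_le_iff₀ (hη0 n)]; exact hηsq n
  linarith

theorem tendsto_blockMid {N M : ℕ → ℕ} (hNpos : ∀ n, 0 < N n) (hMpos : ∀ n, 0 < M n)
    (hM : Tendsto M atTop atTop) {u : ℝ} (hu : 0 ≤ u) :
    Tendsto (fun n => blockMid (N n * M n) (N n) ⌈u * M n⌉₊) atTop (𝓝 u) := by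
  have h1 := tendsto_ceil_mul_div hM hu
  have h2 : Tendsto (fun n => (1 / 2 : ℝ) / M n) atTop (𝓝 0) :=
    (tendsto_natCast_atTop_atTop.comp hM).const_div_atTop _
  have h3 := h1.sub h2
  rw [sub_zero] at h3
  refine h3.congr fun n => ?_
  have hN' : (0 : ℝ) < N n := by exact_mod_cast hNpos n
  have hM' : (0 : ℝ) < M n := by exact_mod_cast hMpos n
  rw [blockMid]; push_cast; field_simp; ring

theorem tendsto_fourierFreq {N : ℕ → ℕ} (hN : Tendsto N atTop atTop) {x : ℝ} (hx : 0 ≤ x) :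
    Tendsto (fun n => fourierFreq (N n) ⌈x * N n⌉₊) atTop (𝓝 (2 * Real.pi * x)) := by
  refine ((tendsto_ceil_mul_div hN hx).const_mul (2 * Real.pi)).congr fun n => ?_
  rw [fourierFreq]; ring

theorem fourierFreq_mem {N k : ℕ} (hN : 0 < N) (hk : k ∈ Finset.Icc 1 (N / 2)) :
    fourierFreq N k ∈ Ioc 0 Real.pi := by
  have hpi := Real.pi_pos
  rw [Finset.mem_Icc] at hk
  have hN' : (0 : ℝ) < N := by exact_mod_cast hN
  have hk' : (0 : ℝ) < k := by exact_mod_cast hk.1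
  have hkN : (k : ℝ) * 2 ≤ N := by exact_mod_cast (by omega : k * 2 ≤ N)
  rw [fourierFreq]
  refine ⟨by positivity, ?_⟩
  rw [div_le_iff₀ hN']
  nlinarith

theorem one_le_mul_fourierFreq {N k : ℕ} (hN : 0 < N) (hk : 1 ≤ k) :
    1 ≤ N * fourierFreq N k := by
  have hpi := Real.pi_gt_three
  have hN' : (0 : ℝ) < N := by exact_mod_cast hN
  have hk' : (1 : ℝ) ≤ k := by exact_mod_cast hk
  rw [fourierFreq, mul_div_cancel₀ _ hN'.ne']
  nlinarith

theorem fourierFreq_rpow_neg_le {N k : ℕ} (hN : 0 < N) (hk : 1 ≤ k) {p : ℝ} (hp : 0 ≤ p) :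
    fourierFreq N k ^ (-p) ≤ ((k : ℝ) / N) ^ (-p) := by
  have hpi := Real.pi_gt_three
  have hN' : (0 : ℝ) < N := by exact_mod_cast hN
  have hk' : (1 : ℝ) ≤ k := by exact_mod_cast hk
  refine Real.rpow_le_rpow_of_nonpos (by positivity) ?_ (by linarith)
  rw [fourierFreq]
  gcongr
  nlinarith

theorem eventually_two_mul_ceil_lt {N : ℕ → ℕ} (hNpos : ∀ n, 0 < N n)
    (hN : Tendsto N atTop atTop) {x : ℝ} (hx : x ∈ Ioo (0 : ℝ) (1 / 2)) :
    ∀ᶠ n in atTop, 2 * ⌈x * N n⌉₊ < N n := by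
  filter_upwards [(tendsto_ceil_mul_div hN hx.1.le).eventually_lt_const hx.2] with n hn
  have hN' : (0 : ℝ) < N n := by exact_mod_cast hNpos n
  rw [div_lt_iff₀ hN'] at hn
  exact_mod_cast (by linarith : (2 : ℝ) * ⌈x * N n⌉₊ < N n)

theorem integral_abs_sub_const_le {Ω : Type*} [MeasurableSpace Ω] {P : Measure Ω} [IsFiniteMeasure P] {F G : Ω → ℝ} (hF : Integrable F P)
    (hG : Integrable G P) (c : ℝ) :
    ∫ ω, |F ω - c| ∂P ≤ ∫ ω, |F ω - G ω| ∂P + ∫ ω, |G ω - c| ∂P := by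
  have i1 : Integrable (fun ω => |F ω - G ω|) P := (hF.sub hG).abs
  have i2 : Integrable (fun ω => |G ω - c|) P := (hG.sub (integrable_const c)).abs
  rw [← integral_add i1 i2]
  exact integral_mono_of_nonneg (Eventually.of_forall fun ω => abs_nonneg _) (i1.add i2)
    (Eventually.of_forall fun ω => abs_sub_le _ _ _)

section Arrays

variable {Ω : Type*} [MeasurableSpace Ω] {P : Measure Ω} [IsProbabilityMeasure P]
  {Z : ℤ → Ω → ℝ} {N M : ℕ → ℕ} {I : ℕ → ℕ → ℕ → Ω → ℝ} {w : ℕ → ℕ → ℕ → ℝ} {W : ℝ → ℝ → ℝ}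
  {C β : ℝ}

theorem tendsto_integral_abs_gridAvg_sq_sub (hZ : iIndepFun Z P)
    (hg : ∀ i, HasLaw (Z i) (gaussianReal 0 1) P) (hNpos : ∀ n, 0 < N n)
    (hMpos : ∀ n, 0 < M n) (hNe : ∀ n, Even (N n)) (hN : Tendsto N atTop atTop)
    (hM : Tendsto M atTop atTop) (hC : 0 ≤ C) (hβ0 : 0 ≤ β) (hβ : β < 1)
    (hI : ∀ n, ∀ j ∈ Finset.Icc 1 (M n), ∀ k ∈ Finset.Icc 1 (N n / 2), MemLp (I n j k) 2 P)
    (hE : Tendsto (fun n => gridAvg (N n) (M n) (N n / 2) fun j k =>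
      ∫ ω, (I n j k ω - w n j k * noisePeriodogram Z (N n) j (fourierFreq (N n) k) ω) ^ 2 ∂P)
      atTop (𝓝 0))
    (hw : ∀ n, ∀ j ∈ Finset.Icc 1 (M n), ∀ k ∈ Finset.Icc 1 (N n / 2),
      w n j k ^ 2 ≤ C * ((k : ℝ) / N n) ^ (-β))
    (hW : ∀ u ∈ Ioo (0 : ℝ) 1, ∀ x ∈ Ioo (0 : ℝ) (1 / 2),
      Tendsto (fun n => w n ⌈u * M n⌉₊ ⌈x * N n⌉₊) atTop (𝓝 (W u x))) :
    Tendsto (fun n => ∫ ω, |gridAvg (N n) (M n) (N n / 2) (fun j k => I n j k ω ^ 2)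
      - ∫ x in (0 : ℝ)..(1 / 2), ∫ u in (0 : ℝ)..1, 2 * W u x ^ 2| ∂P) atTop (𝓝 0) := by
  set L := ∫ x in (0 : ℝ)..(1 / 2), ∫ u in (0 : ℝ)..1, 2 * W u x ^ 2 with hL
  set g : ℕ → ℕ → ℕ → Ω → ℝ := fun n j k ω =>
    w n j k * noisePeriodogram Z (N n) j (fourierFreq (N n) k) ω with hgdef
  have hgm : ∀ n j k, MemLp (g n j k) 2 P := fun n j k =>
    (memLp_noisePeriodogram hg _ _ _).const_mul _
  have hgsq : ∀ n j k, ∫ ω, g n j k ω ^ 2 ∂P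
      = w n j k ^ 2 * ∫ ω, noisePeriodogram Z (N n) j (fourierFreq (N n) k) ω ^ 2 ∂P := by
    intro n j k
    simp_rw [hgdef, mul_pow]
    rw [integral_const_mul]
  have hSy : Tendsto (fun n => gridAvg (N n) (M n) (N n / 2) fun j k => ∫ ω, g n j k ω ^ 2 ∂P)
      atTop (𝓝 L) := by
    refine tendsto_double_riemann_sum hNpos hMpos hNe (C := 12 * C) (by positivity) hβ0 hβ
      (fun n j hj k hk => ?_) fun u hu x hx => ?_
    · have h1 := hw n j hj k hk
      have h2 := integral_noisePeriodogram_sq_le hZ hg (hNpos n) j (fourierFreq (N n) k)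
      have h3 : 0 ≤ ∫ ω, noisePeriodogram Z (N n) j (fourierFreq (N n) k) ω ^ 2 ∂P :=
        integral_nonneg fun ω => sq_nonneg _
      rw [hgsq, abs_of_nonneg (by positivity)]
      nlinarith [sq_nonneg (w n j k)]
    -- The second moment is 2 only for 2k < N. For fixed x < 1/2 this holds eventually, so the
    -- exceptional node k = N/2 does not affect the limit.
    · have h1 := ((hW u hu x hx).pow 2).const_mul 2
      refine h1.congr' ?_
      filter_upwards [eventually_two_mul_ceil_lt hNpos hN hx] with n hn
      have hk := ceil_mul_mem_Icc (hNpos n) (half_div_eq (hNpos n) (hNe n)) hx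
      rw [hgsq, integral_noisePeriodogram_sq hZ hg _ (Finset.mem_Icc.1 hk).1 hn, mul_comm]
  set B := C * (1 / (1 - β)) with hB
  set V : ℕ → Ω → ℝ := fun n ω => gridAvg (N n) (M n) (N n / 2) fun j k => g n j k ω ^ 2 with hV
  have hVar : ∀ n, MemLp (V n) 2 P ∧ Var[V n; P] ≤ 16 * gaussMoment 4 * B ^ 2 / M n := by
    intro n
    refine variance_average_noise_sq_le hZ hg (hNpos n) (hMpos n) (fun k => fourierFreq (N n) k)
      (w := w n) (m := N n / 2) fun j hj => ?_
    calc ∑ k ∈ Finset.Icc 1 (N n / 2), w n j k ^ 2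
        ≤ ∑ k ∈ Finset.Icc 1 (N n / 2), C * ((k : ℝ) / N n) ^ (-β) :=
          Finset.sum_le_sum fun k hk => hw n j hj k hk
      _ ≤ C * (N n * (1 / (1 - β))) := by
          rw [← Finset.mul_sum]
          exact mul_le_mul_of_nonneg_left
            (sum_Icc_div_rpow_neg_le (hNpos n) (Nat.div_le_self _ _) hβ0 hβ) hC
      _ = N n * B := by rw [hB]; ring
  have hEV : ∀ n, ∫ ω, V n ω ∂P
      = gridAvg (N n) (M n) (N n / 2) fun j k => ∫ ω, g n j k ω ^ 2 ∂P := fun n =>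
    integral_gridAvg fun j _ k _ => (hgm n j k).integrable_sq
  -- A positive number whose square dominates the variance; the added 1 excludes κ = 0.
  set κ : ℕ → ℝ := fun n => √((16 * gaussMoment 4 * B ^ 2 + 1) / M n) with hκ
  have hgm4 : 0 ≤ gaussMoment 4 := gaussMoment_nonneg 4
  have hκarg : ∀ n, 0 < (16 * gaussMoment 4 * B ^ 2 + 1) / (M n : ℝ) := fun n => by
    have : (0 : ℝ) < M n := by exact_mod_cast hMpos n
    positivity
  have hκlim : Tendsto κ atTop (𝓝 0) := by
    have := ((tendsto_natCast_atTop_atTop (R := ℝ)).comp hM).const_div_atTop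
      (16 * gaussMoment 4 * B ^ 2 + 1)
    rw [← Real.sqrt_zero]
    exact this.sqrt
  have hVκ : ∀ n, ∫ ω, |V n ω - ∫ x, V n x ∂P| ∂P ≤ κ n := fun n => by
    refine integral_abs_sub_integral_le (hVar n).1 (Real.sqrt_pos.2 (hκarg n))
      ((hVar n).2.trans ?_)
    rw [Real.sq_sqrt (hκarg n).le]
    gcongr
    linarith
  refine tendsto_zero_of_quadratic_tradeoff (fun n => integral_nonneg fun ω => abs_nonneg _)
    (fun n => ?_) hE hSy (r := fun n => κ n + |∫ ω, V n ω ∂P - L|) ?_ fun n η hη => ?_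
  · have hp : 0 ≤ fun (j k : ℕ) => ∫ ω, (I n j k ω - g n j k ω) ^ 2 ∂P := fun j k =>
      integral_nonneg fun ω => sq_nonneg _
    unfold gridAvg
    exact mul_nonneg (by positivity) (Finset.sum_nonneg fun k _ =>
      mul_nonneg (by positivity) (Finset.sum_nonneg fun j _ => hp j k))
  · have h1 := (hSy.sub_const L).abs
    simp_rw [← hEV] at h1
    simpa using hκlim.add h1
  · have h1 := integral_abs_gridAvg_sq_sub_le (N := N n) (hI n) (fun j _ k _ => hgm n j k) hη
    have iI : Integrable (fun ω => gridAvg (N n) (M n) (N n / 2) fun j k => I n j k ω ^ 2) P :=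
      integrable_gridAvg fun j hj k hk => (hI n j hj k hk).integrable_sq
    have iV : Integrable (V n) P := (hVar n).1.integrable (by norm_num)
    have h2 := integral_abs_sub_const_le iI iV L
    have h3 := integral_abs_sub_const_le iV (integrable_const (∫ x, V n x ∂P)) L
    simp only [integral_const, probReal_univ, one_smul] at h3
    have h4 := hVκ n
    linarith

/-- Here only the mean 1 of the innovation periodogram enters the limit: its fluctuations are
removed at rate 12/M by averaging over blocks before squaring. -/
theorem tendsto_integral_abs_avgSq_sub (hZ : iIndepFun Z P)
    (hg : ∀ i, HasLaw (Z i) (gaussianReal 0 1) P) (hNpos : ∀ n, 0 < N n)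
    (hMpos : ∀ n, 0 < M n) (hNe : ∀ n, Even (N n))
    (hM : Tendsto M atTop atTop) (hC : 0 ≤ C) (hβ0 : 0 ≤ β) (hβ : β < 1)
    (hI : ∀ n, ∀ j ∈ Finset.Icc 1 (M n), ∀ k ∈ Finset.Icc 1 (N n / 2), MemLp (I n j k) 2 P)
    (hE : Tendsto (fun n => gridAvg (N n) (M n) (N n / 2) fun j k =>
      ∫ ω, (I n j k ω - w n j k * noisePeriodogram Z (N n) j (fourierFreq (N n) k) ω) ^ 2 ∂P)
      atTop (𝓝 0))
    (hw : ∀ n, ∀ j ∈ Finset.Icc 1 (M n), ∀ k ∈ Finset.Icc 1 (N n / 2),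
      w n j k ^ 2 ≤ C * ((k : ℝ) / N n) ^ (-β))
    (hW : ∀ u ∈ Ioo (0 : ℝ) 1, ∀ x ∈ Ioo (0 : ℝ) (1 / 2),
      Tendsto (fun n => w n ⌈u * M n⌉₊ ⌈x * N n⌉₊) atTop (𝓝 (W u x))) :
    Tendsto (fun n => ∫ ω, |avgSq (N n) (M n) (N n / 2) (fun j k => I n j k ω)
      - ∫ x in (0 : ℝ)..(1 / 2), (∫ u in (0 : ℝ)..1, W u x) ^ 2| ∂P) atTop (𝓝 0) := by
  set L := ∫ x in (0 : ℝ)..(1 / 2), (∫ u in (0 : ℝ)..1, W u x) ^ 2 with hL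
  have hN' : ∀ n, (0 : ℝ) < N n := fun n => by exact_mod_cast hNpos n
  have hM' : ∀ n, (0 : ℝ) < M n := fun n => by exact_mod_cast hMpos n
  set g : ℕ → ℕ → ℕ → Ω → ℝ := fun n j k ω =>
    w n j k * noisePeriodogram Z (N n) j (fourierFreq (N n) k) ω with hgdef
  have hgm : ∀ n j k, MemLp (g n j k) 2 P := fun n j k =>
    (memLp_noisePeriodogram hg _ _ _).const_mul _
  have hSw : Tendsto (fun n => gridAvg (N n) (M n) (N n / 2) fun j k => w n j k ^ 2) atTop
      (𝓝 (∫ x in (0 : ℝ)..(1 / 2), ∫ u in (0 : ℝ)..1, W u x ^ 2)) :=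
    tendsto_double_riemann_sum hNpos hMpos hNe hC hβ0 hβ
      (fun n j hj k hk => by rw [abs_of_nonneg (sq_nonneg _)]; exact hw n j hj k hk)
      fun u hu x hx => (hW u hu x hx).pow 2
  have hSF : Tendsto (fun n => avgSq (N n) (M n) (N n / 2) (w n)) atTop (𝓝 L) := by
    refine tendsto_riemann_sum hNpos (fun n => half_div_eq (hNpos n) (hNe n)) hβ hβ0 hC
      (fun n k hk => ?_) fun x hx => ?_
    · rw [abs_of_nonneg (sq_nonneg _)]
      refine (sq_average_le (M n) fun j => w n j k).trans ((le_abs_self _).trans ?_)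
      refine abs_block_average_le (hMpos n) fun j hj => ?_
      rw [abs_of_nonneg (sq_nonneg _)]
      exact hw n j hj k hk
    -- At fixed x the bound on w² gives a bound on |w| independent of the block, enough to pass to
    -- the limit in the time average before squaring.
    · refine Tendsto.pow (tendsto_block_average hMpos (C := √(C * x ^ (-β))) (Real.sqrt_nonneg _)
        (fun n j hj => Real.abs_le_sqrt ?_) fun u hu => hW u hu x hx) 2
      refine (hw n j hj _ (ceil_mul_mem_Icc (hNpos n)
        (half_div_eq (hNpos n) (hNe n)) hx)).trans ?_
      refine mul_le_mul_of_nonneg_left (Real.rpow_le_rpow_of_nonpos hx.1 ?_ (by linarith)) hC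
      rw [le_div_iff₀ (hN' n)]; exact Nat.le_ceil _
  set SE : ℕ → ℝ := fun n => gridAvg (N n) (M n) (N n / 2) fun j k =>
      ∫ ω, (I n j k ω - g n j k ω) ^ 2 ∂P with hSE
  have hSE0 : ∀ n, 0 ≤ SE n := fun n => by
    have hp : ∀ (j k : ℕ), 0 ≤ ∫ ω, (I n j k ω - g n j k ω) ^ 2 ∂P := fun j k =>
      integral_nonneg fun ω => sq_nonneg _
    exact mul_nonneg (by positivity) (Finset.sum_nonneg fun k _ =>
      mul_nonneg (by positivity) (Finset.sum_nonneg fun j _ => hp j k))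
  have hSw0 : ∀ n, 0 ≤ gridAvg (N n) (M n) (N n / 2) fun j k => w n j k ^ 2 := fun n =>
    mul_nonneg (by positivity) (Finset.sum_nonneg fun k _ =>
      mul_nonneg (by positivity) (Finset.sum_nonneg fun j _ => sq_nonneg _))
  have h12 : Tendsto (fun n => (12 : ℝ) / M n) atTop (𝓝 0) :=
    (tendsto_natCast_atTop_atTop.comp hM).const_div_atTop _
  refine tendsto_zero_of_quadratic_tradeoff (fun n => integral_nonneg fun ω => abs_nonneg _)
    (S := fun n => 2 * SE n
      + 2 * (12 / M n * gridAvg (N n) (M n) (N n / 2) fun j k => w n j k ^ 2))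
    (fun n => ?_) ?_ hSF (r := fun n => |avgSq (N n) (M n) (N n / 2) (w n) - L|) ?_
    fun n η hη => ?_
  · have := hSE0 n
    have := hSw0 n
    have := hM' n
    positivity
  · simpa using (hE.const_mul 2).add ((h12.mul hSw).const_mul 2)
  · simpa using (hSF.sub_const L).abs
  · have h1 := integral_abs_avgSq_sub_le (N := N n) (w := w n) (hI n)
      (fun j _ k _ => hgm n j k) hη
    have iI : Integrable (fun ω => avgSq (N n) (M n) (N n / 2) fun j k => I n j k ω) P :=
      integrable_avgSq (hI n)
    have h2 := integral_abs_sub_const_le iI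
      (integrable_const (avgSq (N n) (M n) (N n / 2) (w n))) L
    simp only [integral_const, probReal_univ, one_smul] at h2
    have h3 : 1 / (N n : ℝ) * ∑ k ∈ Finset.Icc 1 (N n / 2),
        ∫ ω, (1 / (M n : ℝ) * ∑ j ∈ Finset.Icc 1 (M n), (g n j k ω - w n j k)) ^ 2 ∂P
        ≤ 12 / M n * gridAvg (N n) (M n) (N n / 2) fun j k => w n j k ^ 2 := by
      rw [gridAvg, mul_left_comm, Finset.mul_sum _ _ (12 / (M n : ℝ))]
      gcongr with k hk
      exact integral_average_noise_sub_sq_le hZ hg (hNpos n) _ _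
    have h4 : 0 ≤ 1 + 1 / η := by positivity
    have h5 : (1 + 1 / η) * (2 * SE n + 2 * (1 / (N n : ℝ) * ∑ k ∈ Finset.Icc 1 (N n / 2),
        ∫ ω, (1 / (M n : ℝ) * ∑ j ∈ Finset.Icc 1 (M n), (g n j k ω - w n j k)) ^ 2 ∂P))
        ≤ (1 + 1 / η) * (2 * SE n
          + 2 * (12 / M n * gridAvg (N n) (M n) (N n / 2) fun j k => w n j k ^ 2)) := by
      gcongr
    linarith

end Arrays

theorem F1hat_eq_gridAvg (x : ℕ → ℝ) (N M : ℕ) :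
    F1hat x (N * M) N M = gridAvg N M (N / 2) fun j k =>
      localPeriodogram x (N * M) N (blockMid (N * M) N j) (fourierFreq N k) ^ 2 := by
  rw [F1hat, gridAvg, ← Finset.mul_sum, Finset.sum_comm, ← mul_assoc, Nat.cast_mul,
    one_div_mul_one_div]

theorem F2hat_eq_avgSq (x : ℕ → ℝ) (T N M : ℕ) :
    F2hat x T N M = avgSq N M (N / 2) fun j k =>
      localPeriodogram x T N (blockMid T N j) (fourierFreq N k) := rfl

/-- The coefficients are real, so changing the sign of λ conjugates every partial sum. -/
theorem transferFunction_neg {ψ : ℕ → ℝ → ℝ} {u lam : ℝ}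
    (h : Tendsto (fun n => ∑ l ∈ Finset.range n, (ψ l u : ℂ) * phase lam l) atTop
      (𝓝 (transferFunction ψ u lam))) :
    transferFunction ψ u (-lam) = starRingEnd ℂ (transferFunction ψ u lam) := by
  refine Tendsto.limUnder_eq (((Complex.continuous_conj.tendsto _).comp h).congr fun n => ?_)
  simp only [Function.comp_apply, map_sum, map_mul, Complex.conj_ofReal, phase, ← Complex.exp_conj]
  refine Finset.sum_congr rfl fun l _ => ?_
  congr 2
  simp

theorem spectralDensity_neg {ψ : ℕ → ℝ → ℝ} {u lam : ℝ}
    (h : Tendsto (fun n => ∑ l ∈ Finset.range n, (ψ l u : ℂ) * phase lam l) atTop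
      (𝓝 (transferFunction ψ u lam))) :
    spectralDensity ψ u (-lam) = spectralDensity ψ u lam := by
  rw [spectralDensity, spectralDensity, transferFunction_neg h, RCLike.norm_conj]

end LongMemory

/-! ### Assembly of the limits. -/

theorem theorem3p1 {Ω : Type*} [MeasurableSpace Ω] (P : Measure Ω) [IsProbabilityMeasure P]
    (X : ℕ → ℕ → Ω → ℝ) (Z : ℤ → Ω → ℝ) (ψT : ℕ → ℕ → ℕ → ℝ)
    (ψ : ℕ → ℝ → ℝ) (a d : ℝ → ℝ)
    (hX : LongMemory.IsLocallyStationary P X Z ψT ψ a d)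
    (hd : LongMemory.dSup d < 1 / 4)
    (T N M : ℕ → ℕ)
    (hTNM : ∀ n, T n = N n * M n)
    (hNpos : ∀ n, 0 < N n) (hMpos : ∀ n, 0 < M n) (hNeven : ∀ n, Even (N n))
    (hT : Tendsto T atTop atTop)
    (hN : Tendsto N atTop atTop)
    (hNT : Tendsto (fun n => (N n : ℝ) / (T n : ℝ)) atTop (𝓝 0)) :
    IntegrableOn (fun p : ℝ × ℝ => LongMemory.spectralDensity ψ p.1 p.2 ^ 2)
        (Icc (0 : ℝ) 1 ×ˢ Icc (-Real.pi) Real.pi) ∧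
      TendstoInMeasure P
        (fun n ω => LongMemory.F1hat (fun t => X t (T n) ω) (T n) (N n) (M n)) atTop
        (fun _ => LongMemory.F1 (LongMemory.spectralDensity ψ)) ∧
      TendstoInMeasure P
        (fun n ω => LongMemory.F2hat (fun t => X t (T n) ω) (T n) (N n) (M n)) atTop
        (fun _ => LongMemory.F2 (LongMemory.spectralDensity ψ)) ∧
      TendstoInMeasure P
        (fun n ω => LongMemory.DsqHat (fun t => X t (T n) ω) (T n) (N n) (M n)) atTop
        (fun _ => LongMemory.Dsq (LongMemory.spectralDensity ψ)) := by
  open LongMemory in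
  obtain rfl : T = fun n => N n * M n := funext hTNM
  have hN' : ∀ n, (0 : ℝ) < N n := fun n => by exact_mod_cast hNpos n
  have hM' : ∀ n, (0 : ℝ) < M n := fun n => by exact_mod_cast hMpos n
  have hpi := Real.pi_pos
  -- N/T = 1/M, so the condition N/T → 0 says exactly that the number of blocks grows.
  have hM : Tendsto M atTop atTop := by
    have h1 : Tendsto (fun n => (M n : ℝ)⁻¹) atTop (𝓝[>] 0) := by
      refine tendsto_nhdsWithin_iff.2 ⟨hNT.congr fun n => ?_,
        Eventually.of_forall fun n => inv_pos.2 (hM' n)⟩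
      have := (hN' n).ne'
      have := (hM' n).ne'
      push_cast
      field_simp
    have h2 := h1.inv_tendsto_nhdsGT_zero
    simp only [Pi.inv_def, inv_inv] at h2
    exact tendsto_natCast_atTop_iff.1 h2
  obtain ⟨D, C, hD0, hD1, hC, hf, hB, hE⟩ := hX.exists_bartlett hd
  have hpole : IsPoleDensity (spectralDensity ψ) D C :=
    { continuousOn := hX.f_contDiff.continuousOn
      nonneg := spectralDensity_nonneg ψ
      le_rpow := fun u hu lam hl => (hf u hu lam hl.1 hl.2).1
      even := fun u hu lam hl => spectralDensity_neg (hf u hu lam hl.1 hl.2).2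
      lt := hD1 }
  set I : ℕ → ℕ → ℕ → Ω → ℝ := fun n j k ω =>
    localPeriodogram (fun t => X t (N n * M n) ω) (N n * M n) (N n)
      (blockMid (N n * M n) (N n) j) (fourierFreq (N n) k) with hI
  set w : ℕ → ℕ → ℕ → ℝ := fun n j k =>
    spectralDensity ψ (blockMid (N n * M n) (N n) j) (fourierFreq (N n) k) with hw
  have hblock : ∀ n, ∀ j ∈ Finset.Icc 1 (M n), blockMid (N n * M n) (N n) j ∈ Icc (0 : ℝ) 1 :=
    fun n j hj => blockMid_mem_unit (hNpos n) (Finset.mem_Icc.1 hj).1 (Finset.mem_Icc.1 hj).2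
  have hcM : ∀ n, ((M n : ℕ) : ℝ) / M n = 1 := fun n => div_self (hM' n).ne'
  have hcN : ∀ n, ((N n / 2 : ℕ) : ℝ) / N n = 1 / 2 := fun n => half_div_eq (hNpos n) (hNeven n)
  have hpow : ∀ n, ∀ k ∈ Finset.Icc 1 (N n / 2),
      fourierFreq (N n) k ^ (-(4 * D)) ≤ ((k : ℝ) / N n) ^ (-(4 * D)) := fun n k hk =>
    fourierFreq_rpow_neg_le (hNpos n) (Finset.mem_Icc.1 hk).1 (by linarith)
  have hBn : ∀ n, ∀ j ∈ Finset.Icc 1 (M n), ∀ k ∈ Finset.Icc 1 (N n / 2),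
      MemLp (I n j k) 2 P ∧ bartlettError P X Z ψ (N n) (M n) j (fourierFreq (N n) k)
        ≤ C * fourierFreq (N n) k ^ (-(4 * D)) := fun n j hj k hk =>
    have hl := fourierFreq_mem (hNpos n) hk
    hB (N n) (M n) j (hNpos n) (hNeven n) (Finset.mem_Icc.1 hj).1 (Finset.mem_Icc.1 hj).2 _
      hl.1 hl.2 (one_le_mul_fourierFreq (hNpos n) (Finset.mem_Icc.1 hk).1)
  have hImem : ∀ n, ∀ j ∈ Finset.Icc 1 (M n), ∀ k ∈ Finset.Icc 1 (N n / 2),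
      MemLp (I n j k) 2 P := fun n j hj k hk => (hBn n j hj k hk).1
  have hSE : Tendsto (fun n => gridAvg (N n) (M n) (N n / 2) fun j k =>
      ∫ ω, (I n j k ω - w n j k * noisePeriodogram Z (N n) j (fourierFreq (N n) k) ω) ^ 2 ∂P)
      atTop (𝓝 0) := by
    have h0 : (0 : ℝ) = ∫ _x in (0 : ℝ)..(1 / 2), ∫ _u in (0 : ℝ)..1, (0 : ℝ) := by simp
    rw [h0]
    -- The averaged Bartlett error is a double Riemann sum with limit function zero, dominated with
    -- exponent 4D < 1.
    refine tendsto_double_riemann_sum hNpos hMpos hNeven hC.le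
      (by linarith : 0 ≤ 4 * D) (by linarith) (fun n j hj k hk => ?_) fun u hu x hx => ?_
    · rw [abs_of_nonneg (integral_nonneg fun ω => sq_nonneg _)]
      exact (hBn n j hj k hk).2.trans (mul_le_mul_of_nonneg_left (hpow n k hk) hC.le)
    · exact hE N M (fun n => ⌈u * M n⌉₊) (fun n => fourierFreq (N n) ⌈x * N n⌉₊)
        (2 * Real.pi * x) hNpos hNeven
        (Eventually.of_forall fun n => Finset.mem_Icc.1 (ceil_mul_mem_Icc (hMpos n) (hcM n) hu))
        (Eventually.of_forall fun n =>
          fourierFreq_mem (hNpos n) (ceil_mul_mem_Icc (hNpos n) (hcN n) hx))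
        hN hM (by have := hx.1; positivity) (tendsto_fourierFreq hN hx.1.le)
  have hwb : ∀ n, ∀ j ∈ Finset.Icc 1 (M n), ∀ k ∈ Finset.Icc 1 (N n / 2),
      w n j k ^ 2 ≤ C ^ 2 * ((k : ℝ) / N n) ^ (-(4 * D)) := fun n j hj k hk =>
    (hpole.sq_le (hblock n j hj) (fourierFreq_mem (hNpos n) hk)).trans
      (mul_le_mul_of_nonneg_left (hpow n k hk) (sq_nonneg C))
  have hwlim : ∀ u ∈ Ioo (0 : ℝ) 1, ∀ x ∈ Ioo (0 : ℝ) (1 / 2),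
      Tendsto (fun n => w n ⌈u * M n⌉₊ ⌈x * N n⌉₊) atTop
        (𝓝 (spectralDensity ψ u (2 * Real.pi * x))) := by
    intro u hu x hx
    have hmem : (u, 2 * Real.pi * x) ∈ Icc (0 : ℝ) 1 ×ˢ Ioc 0 Real.pi :=
      ⟨Ioo_subset_Icc_self hu, by have := hx.1; positivity, by nlinarith [hx.2]⟩
    have hc : ContinuousWithinAt (fun p : ℝ × ℝ => spectralDensity ψ p.1 p.2)
      (Icc (0 : ℝ) 1 ×ˢ Ioc 0 Real.pi) (u, 2 * Real.pi * x) := hpole.continuousOn _ hmem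
    have hp : Tendsto (fun n => (blockMid (N n * M n) (N n) ⌈u * M n⌉₊,
        fourierFreq (N n) ⌈x * N n⌉₊)) atTop
        (𝓝[Icc (0 : ℝ) 1 ×ˢ Ioc 0 Real.pi] (u, 2 * Real.pi * x)) :=
      tendsto_nhdsWithin_iff.2
        ⟨(tendsto_blockMid hNpos hMpos hM hu.1.le).prodMk_nhds (tendsto_fourierFreq hN hx.1.le),
          Eventually.of_forall fun n => ⟨hblock n _ (ceil_mul_mem_Icc (hMpos n) (hcM n) hu),
            fourierFreq_mem (hNpos n) (ceil_mul_mem_Icc (hNpos n) (hcN n) hx)⟩⟩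
    have hcp := hc.tendsto.comp hp
    exact hcp
  have hF1 : Tendsto (fun n => ∫ ω, |F1hat (fun t => X t (N n * M n) ω) (N n * M n) (N n) (M n)
      - F1 (spectralDensity ψ)| ∂P) atTop (𝓝 0) := by
    simp_rw [F1hat_eq_gridAvg, ← hpole.riemann_limit_F1]
    exact tendsto_integral_abs_gridAvg_sq_sub hX.indep hX.gaussian hNpos hMpos hNeven hN hM
      (sq_nonneg C) (by linarith) (by linarith) hImem hSE hwb hwlim
  have hF2 : Tendsto (fun n => ∫ ω, |F2hat (fun t => X t (N n * M n) ω) (N n * M n) (N n) (M n)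
      - F2 (spectralDensity ψ)| ∂P) atTop (𝓝 0) := by
    simp_rw [F2hat_eq_avgSq, ← hpole.riemann_limit_F2]
    exact tendsto_integral_abs_avgSq_sub hX.indep hX.gaussian hNpos hMpos hNeven hM
      (sq_nonneg C) (by linarith) (by linarith) hImem hSE hwb hwlim
  have i1 : ∀ n, Integrable
      (fun ω => F1hat (fun t => X t (N n * M n) ω) (N n * M n) (N n) (M n)) P := fun n => by
    simp_rw [F1hat_eq_gridAvg]
    exact integrable_gridAvg fun j hj k hk => (hImem n j hj k hk).integrable_sq
  have i2 : ∀ n, Integrable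
      (fun ω => F2hat (fun t => X t (N n * M n) ω) (N n * M n) (N n) (M n)) P := fun n => by
    simp_rw [F2hat_eq_avgSq]
    exact integrable_avgSq (hImem n)
  refine ⟨hpole.integrableOn_sq, tendstoInMeasure_of_tendsto_integral_abs i1 hF1,
    tendstoInMeasure_of_tendsto_integral_abs i2 hF2,
    tendstoInMeasure_of_tendsto_integral_abs
      (fun n => ((i1 n).const_mul _).sub ((i2 n).const_mul _)) ?_⟩
  -- Both D̂² and D² are the same linear combination of their two components, so the L¹ errors
  -- simply add.
  have hlim := (hF1.const_mul (2 * Real.pi)).add (hF2.const_mul (4 * Real.pi))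
  simp only [mul_zero, add_zero] at hlim
  refine squeeze_zero (fun n => integral_nonneg fun ω => abs_nonneg _) (fun n => ?_) hlim
  have j1 := (((i1 n).sub (integrable_const (F1 (spectralDensity ψ)))).abs).const_mul
    (2 * Real.pi)
  have j2 := (((i2 n).sub (integrable_const (F2 (spectralDensity ψ)))).abs).const_mul
    (4 * Real.pi)
  rw [← integral_const_mul, ← integral_const_mul]
  refine (integral_mono_of_nonneg (Eventually.of_forall fun ω => abs_nonneg _) (j1.add j2)
    (Eventually.of_forall fun ω => ?_)).trans_eq (integral_add j1 j2)
  simp only [DsqHat, hpole.Dsq_eq, Pi.add_apply, Pi.sub_apply]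
  set x := F1hat (fun t => X t (N n * M n) ω) (N n * M n) (N n) (M n)
  set y := F2hat (fun t => X t (N n * M n) ω) (N n * M n) (N n) (M n)
  have e : 2 * Real.pi * x - 4 * Real.pi * y
      - (2 * Real.pi * F1 (spectralDensity ψ) - 4 * Real.pi * F2 (spectralDensity ψ))
      = 2 * Real.pi * (x - F1 (spectralDensity ψ)) - 4 * Real.pi * (y - F2 (spectralDensity ψ)) := by
    ring
  rw [e]
  refine (abs_sub _ _).trans_eq ?_
  rw [abs_mul (2 * Real.pi), abs_mul (4 * Real.pi), abs_of_pos (by positivity : (0 : ℝ) < 2 * Real.pi),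
    abs_of_pos (by positivity : (0 : ℝ) < 4 * Real.pi)]
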